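/- Let $l<r$ and $\rho>0$ be real, let $\mu\in C^3([l,r])$, $\sigma^2\in C^4([l,r])$ with $\sigma^2>0$ on $[l,r]$, and let $\kappa\in C^2([l,r])$ with $\kappa\ge 0$. These are the drift, squared volatility and killing rate of a diffusion on $[l,r]$ that is sticky at $l$ with stickiness $\rho$ and killed at $r$. Consider the Sturm–Liouville problem with the eigenparameter in the boundary condition $$\mu\varphi'+\tfrac12\sigma^2\varphi''-\kappa\varphi=-\lambda\varphi\ \text{ on }(l,r),\qquad \rho\varphi'(l)-(\kappa(l)-\lambda)\varphi(l)=0,\qquad \varphi(r)=0,$$ for $\varphi\in C^2([l,r])$, $\varphi\not\equiv0$. Its real eigenvalues form an infinite sequence $\lambda_1<\lambda_2<\cdots$. For a grid $l=x_0<x_1<\dots<x_n<x_{n+1}=r$ put $\delta^+x_i=x_{i+1}-x_i$ for $0\le i\le n$, $\delta^-x_i=x_i-x_{i-1}$ and $\delta x_i=\tfrac12(\delta^+x_i+\delta^-x_i)$ for $1\le i\le n$, and $h=\max_{0\le i\le n}\delta^+x_i$. Let $\mathbb G$ be the tridiagonal $(n+1)\times(n+1)$ matrix, indexed by $0,\dots,n$,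 with off-diagonal entries $\mathbb G_{i,i-1}=d_i$ for $1\le i\le n$ and $\mathbb G_{i,i+1}=u_i$ for $0\le i\le n-1$, and diagonal entries $\mathbb G_{i,i}=-d_i-u_i-\kappa(x_i)$, where $$d_0=0,\quad u_0=\frac{\rho\beta}{\delta^+x_0},\qquad d_i=\frac{-\mu(x_i)\delta^+x_i+\sigma^2(x_i)}{2\,\delta^-x_i\,\delta x_i},\quad u_i=\frac{\mu(x_i)\delta^-x_i+\sigma^2(x_i)}{2\,\delta^+x_i\,\delta x_i}\quad(1\le i\le n),$$ with $\beta=1$ in Scheme 1 and $\beta=\bigl(1+\frac{\rho-\mu(x_0)}{\sigma^2(x_0)}\delta^+x_0\bigr)^{-1}$ in Scheme 2. Put $\gamma=1$ for Scheme 1 and $\gamma=2$ for Scheme 2. For each of the two schemes and each $K$ there are constants $\delta>0$ and $C>0$ such that the following holds for every $n$ and every such grid with $h<\delta$ and $\max_{0\le i\le n}\delta^+x_i\le K\min_{0\le i\le n}\delta^+x_i$: the matrix $-\mathbb G$ has $n+1$ distinct real eigenvalues $\lambda_1^n<\dots<\lambda_{n+1}^n$, and for every integer $k$ with $1\le k\le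 h^{-1/4}$ one has $k\le n+1$ and $$|\lambda_k^n-\lambda_k|\le C\,k^4\,h^{\gamma}.$$ -/

import Mathlib

open Set

noncomputable section

/-- Coefficients of a diffusion on `[l, r]` that is sticky at `l` (stickiness `ρ`), killed at `r`,
with drift `μ`, volatility `σ` and killing rate `κ`. -/
structure StickyDiffusion where
  l : ℝ
  r : ℝ
  ρ : ℝ
  μ : ℝ → ℝ
  σ : ℝ → ℝ
  κ : ℝ → ℝ

namespace StickyDiffusion

/-- First derivative on `[l, r]` (one-sided at the end points). -/
def d1 (D : StickyDiffusion) (f : ℝ → ℝ) : ℝ → ℝ := derivWithin f (Icc D.l D.r)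

/-- Second derivative on `[l, r]` (one-sided at the end points). -/
def d2 (D : StickyDiffusion) (f : ℝ → ℝ) : ℝ → ℝ := D.d1 (D.d1 f)

/-- The generator in the interior, `𝒢 f = μ f' + ½ σ² f'' - κ f`. -/
def generator (D : StickyDiffusion) (f : ℝ → ℝ) (x : ℝ) : ℝ :=
  D.μ x * D.d1 f x + 1 / 2 * D.σ x ^ 2 * D.d2 f x - D.κ x * f x

/-- `φ` is an eigenfunction, for the eigenvalue `lam`, of the Sturm–Liouville problem
`𝒢 φ = -lam φ` on `(l, r)`, `ρ φ'(l) - (κ(l) - lam) φ(l) = 0`, `φ(r) = 0`. -/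
structure IsEigenpair (D : StickyDiffusion) (lam : ℝ) (φ : ℝ → ℝ) : Prop where
  smooth : ContDiffOn ℝ 2 φ (Icc D.l D.r)
  nonzero : ∃ x ∈ Icc D.l D.r, φ x ≠ 0
  interior : ∀ x ∈ Ioo D.l D.r, D.generator φ x = -lam * φ x
  sticky : D.ρ * D.d1 φ D.l - (D.κ D.l - lam) * φ D.l = 0
  killed : φ D.r = 0

/-- The set of eigenvalues of the Sturm–Liouville problem. -/
def eigenvalues (D : StickyDiffusion) : Set ℝ := {lam | ∃ φ, D.IsEigenpair lam φ}

end StickyDiffusion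

/-- A grid `l = x 0 < x 1 < ⋯ < x n < x (n + 1) = r`; values `x i` with `i > n + 1` play no role. -/
structure Grid (l r : ℝ) (n : ℕ) where
  x : ℕ → ℝ
  left : x 0 = l
  right : x (n + 1) = r
  lt_succ : ∀ i ≤ n, x i < x (i + 1)

namespace Grid

variable {l r : ℝ} {n : ℕ}

/-- Right step `δ⁺xᵢ`. -/
def stepR (g : Grid l r n) (i : ℕ) : ℝ := g.x (i + 1) - g.x i

/-- Left step `δ⁻xᵢ`; it is `0` for `i = 0`. -/
def stepL (g : Grid l r n) (i : ℕ) : ℝ := g.x i - g.x (i - 1)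

/-- Average step `δxᵢ`. -/
def step (g : Grid l r n) (i : ℕ) : ℝ := (g.stepR i + g.stepL i) / 2

/-- The mesh size `h = max_{0 ≤ i ≤ n} δ⁺xᵢ`. -/
def mesh (g : Grid l r n) : ℝ :=
  (Finset.range (n + 1)).sup' Finset.nonempty_range_add_one g.stepR

/-- The smallest step `min_{0 ≤ i ≤ n} δ⁺xᵢ`. -/
def minStep (g : Grid l r n) : ℝ :=
  (Finset.range (n + 1)).inf' Finset.nonempty_range_add_one g.stepR

end Grid

/-- The two discretizations of the sticky boundary. -/
inductive Scheme
  | one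
  | two

/-- The convergence order `γ`. -/
def Scheme.order : Scheme → ℕ
  | .one => 1
  | .two => 2

namespace StickyDiffusion

variable {n : ℕ}

/-- The boundary factor `β`. -/
def beta (D : StickyDiffusion) (g : Grid D.l D.r n) : Scheme → ℝ
  | .one => 1
  | .two => 1 / (1 + (D.ρ - D.μ (g.x 0)) / D.σ (g.x 0) ^ 2 * g.stepR 0)

/-- Rate of the jump `xᵢ → xᵢ₋₁`, for `0 ≤ i ≤ n`. -/
def rateDown (D : StickyDiffusion) (g : Grid D.l D.r n) (i : ℕ) : ℝ :=
  if i = 0 then 0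
  else (-D.μ (g.x i) * g.stepR i + D.σ (g.x i) ^ 2) / (2 * g.stepL i * g.step i)

/-- Rate of the jump `xᵢ → xᵢ₊₁`, for `0 ≤ i ≤ n` (for `i = n` it is the rate of killing
at `r`). -/
def rateUp (D : StickyDiffusion) (s : Scheme) (g : Grid D.l D.r n) (i : ℕ) : ℝ :=
  if i = 0 then D.ρ * D.beta g s / g.stepR 0
  else (D.μ (g.x i) * g.stepL i + D.σ (g.x i) ^ 2) / (2 * g.stepR i * g.step i)

/-- The tridiagonal generator matrix of the CTMC on the states `x 0, …, x n`. -/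
def generatorMatrix (D : StickyDiffusion) (s : Scheme) (g : Grid D.l D.r n) :
    Matrix (Fin (n + 1)) (Fin (n + 1)) ℝ :=
  fun i j =>
    if (j : ℕ) = i then -D.rateDown g i - D.rateUp s g i - D.κ (g.x i)
    else if (j : ℕ) + 1 = i then D.rateDown g i
    else if (j : ℕ) = i + 1 then D.rateUp s g i
    else 0

/-- The set of all `lam` with `𝔾 φ = -lam φ` for some `φ ≠ 0`. -/
def ctmcEigenvalues (D : StickyDiffusion) (s : Scheme) (g : Grid D.l D.r n) : Set ℝ :=
  {lam | Module.End.HasEigenvalue (Matrix.toLin' (D.generatorMatrix s g)) (-lam)}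

end StickyDiffusion

/-- `lam k`, `k ∈ I`, lists the elements of `Λ` in strictly increasing order, without omission. -/
def IsIncreasingEnumeration (I : Set ℕ) (lam : ℕ → ℝ) (Λ : Set ℝ) : Prop :=
  StrictMonoOn lam I ∧ lam '' I = Λ

end

/-! Multiplying the equation by the speed density `w = p / σ²`, where `p` is the reciprocal scale
density, makes the problem self-adjoint: `(p φ' / 2)' = w (κ - λ) φ`, and the sticky condition
becomes an atom of mass `1 / (2ρ)` at `l`. The eigenvalues belong to the quotient of the energy `∫ p
φ'² / 2 + ∫ w κ φ² + κ(l) φ(l)² / (2ρ)` by the mass `∫ w φ² + φ(l)² / (2ρ)`. The matrix is symmetric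
for the weights `nodeMass`, with conductances `condWeight / (2 gap)`, so its eigenvalues belong to a
quotient of the same shape. The proof compares these quotients on finite-dimensional spaces.

The differential problem is solved by the Prüfer angle. Its value at `r` is continuous and strictly
increasing in `λ`, and the eigenvalues are where it meets `π, 2π, …`. The `k`-th eigenfunction has
at most `k - 1` zeros in `[l, r)`; Picone's inequality for a parabola on an interval of length `(r -
l) / k` free of zeros gives `λ_k ≤ C k²` (`exists_growth_bound`).

For the upper bound (`exists_eig_upper`), a combination of the first `k` eigenfunctions is sampled
on the grid so as to be orthogonal to the first `k - 1` eigenvectors. For the lower bound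
(`exists_eig_lower`), a combination of the first `k` eigenvectors is interpolated affinely so as to
vanish at the zeros of the `k`-th eigenfunction; Picone's inequality then makes energy minus `λ_k`
times mass nonnegative. Thus completeness of the eigenfunctions is never needed.

The forms are compared in `exists_mass_consistency`, `exists_dirichlet_upper` and
`exists_dirichlet_affine`, all resting on `exists_condWeight_bound`. Interior errors are `O(h²)`;
the scheme enters only through the weight of node `0`, whose error is `O(h^γ)`
(`exists_boundary_bound`). With `ε` of order `h^γ`, each form is perturbed by `ε` times the energy.
An error in the energy costs `ε λ` and one in the mass costs `ε λ²`, so `|λ_k^n - λ_k| ≤ C ε (λ_k +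
λ_k²)`, which is `O(k⁴ h^γ)`. The restriction `k ≤ h^(-1/4)` keeps `ε λ_k` small. -/

noncomputable section

open MeasureTheory intervalIntegral Filter Topology

/-! ### Calculus on an interval -/

/-- A function of class `C^n` on a compact interval extends to a function of class `C^n` on `ℝ`. -/
theorem exists_contDiff_extension {l r : ℝ} (hlr : l < r) (n : ℕ) :
    ∀ {f : ℝ → ℝ}, ContDiffOn ℝ n f (Icc l r) → ∃ F : ℝ → ℝ, ContDiff ℝ n F ∧ EqOn F f (Icc l r) := by
  induction n with
  | zero =>
    intro f hf
    refine ⟨fun x => f (projIcc l r hlr.le x), ?_, fun x hx => by simp [projIcc_of_mem hlr.le hx]⟩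
    rw [Nat.cast_zero, contDiff_zero]
    exact hf.continuousOn.comp_continuous (by fun_prop) fun x => (projIcc l r hlr.le x).2
  | succ n ih =>
    intro f hf
    have hu := uniqueDiffOn_Icc hlr
    -- Extend the derivative first and integrate: the primitive normalised at `l` gains one order of
    -- smoothness.
    obtain ⟨G, hG, hGf⟩ := ih (hf.derivWithin hu (m := n) (by norm_cast))
    have hder : ∀ x, HasDerivAt (fun x => f l + ∫ t in l..x, G t) (G x) x := fun x =>
      ((hG.continuous.integral_hasStrictDerivAt l x).hasDerivAt).const_add _
    refine ⟨fun x => f l + ∫ t in l..x, G t, ?_, fun x hx => ?_⟩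
    · rw [Nat.cast_add, Nat.cast_one, contDiff_succ_iff_deriv]
      refine ⟨fun x => (hder x).differentiableAt, by simp, ?_⟩
      rwa [show deriv (fun x => f l + ∫ t in l..x, G t) = G from funext fun x => (hder x).deriv]
    · have hfd : DifferentiableOn ℝ f (Icc l r) := hf.differentiableOn (by simp)
      have h1 : ∫ t in l..x, G t = f x - f l := by
        refine integral_eq_sub_of_hasDerivAt_of_le hx.1
          (hf.continuousOn.mono (Icc_subset_Icc_right hx.2)) (fun y hy => ?_)
          (hG.continuous.intervalIntegrable _ _)
        have hy' : y ∈ Icc l r := ⟨hy.1.le, hy.2.le.trans hx.2⟩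
        rw [hGf hy']
        exact (hfd y hy').hasDerivWithinAt.hasDerivAt (Icc_mem_nhds hy.1 (hy.2.trans_le hx.2))
      simp [h1]

/-- The trapezoidal rule with integral remainder. -/
theorem trapezoid_identity {a b : ℝ} (hab : a ≤ b) {f f' f'' : ℝ → ℝ}
    (hf : ∀ x ∈ Icc a b, HasDerivAt f (f' x) x) (hf' : ∀ x ∈ Icc a b, HasDerivAt f' (f'' x) x)
    (hc : Continuous f'') :
    (b - a) / 2 * (f a + f b) - ∫ x in a..b, f x = ∫ x in a..b, (x - a) * (b - x) / 2 * f'' x := by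
  have hcf : ContinuousOn f (Icc a b) := fun x hx => (hf x hx).continuousAt.continuousWithinAt
  have hI : IntervalIntegrable f volume a b := hcf.intervalIntegrable_of_Icc hab
  have hI2 : IntervalIntegrable (fun x => (x - a) * (b - x) / 2 * f'' x) volume a b :=
    Continuous.intervalIntegrable (by fun_prop) _ _
  -- Two integrations by parts at once: the kernel `(x - a)(b - x) / 2` vanishes at both ends and
  -- has derivative `(a + b) / 2 - x`, so only the second term of the primitive leaves boundary
  -- values, namely the trapezoidal ones.
  have hH : ∫ x in a..b, (f x + (x - a) * (b - x) / 2 * f'' x) =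
      ((b - a) * (b - b) / 2 * f' b + (b - (a + b) / 2) * f b) -
      ((a - a) * (b - a) / 2 * f' a + (a - (a + b) / 2) * f a) := by
    refine integral_eq_sub_of_hasDerivAt
      (f := fun x => (x - a) * (b - x) / 2 * f' x + (x - (a + b) / 2) * f x) (fun x hx => ?_) (hI.add hI2)
    rw [uIcc_of_le hab] at hx
    have h1 : HasDerivAt (fun x => (x - a) * (b - x) / 2) ((1 * (b - x) + (x - a) * (-1)) / 2) x :=
      ((((hasDerivAt_id x).sub_const a).mul ((hasDerivAt_id x).const_sub b)).div_const 2)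
    have h2 : HasDerivAt (fun x => x - (a + b) / 2) 1 x := (hasDerivAt_id x).sub_const _
    refine ((h1.mul (hf' x hx)).add (h2.mul (hf x hx))).congr_deriv ?_
    ring
  rw [integral_add hI hI2] at hH
  linarith

/-- The remainder is kept as an integral of `|f''|`, not a supremum, so that summation over cells
leaves an integral norm that the energy can control. -/
theorem trapezoid_error_le {a b : ℝ} (hab : a ≤ b) {f f' f'' : ℝ → ℝ}
    (hf : ∀ x ∈ Icc a b, HasDerivAt f (f' x) x) (hf' : ∀ x ∈ Icc a b, HasDerivAt f' (f'' x) x)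
    (hc : Continuous f'') :
    |(b - a) / 2 * (f a + f b) - ∫ x in a..b, f x| ≤ (b - a) ^ 2 * ∫ x in a..b, |f'' x| := by
  rw [trapezoid_identity hab hf hf' hc, ← intervalIntegral.integral_const_mul]
  refine (abs_integral_le_integral_abs hab).trans (integral_mono_on hab
    (Continuous.intervalIntegrable (by fun_prop) _ _)
    (Continuous.intervalIntegrable (by fun_prop) _ _) fun x hx => ?_)
  rw [abs_mul]
  refine mul_le_mul_of_nonneg_right ?_ (abs_nonneg _)
  have h1 : 0 ≤ x - a := sub_nonneg.2 hx.1
  have h2 : 0 ≤ b - x := sub_nonneg.2 hx.2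
  rw [abs_of_nonneg (by positivity)]
  nlinarith [mul_nonneg h1 h2]

theorem abs_sub_le_integral_abs_deriv {a b : ℝ} (hab : a ≤ b) {f f' : ℝ → ℝ}
    (hf : ∀ x ∈ Icc a b, HasDerivAt f (f' x) x) (hc : Continuous f') :
    |f b - f a| ≤ ∫ x in a..b, |f' x| := by
  rw [← integral_eq_sub_of_hasDerivAt (fun x hx => hf x (by rwa [uIcc_of_le hab] at hx))
    (hc.intervalIntegrable _ _)]
  exact abs_integral_le_integral_abs hab

/-- A continuous function is bounded on a compact interval, with a nonnegative bound. -/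
theorem exists_abs_le_on_Icc {f : ℝ → ℝ} (hf : Continuous f) (l r : ℝ) :
    ∃ B, 0 ≤ B ∧ ∀ x ∈ Icc l r, |f x| ≤ B := by
  obtain ⟨B, hB⟩ := isCompact_Icc.exists_bound_of_continuousOn (s := Icc l r) hf.continuousOn
  exact ⟨max B 0, le_max_right _ _, fun x hx => (hB x hx).trans (le_max_left _ _)⟩

theorem exists_pos_le_on_Icc {f : ℝ → ℝ} (hf : Continuous f) {l r : ℝ} (hlr : l ≤ r)
    (hpos : ∀ x ∈ Icc l r, 0 < f x) : ∃ b, 0 < b ∧ ∀ x ∈ Icc l r, b ≤ f x := by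
  obtain ⟨x, hx, hmin⟩ := isCompact_Icc.exists_isMinOn (nonempty_Icc.2 hlr) hf.continuousOn
  exact ⟨f x, hpos x hx, fun y hy => hmin hy⟩

/-- First order Taylor expansion with a uniform quadratic remainder. -/
theorem exists_taylor_bound {f : ℝ → ℝ} (hf : ContDiff ℝ 2 f) (l r : ℝ) :
    ∃ B, 0 ≤ B ∧ ∀ a ∈ Icc l r, ∀ b ∈ Icc l r, a ≤ b →
      |f b - f a - deriv f a * (b - a)| ≤ B * (b - a) ^ 2 := by
  have h1 : ContDiff ℝ 1 (deriv f) := (contDiff_succ_iff_deriv (n := 1).1 hf).2.2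
  have h2 : Continuous (deriv (deriv f)) := h1.continuous_deriv le_rfl
  obtain ⟨B, hB0, hB⟩ := exists_abs_le_on_Icc h2 l r
  refine ⟨B, hB0, fun a ha b hb hab => ?_⟩
  have hd : ∀ x, HasDerivAt f (deriv f x) x := fun x =>
    (hf.differentiable (by simp) x).hasDerivAt
  have hd' : ∀ x, HasDerivAt (deriv f) (deriv (deriv f) x) x := fun x =>
    (h1.differentiable (by simp) x).hasDerivAt
  have hb1 : ∀ x ∈ Icc a b, |deriv f x - deriv f a| ≤ B * (b - a) := fun x hx => by
    have := Convex.norm_image_sub_le_of_norm_hasDerivWithin_le (f := deriv f)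
      (f' := deriv (deriv f)) (s := Icc a b) (C := B) (x := a) (y := x)
      (fun y _ => (hd' y).hasDerivWithinAt)
      (fun y hy => hB y ⟨ha.1.trans hy.1, hy.2.trans hb.2⟩) (convex_Icc a b) ⟨le_rfl, hab⟩ hx
    rw [Real.norm_eq_abs, Real.norm_eq_abs, abs_of_nonneg (sub_nonneg.2 hx.1)] at this
    exact this.trans (mul_le_mul_of_nonneg_left (by linarith [hx.2]) hB0)
  have hd3 : ∀ x, HasDerivAt (fun x => f x - deriv f a * (x - a)) (deriv f x - deriv f a) x :=
    fun x => ((hd x).sub (((hasDerivAt_id x).sub_const a).const_mul (deriv f a))).congr_deriv (by ring)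
  have := Convex.norm_image_sub_le_of_norm_hasDerivWithin_le
    (f := fun x => f x - deriv f a * (x - a))
    (f' := fun x => deriv f x - deriv f a) (s := Icc a b) (C := B * (b - a)) (x := a) (y := b)
    (fun y _ => (hd3 y).hasDerivWithinAt)
    hb1 (convex_Icc a b) ⟨le_rfl, hab⟩ ⟨hab, le_rfl⟩
  rw [Real.norm_eq_abs, Real.norm_eq_abs, abs_of_nonneg (sub_nonneg.2 hab)] at this
  calc _ = |f b - deriv f a * (b - a) - (f a - deriv f a * (a - a))| := by congr 1; ring
    _ ≤ _ := this
    _ = _ := by ring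

/-- The mean of a `C²` function over a short interval, up to second order. -/
theorem exists_integral_taylor_bound {f : ℝ → ℝ} (hf : ContDiff ℝ 2 f) (l r : ℝ) :
    ∃ B, 0 ≤ B ∧ ∀ a ∈ Icc l r, ∀ b ∈ Icc l r, a ≤ b →
      |(∫ x in a..b, f x) - (b - a) * (f a + deriv f a * (b - a) / 2)| ≤ B * (b - a) ^ 3 := by
  obtain ⟨B, hB0, hB⟩ := exists_taylor_bound hf l r
  refine ⟨B, hB0, fun a ha b hb hab => ?_⟩
  have hc := hf.continuous
  have h1 : ∫ x in a..b, (f a + deriv f a * (x - a)) = (b - a) * (f a + deriv f a * (b - a) / 2) := by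
    rw [integral_eq_sub_of_hasDerivAt (f := fun x => f a * x + deriv f a * (x - a) ^ 2 / 2)
      (fun x _ => ?_) (Continuous.intervalIntegrable (by fun_prop) _ _)]
    · ring
    · refine (((hasDerivAt_id x).const_mul (f a)).add
        (((((hasDerivAt_id x).sub_const a).pow 2).const_mul (deriv f a)).div_const 2)).congr_deriv ?_
      simp; ring
  rw [← h1, ← integral_sub (hc.intervalIntegrable _ _) (Continuous.intervalIntegrable (by fun_prop) _ _)]
  have h2 := norm_integral_le_of_norm_le_const (a := a) (b := b) (C := B * (b - a) ^ 2)
    (f := fun x => f x - (f a + deriv f a * (x - a))) (fun x hx => by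
      rw [uIoc_of_le hab] at hx
      rw [Real.norm_eq_abs]
      calc _ = |f x - f a - deriv f a * (x - a)| := by congr 1; ring
        _ ≤ B * (x - a) ^ 2 := hB a ha x ⟨ha.1.trans hx.1.le, hx.2.trans hb.2⟩ hx.1.le
        _ ≤ _ := by
          have := hx.1; have := hx.2
          gcongr)
  rw [Real.norm_eq_abs, abs_of_nonneg (sub_nonneg.2 hab)] at h2
  calc _ ≤ _ := h2
    _ = _ := by ring

/-- Uniform trapezoidal rule for a fixed `C²` function. -/
theorem exists_trapezoid_bound {f : ℝ → ℝ} (hf : ContDiff ℝ 2 f) (l r : ℝ) :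
    ∃ B, 0 ≤ B ∧ ∀ a ∈ Icc l r, ∀ b ∈ Icc l r, a ≤ b →
      |(b - a) / 2 * (f a + f b) - ∫ x in a..b, f x| ≤ B * (b - a) ^ 3 := by
  have h1 : ContDiff ℝ 1 (deriv f) := (contDiff_succ_iff_deriv (n := 1).1 hf).2.2
  have h2 : Continuous (deriv (deriv f)) := h1.continuous_deriv le_rfl
  obtain ⟨B, hB0, hB⟩ := exists_abs_le_on_Icc h2 l r
  refine ⟨B, hB0, fun a ha b hb hab => ?_⟩
  refine (trapezoid_error_le hab (fun x _ => (hf.differentiable (by simp) x).hasDerivAt)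
    (fun x _ => (h1.differentiable (by simp) x).hasDerivAt) h2).trans ?_
  have h3 : ∫ x in a..b, |deriv (deriv f) x| ≤ ∫ x in a..b, B :=
    integral_mono_on hab (h2.abs.intervalIntegrable _ _) (by simp)
      (fun x hx => hB x ⟨ha.1.trans hx.1, hx.2.trans hb.2⟩)
  rw [intervalIntegral.integral_const, smul_eq_mul] at h3
  calc _ ≤ (b - a) ^ 2 * ((b - a) * B) := by gcongr
    _ = _ := by ring

/-- If `g' ≥ -A |g|` and `g a > 0`, then `g > 0` afterwards. -/
theorem pos_of_deriv_ge_neg_mul_abs {a b A : ℝ} {g g' : ℝ → ℝ}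
    (hg : ∀ x ∈ Icc a b, HasDerivAt g (g' x) x)
    (hg' : ∀ x ∈ Icc a b, -(A * |g x|) ≤ g' x) (ha : 0 < g a) :
    ∀ x ∈ Icc a b, 0 < g x := by
  intro x hx
  -- The barrier decays at rate `A + 1`, faster than the hypothesis allows for `g` at a contact
  -- point; this supplies the strict inequality required by the comparison theorem.
  have hB : ∀ x, HasDerivAt (fun x => -(g a * Real.exp (-(A + 1) * (x - a))))
      (-(g a * (Real.exp (-(A + 1) * (x - a)) * (-(A + 1) * 1)))) x := fun x =>
    ((((((hasDerivAt_id x).sub_const a).const_mul (-(A + 1))).exp).const_mul (g a)).neg)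
  have := image_le_of_deriv_right_lt_deriv_boundary' (f := fun x => -g x) (f' := fun x => -g' x)
    (a := a) (b := b) (B := fun x => -(g a * Real.exp (-(A + 1) * (x - a))))
    (B' := fun x => -(g a * (Real.exp (-(A + 1) * (x - a)) * (-(A + 1) * 1))))
    (fun x hx => (hg x hx).neg.continuousAt.continuousWithinAt)
    (fun x hx => (hg x ⟨hx.1, hx.2.le⟩).neg.hasDerivWithinAt) (by simp)
    (fun x _ => (hB x).continuousAt.continuousWithinAt)
    (fun x _ => (hB x).hasDerivWithinAt) (fun x hx heq => by
      have h1 := hg' x ⟨hx.1, hx.2.le⟩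
      have h2 : g x = g a * Real.exp (-(A + 1) * (x - a)) := neg_injective heq
      have h3 : 0 < g x := by rw [h2]; positivity
      rw [abs_of_pos h3] at h1
      have h4 : -(g a * (Real.exp (-(A + 1) * (x - a)) * (-(A + 1) * 1))) = (A + 1) * g x := by
        rw [h2]; ring
      simp only [h4]
      linarith) hx
  have h5 : 0 < g a * Real.exp (-(A + 1) * (x - a)) := by positivity
  simp only [neg_le_neg_iff] at this
  linarith

/-- If `g' ≥ -A |g|` and `g a ≥ 0`, then `g ≥ 0` afterwards. -/
theorem nonneg_of_deriv_ge_neg_mul_abs {a b A : ℝ} {g g' : ℝ → ℝ}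
    (hg : ∀ x ∈ Icc a b, HasDerivAt g (g' x) x)
    (hg' : ∀ x ∈ Icc a b, -(A * |g x|) ≤ g' x) (ha : 0 ≤ g a) :
    ∀ x ∈ Icc a b, 0 ≤ g x := by
  intro x hx
  -- Since `g a` may be `0`, the barrier is an arbitrarily small multiple of a growing exponential;
  -- the multiple is chosen at the end to contradict `g x < 0`.
  have key : ∀ ε > 0, -g x ≤ ε * Real.exp ((A + 1) * (x - a)) := by
    intro ε hε
    have hB : ∀ x, HasDerivAt (fun x => ε * Real.exp ((A + 1) * (x - a)))
        (ε * (Real.exp ((A + 1) * (x - a)) * ((A + 1) * 1))) x := fun x =>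
      (((((hasDerivAt_id x).sub_const a).const_mul (A + 1)).exp).const_mul ε)
    refine image_le_of_deriv_right_lt_deriv_boundary' (f := fun x => -g x) (f' := fun x => -g' x)
      (a := a) (b := b) (B := fun x => ε * Real.exp ((A + 1) * (x - a)))
      (B' := fun x => ε * (Real.exp ((A + 1) * (x - a)) * ((A + 1) * 1)))
      (fun x hx => (hg x hx).neg.continuousAt.continuousWithinAt)
      (fun x hx => (hg x ⟨hx.1, hx.2.le⟩).neg.hasDerivWithinAt) (by simp; linarith)
      (fun x _ => (hB x).continuousAt.continuousWithinAt)
      (fun x _ => (hB x).hasDerivWithinAt) (fun x hx heq => ?_) hx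
    have h1 := hg' x ⟨hx.1, hx.2.le⟩
    have h2 : -g x = ε * Real.exp ((A + 1) * (x - a)) := heq
    have h3 : 0 < -g x := by rw [h2]; positivity
    rw [abs_of_neg (by linarith)] at h1
    have h4 : ε * (Real.exp ((A + 1) * (x - a)) * ((A + 1) * 1)) = (A + 1) * -g x := by
      rw [h2]; ring
    simp only [h4]
    linarith
  by_contra! hneg
  have h5 := key (-g x / 2 / Real.exp ((A + 1) * (x - a))) (by
    have := Real.exp_pos ((A + 1) * (x - a))
    have : 0 < -g x := by linarith
    positivity)
  rw [div_mul_cancel₀ _ (Real.exp_pos _).ne'] at h5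
  linarith

/-- The difference factors as `sin (a + b) sin (a - b)`. This makes the Prüfer field Lipschitz in
the angle, with constant `|pruferCoeff|`. -/
theorem abs_sin_sq_sub_sin_sq_le (a b : ℝ) : |Real.sin a ^ 2 - Real.sin b ^ 2| ≤ |a - b| := by
  have h : Real.sin a ^ 2 - Real.sin b ^ 2 = Real.sin (a + b) * Real.sin (a - b) := by
    rw [Real.sin_add, Real.sin_sub]
    have h1 := Real.sin_sq_add_cos_sq a
    have h2 := Real.sin_sq_add_cos_sq b
    linear_combination (Real.sin b) ^ 2 * h1 - (Real.sin a) ^ 2 * h2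
  rw [h, abs_mul]
  calc _ ≤ 1 * |a - b| := mul_le_mul (Real.abs_sin_le_one _) Real.abs_sin_le_abs (abs_nonneg _) zero_le_one
    _ = _ := one_mul _

/-- Fewer linear conditions than unknowns leave a nonzero solution. -/
theorem exists_ne_zero_forall_sum_eq_zero {ι τ : Type*} [Fintype ι] [Fintype τ]
    (hcard : Fintype.card ι < Fintype.card τ) (L : ι → τ → ℝ) :
    ∃ c : τ → ℝ, c ≠ 0 ∧ ∀ i, ∑ t, c t * L i t = 0 := by
  have h : (Matrix.mulVecLin (Matrix.of L)).ker ≠ ⊥ :=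
    LinearMap.ker_ne_bot_of_finrank_lt (by simpa using hcard)
  obtain ⟨c, hc, hc0⟩ := (Submodule.ne_bot_iff _).1 h
  refine ⟨c, hc0, fun i => ?_⟩
  have := congrFun (LinearMap.mem_ker.1 hc) i
  simpa [Matrix.mulVec, dotProduct, mul_comm] using this

/-- Cauchy–Schwarz for interval integrals of continuous functions. -/
theorem sq_integral_mul_le {a b : ℝ} (hab : a ≤ b) {f g : ℝ → ℝ} (hf : Continuous f)
    (hg : Continuous g) :
    (∫ x in a..b, f x * g x) ^ 2 ≤ (∫ x in a..b, f x ^ 2) * ∫ x in a..b, g x ^ 2 := by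
  have hq : ∀ t : ℝ, 0 ≤ (∫ x in a..b, g x ^ 2) * (t * t) + (2 * ∫ x in a..b, f x * g x) * t +
      ∫ x in a..b, f x ^ 2 := fun t => by
    have h0 : 0 ≤ ∫ x in a..b, (f x + t * g x) ^ 2 :=
      integral_nonneg hab fun x _ => sq_nonneg _
    have h1 : ∫ x in a..b, (f x + t * g x) ^ 2 =
        ∫ x in a..b, ((t * t) * g x ^ 2 + (2 * t) * (f x * g x) + f x ^ 2) := by
      congr 1; ext x; ring
    rw [h1, integral_add (Continuous.intervalIntegrable (by fun_prop) _ _)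
      (Continuous.intervalIntegrable (by fun_prop) _ _),
      integral_add (Continuous.intervalIntegrable (by fun_prop) _ _)
      (Continuous.intervalIntegrable (by fun_prop) _ _), intervalIntegral.integral_const_mul,
      intervalIntegral.integral_const_mul] at h0
    linarith
  have := discrim_le_zero hq
  rw [discrim] at this
  nlinarith

/-! ### The Sturm–Liouville problem in self-adjoint form -/

/-- Globally defined coefficients `c = μ / σ²`, `s = 1 / σ²`, `κ` of the sticky problem. -/
structure StickyCoeff where
  l : ℝ
  r : ℝ
  ρ : ℝ
  c : ℝ → ℝ
  s : ℝ → ℝ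
  κ : ℝ → ℝ
  hlr : l < r
  hρ : 0 < ρ
  hc : ContDiff ℝ 2 c
  hs : ContDiff ℝ 2 s
  hκ : ContDiff ℝ 2 κ
  s_pos : ∀ x ∈ Icc l r, 0 < s x
  κ_nonneg : ∀ x ∈ Icc l r, 0 ≤ κ x

namespace StickyCoeff

variable (S : StickyCoeff)

/-- Reciprocal scale density. -/
def p (x : ℝ) : ℝ := Real.exp (∫ t in S.l..x, 2 * S.c t)

/-- Speed density. -/
def w (x : ℝ) : ℝ := S.p x * S.s x

theorem p_pos (x : ℝ) : 0 < S.p x := Real.exp_pos _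

theorem p_left : S.p S.l = 1 := by simp [p]

theorem l_mem : S.l ∈ Icc S.l S.r := ⟨le_rfl, S.hlr.le⟩

theorem r_mem : S.r ∈ Icc S.l S.r := ⟨S.hlr.le, le_rfl⟩

theorem w_pos {x : ℝ} (hx : x ∈ Icc S.l S.r) : 0 < S.w x := mul_pos (S.p_pos x) (S.s_pos x hx)

theorem continuous_c : Continuous S.c := S.hc.continuous

theorem continuous_s : Continuous S.s := S.hs.continuous

theorem continuous_κ : Continuous S.κ := S.hκ.continuous

theorem hasDerivAt_p (x : ℝ) : HasDerivAt S.p (2 * S.c x * S.p x) x := by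
  have h : Continuous fun t => 2 * S.c t := continuous_const.mul S.continuous_c
  exact ((h.integral_hasStrictDerivAt S.l x).hasDerivAt.exp).congr_deriv (mul_comm _ _)

theorem continuous_p : Continuous S.p :=
  continuous_iff_continuousAt.2 fun x => (S.hasDerivAt_p x).continuousAt

theorem deriv_p : deriv S.p = fun x => 2 * S.c x * S.p x := funext fun x => (S.hasDerivAt_p x).deriv

theorem contDiff_p : ContDiff ℝ 2 S.p := by
  have h1 : ContDiff ℝ 1 S.p := by
    rw [contDiff_one_iff_deriv, S.deriv_p]
    exact ⟨fun x => (S.hasDerivAt_p x).differentiableAt,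
      (continuous_const.mul S.continuous_c).mul S.continuous_p⟩
  rw [show (2 : WithTop ℕ∞) = 1 + 1 by norm_num, contDiff_succ_iff_deriv, S.deriv_p]
  exact ⟨fun x => (S.hasDerivAt_p x).differentiableAt, by simp,
    (contDiff_const.mul (S.hc.of_le (by norm_num))).mul h1⟩

theorem contDiff_w : ContDiff ℝ 2 S.w := S.contDiff_p.mul S.hs

theorem continuous_w : Continuous S.w := S.contDiff_w.continuous

/-- The pair `(φ, ψ)` with `ψ = p φ' / 2` solves the equation with parameter `lam` on `[l, r]` and
satisfies the boundary condition at `l`. -/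
structure IsSolution (lam : ℝ) (φ ψ : ℝ → ℝ) : Prop where
  cont_fst : Continuous φ
  cont_snd : Continuous ψ
  deriv_fst : ∀ x ∈ Icc S.l S.r, HasDerivAt φ (2 * ψ x / S.p x) x
  deriv_snd : ∀ x ∈ Icc S.l S.r, HasDerivAt ψ (S.w x * (S.κ x - lam) * φ x) x
  ne_zero : ∀ x ∈ Icc S.l S.r, φ x = 0 → ψ x ≠ 0
  left : 2 * S.ρ * ψ S.l = (S.κ S.l - lam) * φ S.l

/-- Picone's inequality. -/
theorem IsSolution.picone {lam : ℝ} {φ ψ : ℝ → ℝ} (h : S.IsSolution lam φ ψ) {a b : ℝ} (hab : a ≤ b)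
    (ha : S.l ≤ a) (hb : b ≤ S.r) {U U' : ℝ → ℝ} (hU : ∀ x, HasDerivAt U (U' x) x)
    (hU' : Continuous U') (hz : ∀ x ∈ Icc a b, φ x = 0 → U x = 0) :
    ψ b * U b ^ 2 / φ b - ψ a * U a ^ 2 / φ a ≤
      ∫ x in a..b, (S.p x / 2 * U' x ^ 2 + S.w x * (S.κ x - lam) * U x ^ 2) := by
  have hmem : ∀ x ∈ Icc a b, x ∈ Icc S.l S.r := fun x hx => ⟨ha.trans hx.1, hx.2.trans hb⟩
  have hcU : Continuous U := continuous_iff_continuousAt.2 fun x => (hU x).continuousAt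
  -- Picone's identity: the derivative falls short of the integrand by a multiple of a square. At a
  -- zero of `φ` the quotient has the default value `0`, which is also its limit: the zero is simple
  -- because `ψ ≠ 0` there, while `U ^ 2` vanishes to second order. The derivative there comes from
  -- the slopes of `U` and `φ`.
  have hder : ∀ x ∈ Icc a b, HasDerivAt (fun x => ψ x * U x ^ 2 / φ x)
      (S.p x / 2 * U' x ^ 2 + S.w x * (S.κ x - lam) * U x ^ 2 -
        S.p x / 2 * (if φ x = 0 then 0 else U' x - 2 * ψ x * U x / (S.p x * φ x)) ^ 2) x := by
    intro x hx
    have hp := (S.p_pos x).ne'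
    have h1 := h.deriv_fst x (hmem x hx)
    have h2 := h.deriv_snd x (hmem x hx)
    by_cases h0 : φ x = 0
    · have hψ := h.ne_zero x (hmem x hx) h0
      have hUx := hz x hx h0
      rw [hasDerivAt_iff_tendsto_slope]
      have t1 := hasDerivAt_iff_tendsto_slope.1 h1
      have t2 := hasDerivAt_iff_tendsto_slope.1 (hU x)
      have t3 : Tendsto ψ (𝓝[≠] x) (𝓝 (ψ x)) := h2.continuousAt.mono_left nhdsWithin_le_nhds
      have t4 := (t3.mul (t2.pow 2)).div t1 (by positivity)
      have e1 : ψ x * U' x ^ 2 / (2 * ψ x / S.p x) = S.p x / 2 * U' x ^ 2 +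
          S.w x * (S.κ x - lam) * U x ^ 2 -
        S.p x / 2 * (if φ x = 0 then 0 else U' x - 2 * ψ x * U x / (S.p x * φ x)) ^ 2 := by
        rw [if_pos h0, hUx]; field_simp; ring
      rw [← e1]
      refine t4.congr' ?_
      filter_upwards [self_mem_nhdsWithin] with y hy
      have hy' : y - x ≠ 0 := sub_ne_zero.2 hy
      simp only [slope_def_field, Pi.div_apply, hUx, h0]
      by_cases hφy : φ y = 0
      · simp [hφy]
      · field_simp
        ring
    · rw [if_neg h0]
      refine ((h2.mul ((hU x).pow 2)).div h1 h0).congr_deriv ?_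
      simp only [Pi.mul_apply, Pi.pow_apply]
      field_simp
      ring
  refine sub_le_integral_of_hasDeriv_right_of_le hab
    (fun x hx => (hder x hx).continuousAt.continuousWithinAt)
    (fun x hx => (hder x (Ioo_subset_Icc_self hx)).hasDerivWithinAt) ?_ (fun x _ => ?_)
  · have := S.continuous_p; have := S.continuous_w; have := S.continuous_κ
    exact Continuous.integrableOn_Icc (by fun_prop)
  · have := S.p_pos x
    have : 0 ≤ S.p x / 2 * (if φ x = 0 then 0 else U' x - 2 * ψ x * U x / (S.p x * φ x)) ^ 2 := by
      positivity
    linarith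

/-! ### The Prüfer angle -/

/-- Coefficient of `sin²` in the Prüfer equation. -/
def pruferCoeff (lam x : ℝ) : ℝ := 2 / S.p x + S.w x * (S.κ x - lam)

/-- Right-hand side of the Prüfer equation. -/
def pruferField (lam x t : ℝ) : ℝ := 2 / S.p x - S.pruferCoeff lam x * Real.sin t ^ 2

/-- Initial Prüfer angle. -/
def angleLeft (lam : ℝ) : ℝ := Real.pi / 2 - Real.arctan ((S.κ S.l - lam) / (2 * S.ρ))

theorem continuous_pruferCoeff (lam : ℝ) : Continuous (S.pruferCoeff lam) := by
  have := S.continuous_p; have := S.continuous_w; have := S.continuous_κ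
  unfold pruferCoeff
  have : ∀ x, S.p x ≠ 0 := fun x => (S.p_pos x).ne'
  fun_prop (disch := assumption)

/-- The field is bounded and globally Lipschitz in the angle, so a single application of
Picard–Lindelöf covers the whole interval. It is made on `[l - 1, r + 1]` to obtain two-sided
derivatives at `l` and `r`. -/
theorem exists_angle (lam : ℝ) : ∃ θ : ℝ → ℝ, Continuous θ ∧ θ S.l = S.angleLeft lam ∧
    ∀ x ∈ Icc S.l S.r, HasDerivAt θ (S.pruferField lam x (θ x)) x := by
  have hlr := S.hlr
  obtain ⟨A, hA0, hA⟩ := exists_abs_le_on_Icc (S.continuous_pruferCoeff lam) (S.l - 1) (S.r + 1)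
  have hcp : Continuous fun x => 2 / S.p x :=
    continuous_const.div S.continuous_p fun x => (S.p_pos x).ne'
  obtain ⟨B, hB0, hB⟩ := exists_abs_le_on_Icc hcp (S.l - 1) (S.r + 1)
  have hPL : IsPicardLindelof (S.pruferField lam) (tmin := S.l - 1) (tmax := S.r + 1)
      ⟨S.l, by constructor <;> linarith⟩ (S.angleLeft lam)
      ⟨(B + A) * (S.r - S.l + 1), mul_nonneg (by positivity) (by linarith)⟩ 0
      ⟨B + A, by positivity⟩ ⟨A, hA0⟩ := by
    refine ⟨fun t ht => LipschitzOnWith.of_dist_le_mul fun x _ y _ => ?_, fun x _ => ?_,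
      fun t ht x _ => ?_, ?_⟩
    · rw [Real.dist_eq, Real.dist_eq]
      have : S.pruferField lam t x - S.pruferField lam t y =
        -(S.pruferCoeff lam t * (Real.sin x ^ 2 - Real.sin y ^ 2)) := by
        unfold pruferField; ring
      rw [this, abs_neg, abs_mul]
      exact mul_le_mul (hA t ht) (abs_sin_sq_sub_sin_sq_le x y) (abs_nonneg _) hA0
    · have := S.continuous_pruferCoeff lam
      unfold pruferField
      exact Continuous.continuousOn (hcp.sub (by fun_prop))
    · rw [Real.norm_eq_abs]
      refine (abs_sub _ _).trans (add_le_add (hB t ht) ?_)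
      rw [abs_mul, abs_of_nonneg (sq_nonneg (Real.sin x))]
      calc _ ≤ A * 1 := mul_le_mul (hA t ht) (Real.sin_sq_le_one x) (sq_nonneg _) hA0
        _ = A := mul_one A
    · change (B + A) * max (S.r + 1 - S.l) (S.l - (S.l - 1)) ≤ (B + A) * (S.r - S.l + 1) - 0
      rw [sub_zero]
      refine mul_le_mul_of_nonneg_left (max_le ?_ ?_) (by positivity) <;> linarith
  obtain ⟨α, hα0, hα⟩ := hPL.exists_eq_forall_mem_Icc_hasDerivWithinAt₀
  -- Clamping the argument gives continuity on all of `ℝ`; the margin `1 / 2` leaves the function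
  -- unchanged near `[l, r]`.
  refine ⟨fun x => α (max (S.l - 1 / 2) (min x (S.r + 1 / 2))), ?_, ?_, fun x hx => ?_⟩
  · refine ContinuousOn.comp_continuous (s := Icc (S.l - 1) (S.r + 1))
      (fun x hx => (hα x hx).continuousWithinAt) (by fun_prop) fun x => ⟨?_, ?_⟩
    · exact le_max_of_le_left (by linarith)
    · exact max_le (by linarith) ((min_le_right _ _).trans (by linarith))
  · change α (max (S.l - 1 / 2) (min S.l (S.r + 1 / 2))) = _
    rw [min_eq_left (by linarith), max_eq_right (by linarith)]; exact hα0
  · have hd : HasDerivAt α (S.pruferField lam x (α x)) x :=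
      (hα x ⟨by linarith [hx.1], by linarith [hx.2]⟩).hasDerivAt
        (Icc_mem_nhds (by linarith [hx.1]) (by linarith [hx.2]))
    have hx' : max (S.l - 1 / 2) (min x (S.r + 1 / 2)) = x := by
      rw [min_eq_left (by linarith [hx.2]), max_eq_right (by linarith [hx.1])]
    simp only [hx']
    refine hd.congr_of_eventuallyEq ?_
    filter_upwards [Ioo_mem_nhds (show S.l - 1 / 2 < x by linarith [hx.1])
      (show x < S.r + 1 / 2 by linarith [hx.2])] with y hy
    rw [min_eq_left hy.2.le, max_eq_right hy.1.le]

/-- The Prüfer angle. -/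
def angle (lam : ℝ) : ℝ → ℝ := (S.exists_angle lam).choose

theorem continuous_angle (lam : ℝ) : Continuous (S.angle lam) := (S.exists_angle lam).choose_spec.1

theorem angle_left (lam : ℝ) : S.angle lam S.l = S.angleLeft lam :=
  (S.exists_angle lam).choose_spec.2.1

theorem hasDerivAt_angle (lam : ℝ) {x : ℝ} (hx : x ∈ Icc S.l S.r) :
    HasDerivAt (S.angle lam) (S.pruferField lam x (S.angle lam x)) x :=
  (S.exists_angle lam).choose_spec.2.2 x hx

/-- The Prüfer radius. -/
def radius (lam x : ℝ) : ℝ := Real.exp (∫ t in S.l..x,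
  S.pruferCoeff lam t * Real.sin (S.angle lam t) * Real.cos (S.angle lam t))

theorem radius_pos (lam x : ℝ) : 0 < S.radius lam x := Real.exp_pos _

theorem hasDerivAt_radius (lam x : ℝ) : HasDerivAt (S.radius lam)
    (S.radius lam x * (S.pruferCoeff lam x * Real.sin (S.angle lam x) * Real.cos (S.angle lam x)))
    x := by
  have h1 := S.continuous_angle lam
  have h2 := S.continuous_pruferCoeff lam
  have h : Continuous fun t =>
      S.pruferCoeff lam t * Real.sin (S.angle lam t) * Real.cos (S.angle lam t) := by fun_prop
  exact (h.integral_hasStrictDerivAt S.l x).hasDerivAt.exp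

theorem continuous_radius (lam : ℝ) : Continuous (S.radius lam) :=
  continuous_iff_continuousAt.2 fun x => (S.hasDerivAt_radius lam x).continuousAt

/-- The solution of the equation that satisfies the condition at `l`. -/
def sol (lam x : ℝ) : ℝ := S.radius lam x * Real.sin (S.angle lam x)

/-- The quasi-derivative `p φ' / 2` of the solution `φ`. -/
def solQuasi (lam x : ℝ) : ℝ := S.radius lam x * Real.cos (S.angle lam x)

/-- The radius solves the linear equation that remains once the angle is known. The initial angle is
the one with cotangent `(κ(l) - lam) / (2ρ)`, which is the sticky condition, and sine and cosine
have no common zero. -/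
theorem isSolution_sol (lam : ℝ) : S.IsSolution lam (S.sol lam) (S.solQuasi lam) where
  cont_fst := (S.continuous_radius lam).mul (Real.continuous_sin.comp (S.continuous_angle lam))
  cont_snd := (S.continuous_radius lam).mul (Real.continuous_cos.comp (S.continuous_angle lam))
  deriv_fst x hx := by
    refine ((S.hasDerivAt_radius lam x).mul (S.hasDerivAt_angle lam hx).sin).congr_deriv ?_
    unfold solQuasi pruferField
    ring
  deriv_snd x hx := by
    refine ((S.hasDerivAt_radius lam x).mul (S.hasDerivAt_angle lam hx).cos).congr_deriv ?_
    unfold sol pruferField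
    have h1 := Real.cos_sq' (S.angle lam x)
    have h2 : S.pruferCoeff lam x - 2 / S.p x = S.w x * (S.κ x - lam) := by unfold pruferCoeff; ring
    rw [← h2]
    linear_combination (S.radius lam x * S.pruferCoeff lam x * Real.sin (S.angle lam x)) * h1
  ne_zero x _ h0 h1 := by
    have hR := (S.radius_pos lam x).ne'
    have hs : Real.sin (S.angle lam x) = 0 := (mul_eq_zero.1 h0).resolve_left hR
    have hc : Real.cos (S.angle lam x) = 0 := (mul_eq_zero.1 h1).resolve_left hR
    have := Real.sin_sq_add_cos_sq (S.angle lam x)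
    simp [hs, hc] at this
  left := by
    have hρ := S.hρ.ne'
    unfold sol solQuasi
    rw [S.angle_left, angleLeft, Real.sin_pi_div_two_sub, Real.cos_pi_div_two_sub]
    set t := (S.κ S.l - lam) / (2 * S.ρ) with ht
    have h1 : Real.sin (Real.arctan t) = t * Real.cos (Real.arctan t) := by
      rw [← Real.tan_mul_cos (Real.cos_arctan_pos t).ne', Real.tan_arctan]
    have h2 : S.κ S.l - lam = 2 * S.ρ * t := by rw [ht]; field_simp
    rw [h1, h2]
    ring

theorem sol_left_ne_zero (lam : ℝ) : S.sol lam S.l ≠ 0 := by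
  intro h0
  have h := S.isSolution_sol lam
  have h1 := h.left
  rw [h0, mul_zero] at h1
  have := S.hρ.ne'
  exact h.ne_zero S.l S.l_mem h0 (by simpa [this] using h1)

theorem angleLeft_pos (lam : ℝ) : 0 < S.angleLeft lam :=
  sub_pos.2 (Real.arctan_lt_pi_div_two _)

theorem angleLeft_strictMono : StrictMono S.angleLeft := fun a b hab => by
  unfold angleLeft
  have := S.hρ
  exact sub_lt_sub_left (Real.arctan_strictMono (by gcongr)) _

theorem continuous_angleLeft : Continuous S.angleLeft := by
  unfold angleLeft
  exact continuous_const.sub (Real.continuous_arctan.comp (by fun_prop))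

theorem pruferField_sub_abs_le {lam A x : ℝ} (hA : |S.pruferCoeff lam x| ≤ A) (t u : ℝ) :
    |S.pruferField lam x t - S.pruferField lam x u| ≤ A * |t - u| := by
  have : S.pruferField lam x t - S.pruferField lam x u =
    -(S.pruferCoeff lam x * (Real.sin t ^ 2 - Real.sin u ^ 2)) := by
    unfold pruferField; ring
  rw [this, abs_neg, abs_mul]
  exact mul_le_mul hA (abs_sin_sq_sub_sin_sq_le t u) (abs_nonneg _) ((abs_nonneg _).trans hA)

theorem pruferField_sub_lam (lam lam' x t : ℝ) :
    S.pruferField lam' x t - S.pruferField lam x t = S.w x * (lam' - lam) * Real.sin t ^ 2 := by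
  unfold pruferField pruferCoeff; ring

/-- Sturm comparison: raising `lam` adds the nonnegative term `w (b - a) sin²` to the field.
Strictness comes from the initial angle, which already increases strictly because `lam` occurs in
the boundary condition. -/
theorem angle_strictMono {x : ℝ} (hx : x ∈ Icc S.l S.r) : StrictMono fun lam => S.angle lam x := by
  intro a b hab
  obtain ⟨A, hA0, hA⟩ := exists_abs_le_on_Icc (S.continuous_pruferCoeff a) S.l S.r
  refine sub_pos.1 (pos_of_deriv_ge_neg_mul_abs (a := S.l) (b := S.r) (A := A)
    (g := fun x => S.angle b x - S.angle a x)
    (fun y hy => (S.hasDerivAt_angle b hy).sub (S.hasDerivAt_angle a hy)) (fun y hy => ?_) ?_ x hx)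
  · have h1 := S.pruferField_sub_lam a b y (S.angle b y)
    have h2 : 0 ≤ S.w y * (b - a) * Real.sin (S.angle b y) ^ 2 :=
      mul_nonneg (mul_nonneg (S.w_pos hy).le (sub_pos.2 hab).le) (sq_nonneg _)
    have h3 := (abs_le.1 (S.pruferField_sub_abs_le (hA y hy) (S.angle b y) (S.angle a y))).1
    linarith
  · simp only [S.angle_left]
    exact sub_pos.2 (S.angleLeft_strictMono hab)

theorem sin_sq_sub_int_mul_pi (t : ℝ) (j : ℤ) : Real.sin (t - j * Real.pi) ^ 2 = Real.sin t ^ 2 := by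
  rw [Real.sin_sub_int_mul_pi, mul_pow]
  rcases Int.even_or_odd j with h | h
  · rw [h.neg_one_zpow]; simp
  · rw [h.neg_one_zpow]; simp

/-- The Prüfer angle exceeds a multiple of `π` strictly after reaching it. -/
theorem int_mul_pi_lt_angle {lam : ℝ} {j : ℤ} {x y : ℝ} (hx : S.l ≤ x) (hxy : x < y) (hy : y ≤ S.r)
    (h : j * Real.pi ≤ S.angle lam x) : j * Real.pi < S.angle lam y := by
  obtain ⟨A, hA0, hA⟩ := exists_abs_le_on_Icc (S.continuous_pruferCoeff lam) S.l S.r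
  have hmem : ∀ z ∈ Icc x y, z ∈ Icc S.l S.r := fun z hz => ⟨hx.trans hz.1, hz.2.trans hy⟩
  -- At multiples of `π` the field equals `2 / p > 0`, so by the Lipschitz bound they act as
  -- barriers from below.
  have hge : ∀ z ∈ Icc x y, -(A * |S.angle lam z - j * Real.pi|) ≤ S.pruferField lam z (S.angle lam z) := by
    intro z hz
    have h1 := S.pruferField_sub_abs_le (hA z (hmem z hz)) (S.angle lam z - j * Real.pi) 0
    have h2 : S.pruferField lam z (S.angle lam z - j * Real.pi) = S.pruferField lam z (S.angle lam z) := by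
      unfold pruferField; rw [sin_sq_sub_int_mul_pi]
    have h3 : S.pruferField lam z 0 = 2 / S.p z := by simp [pruferField]
    rw [h2, h3, sub_zero] at h1
    have := (abs_le.1 h1).1
    have : 0 < 2 / S.p z := div_pos two_pos (S.p_pos z)
    linarith
  have hd : ∀ z ∈ Icc x y, HasDerivAt (fun z => S.angle lam z - j * Real.pi)
      (S.pruferField lam z (S.angle lam z)) z := fun z hz =>
    (S.hasDerivAt_angle lam (hmem z hz)).sub_const _
  have h0 := nonneg_of_deriv_ge_neg_mul_abs hd hge (sub_nonneg.2 h)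
  -- If the angle were exactly `jπ` at `y`, its derivative `2 / p > 0` would put it below `jπ` just
  -- before `y`.
  refine lt_of_le_of_ne (sub_nonneg.1 (h0 y ⟨hxy.le, le_rfl⟩)) fun heq => ?_
  have hdy := hd y ⟨hxy.le, le_rfl⟩
  have hval : S.pruferField lam y (S.angle lam y) = 2 / S.p y := by
    rw [← heq]; simp [pruferField, Real.sin_int_mul_pi]
  rw [hval] at hdy
  have hpos : 0 < 2 / S.p y := div_pos two_pos (S.p_pos y)
  have hev : ∀ᶠ z in 𝓝[<] y, 0 < slope (fun z => S.angle lam z - j * Real.pi) y z :=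
    ((hasDerivAt_iff_tendsto_slope.1 hdy).mono_left
      (nhdsWithin_mono _ fun z hz => ne_of_lt hz)).eventually (lt_mem_nhds hpos)
  obtain ⟨z, hz, hz2⟩ := (hev.and (Ioo_mem_nhdsLT hxy)).exists
  rw [slope_def_field, ← heq] at hz
  have h1 := h0 z ⟨hz2.1.le, hz2.2.le⟩
  have h2 : (S.angle lam z - j * Real.pi - (j * Real.pi - j * Real.pi)) / (z - y) ≤ 0 :=
    div_nonpos_of_nonneg_of_nonpos (by linarith) (by linarith [hz2.2])
  linarith

theorem angle_pos {lam x : ℝ} (hx : x ∈ Icc S.l S.r) : 0 < S.angle lam x := by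
  rcases hx.1.eq_or_lt with h | h
  · rw [← h, S.angle_left]; exact S.angleLeft_pos lam
  · have := S.int_mul_pi_lt_angle (lam := lam) (j := 0) le_rfl h hx.2
      (by simpa [S.angle_left] using (S.angleLeft_pos lam).le)
    simpa using this

/-- At `lam = 0` the field is `(2 / p) cos² - w κ sin²`, which is not positive at `π / 2` because `κ
≥ 0`; the angle starts below that barrier. Hence `0` lies below every eigenvalue. -/
theorem angle_zero_right_le : S.angle 0 S.r ≤ Real.pi / 2 := by
  have hcp : Continuous fun x => 2 / S.p x :=
    continuous_const.div S.continuous_p fun x => (S.p_pos x).ne'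
  obtain ⟨A, hA0, hA⟩ := exists_abs_le_on_Icc hcp S.l S.r
  refine sub_nonneg.1 (nonneg_of_deriv_ge_neg_mul_abs (a := S.l) (b := S.r) (A := A)
    (g := fun x => Real.pi / 2 - S.angle 0 x)
    (fun y hy => (S.hasDerivAt_angle 0 hy).const_sub _) (fun y hy => ?_) ?_ S.r S.r_mem)
  · have h1 := Real.sin_sq_add_cos_sq (S.angle 0 y)
    have h2 : Real.cos (S.angle 0 y) ^ 2 ≤ |Real.pi / 2 - S.angle 0 y| := by
      have := abs_sin_sq_sub_sin_sq_le (Real.pi / 2 - S.angle 0 y) 0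
      rw [Real.sin_pi_div_two_sub] at this
      simpa using this
    have h3 : S.pruferField 0 y (S.angle 0 y) = 2 / S.p y * Real.cos (S.angle 0 y) ^ 2 -
        S.w y * S.κ y * Real.sin (S.angle 0 y) ^ 2 := by
      unfold pruferField pruferCoeff
      linear_combination (-(2 / S.p y)) * h1
    have h4 : 0 ≤ S.w y * S.κ y * Real.sin (S.angle 0 y) ^ 2 :=
      mul_nonneg (mul_nonneg (S.w_pos hy).le (S.κ_nonneg y hy)) (sq_nonneg _)
    have h5 : 2 / S.p y * Real.cos (S.angle 0 y) ^ 2 ≤ A * |Real.pi / 2 - S.angle 0 y| :=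
      mul_le_mul ((le_abs_self _).trans (hA y hy)) h2 (sq_nonneg _) hA0
    linarith
  · simp only [S.angle_left, angleLeft]
    have : 0 ≤ Real.arctan ((S.κ S.l - 0) / (2 * S.ρ)) := by
      have := S.hρ
      have := S.κ_nonneg S.l S.l_mem
      rw [Real.arctan_nonneg, sub_zero]
      positivity
    linarith

/-- Grönwall's inequality for the difference of two angles: changing `lam` moves the initial angle
continuously and the field by at most `B |b - a|`. The constant `A + 1` replaces `A` to avoid the
degenerate case of the Grönwall bound. -/
theorem continuous_angle_right : Continuous fun lam => S.angle lam S.r := by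
  rw [continuous_iff_continuousAt]
  intro a
  obtain ⟨A, hA0, hA⟩ := exists_abs_le_on_Icc (S.continuous_pruferCoeff a) S.l S.r
  obtain ⟨B, hB0, hB⟩ := exists_abs_le_on_Icc S.continuous_w S.l S.r
  have key : ∀ b, |S.angle b S.r - S.angle a S.r| ≤
      |S.angleLeft b - S.angleLeft a| * Real.exp ((A + 1) * (S.r - S.l)) +
        B * |b - a| / (A + 1) * (Real.exp ((A + 1) * (S.r - S.l)) - 1) := fun b => by
    have h := norm_le_gronwallBound_of_norm_deriv_right_le (a := S.l) (b := S.r)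
      (f := fun x => S.angle b x - S.angle a x)
      (f' := fun x => S.pruferField b x (S.angle b x) - S.pruferField a x (S.angle a x))
      (K := A + 1) (ε := B * |b - a|) (δ := |S.angleLeft b - S.angleLeft a|)
      ((S.continuous_angle b).sub (S.continuous_angle a)).continuousOn
      (fun x hx => ((S.hasDerivAt_angle b ⟨hx.1, hx.2.le⟩).sub
        (S.hasDerivAt_angle a ⟨hx.1, hx.2.le⟩)).hasDerivWithinAt)
      (by simp [S.angle_left]) (fun x hx => ?_) S.r S.r_mem
    · rwa [gronwallBound_of_K_ne_0 (by positivity)] at h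
    · have hx' : x ∈ Icc S.l S.r := ⟨hx.1, hx.2.le⟩
      rw [Real.norm_eq_abs, Real.norm_eq_abs]
      have h1 := S.pruferField_sub_lam a b x (S.angle b x)
      have h2 := S.pruferField_sub_abs_le (hA x hx') (S.angle b x) (S.angle a x)
      have h3 : |S.w x * (b - a) * Real.sin (S.angle b x) ^ 2| ≤ B * |b - a| := by
        rw [abs_mul, abs_mul, abs_of_nonneg (sq_nonneg (Real.sin _))]
        calc _ ≤ (B * |b - a|) * 1 := mul_le_mul
              (mul_le_mul_of_nonneg_right (hB x hx') (abs_nonneg _)) (Real.sin_sq_le_one _)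
              (sq_nonneg _) (by positivity)
          _ = _ := mul_one _
      calc _ = |(S.pruferField b x (S.angle b x) - S.pruferField a x (S.angle b x)) +
            (S.pruferField a x (S.angle b x) - S.pruferField a x (S.angle a x))| := by congr 1; ring
        _ ≤ _ := abs_add_le _ _
        _ ≤ B * |b - a| + A * |S.angle b x - S.angle a x| := by rw [h1]; exact add_le_add h3 h2
        _ ≤ _ := by nlinarith [abs_nonneg (S.angle b x - S.angle a x)]
  rw [ContinuousAt, tendsto_iff_dist_tendsto_zero]
  refine squeeze_zero (fun _ => dist_nonneg) key ?_
  have hc : Continuous fun b => |S.angleLeft b - S.angleLeft a| * Real.exp ((A + 1) * (S.r - S.l)) +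
        B * |b - a| / (A + 1) * (Real.exp ((A + 1) * (S.r - S.l)) - 1) := by
    have := S.continuous_angleLeft
    fun_prop
  simpa using hc.tendsto a

/-- The zeros in `[l, r)` of the solution are at most `k - 1` if the final angle is at most `kπ`. -/
theorem exists_zeros {lam : ℝ} {k : ℕ} (hk : 1 ≤ k) (h : S.angle lam S.r ≤ k * Real.pi) :
    ∃ z : Fin (k - 1) → ℝ, ∀ x ∈ Ico S.l S.r, S.sol lam x = 0 → ∃ i, z i = x := by
  classical
  -- The `i`-th entry is the point where the angle is `(i + 1)π`, with default `l` if there is none.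
  -- Each multiple of `π` is attained at most once; `0` is excluded by positivity, and `kπ` because
  -- the angle would exceed it strictly at `r`.
  refine ⟨fun i => if hi : ∃ x ∈ Ico S.l S.r, S.angle lam x = ((i : ℕ) + 1 : ℕ) * Real.pi then hi.choose
    else S.l, fun x hx h0 => ?_⟩
  have hs : Real.sin (S.angle lam x) = 0 := (mul_eq_zero.1 h0).resolve_left (S.radius_pos lam x).ne'
  obtain ⟨j, hj⟩ := Real.sin_eq_zero_iff.1 hs
  have hpi := Real.pi_pos
  have hj0 : 0 < j := by
    have := S.angle_pos (lam := lam) ⟨hx.1, hx.2.le⟩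
    rw [← hj] at this
    exact_mod_cast pos_of_mul_pos_left this hpi.le
  have hjk : j < k := by
    have := S.int_mul_pi_lt_angle hx.1 hx.2 le_rfl hj.le
    have := this.trans_le h
    exact_mod_cast lt_of_mul_lt_mul_right this hpi.le
  obtain ⟨m, rfl⟩ : ∃ m : ℕ, j = m + 1 := ⟨(j - 1).toNat, by omega⟩
  have hex : ∃ x ∈ Ico S.l S.r, S.angle lam x = ((m : ℕ) + 1 : ℕ) * Real.pi :=
    ⟨x, hx, by rw [← hj]; push_cast; ring⟩
  refine ⟨⟨m, by omega⟩, ?_⟩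
  simp only [hex, dif_pos]
  obtain ⟨hy, hy2⟩ := hex.choose_spec
  set y := hex.choose
  have hxy : S.angle lam y = S.angle lam x := by rw [hy2, ← hj]; push_cast; ring
  rcases lt_trichotomy y x with hlt | heq | hgt
  · have := S.int_mul_pi_lt_angle hy.1 hlt hx.2.le (j := m + 1) (by rw [hxy, ← hj])
    rw [← hj] at this; exact absurd this (lt_irrefl _)
  · exact heq
  · have := S.int_mul_pi_lt_angle hx.1 hgt hy.2.le (j := m + 1) hj.le
    rw [hxy, ← hj] at this; exact absurd this (lt_irrefl _)

end StickyCoeff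

namespace StickyCoeff

variable (S : StickyCoeff)

/-! ### The eigenvalue sequence -/

/-- Pigeonhole: `k` disjoint open cells cannot all meet a family of `k - 1` points. -/
theorem exists_subinterval_avoiding {l r : ℝ} (hlr : l < r) {k : ℕ} (hk : 1 ≤ k) (z : Fin (k - 1) → ℝ) :
    ∃ a b, l ≤ a ∧ b ≤ r ∧ b - a = (r - l) / k ∧ ∀ i, z i ∉ Ioo a b := by
  have hk0 : (0 : ℝ) < k := by exact_mod_cast hk
  set d := (r - l) / k with hd
  have hd0 : 0 < d := div_pos (sub_pos.2 hlr) hk0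
  by_contra! hcon
  have h1 : ∀ j : Fin k, ∃ i, z i ∈ Ioo (l + j * d) (l + (j + 1) * d) := fun j => by
    refine hcon _ _ ?_ ?_ ?_
    · have : (0 : ℝ) ≤ (j : ℕ) * d := by positivity
      linarith
    · have hj : ((j : ℕ) : ℝ) + 1 ≤ k := by exact_mod_cast j.2
      have h2 : (((j : ℕ) : ℝ) + 1) * d ≤ k * d := by gcongr
      have h3 : k * d = r - l := by rw [hd]; field_simp
      linarith
    · ring
  choose f hf using h1
  have hinj : Function.Injective f := fun i j hij => by
    have hi := hf i
    have hj := hf j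
    rw [hij] at hi
    have key : ∀ a b : Fin k, z (f j) ∈ Ioo (l + (a : ℕ) * d) (l + ((a : ℕ) + 1) * d) →
        z (f j) ∈ Ioo (l + (b : ℕ) * d) (l + ((b : ℕ) + 1) * d) → (a : ℕ) ≤ b := fun a b ha hb => by
      have : ((a : ℕ) : ℝ) * d < ((b : ℕ) + 1) * d := by linarith [ha.1, hb.2]
      have := lt_of_mul_lt_mul_right this hd0.le
      have : (a : ℕ) < (b : ℕ) + 1 := by exact_mod_cast this
      omega
    exact Fin.ext (le_antisymm (key i j hi hj) (key j i hj hi))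
  have := Fintype.card_le_of_injective f hinj
  simp at this
  omega

theorem integral_parabola_sq (a b : ℝ) : ∫ x in a..b, ((x - a) * (b - x)) ^ 2 = (b - a) ^ 5 / 30 := by
  rw [integral_eq_sub_of_hasDerivAt (f := fun x => (b - a) ^ 2 * (x - a) ^ 3 / 3 -
    (b - a) * (x - a) ^ 4 / 2 + (x - a) ^ 5 / 5) (fun x _ => ?_)
    (Continuous.intervalIntegrable (by fun_prop) _ _)]
  · ring
  · have h := (hasDerivAt_id x).sub_const a
    refine (((((h.pow 3).const_mul ((b - a) ^ 2)).div_const 3).sub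
      (((h.pow 4).const_mul (b - a)).div_const 2)).add ((h.pow 5).div_const 5)).congr_deriv ?_
    simp
    ring

theorem integral_parabola_deriv_sq (a b : ℝ) : ∫ x in a..b, (a + b - 2 * x) ^ 2 = (b - a) ^ 3 / 3 := by
  rw [integral_eq_sub_of_hasDerivAt (f := fun x => -(a + b - 2 * x) ^ 3 / 6) (fun x _ => ?_)
    (Continuous.intervalIntegrable (by fun_prop) _ _)]
  · ring
  · have h := ((hasDerivAt_id x).const_mul 2).const_sub (a + b)
    refine (((h.pow 3).neg).div_const 6).congr_deriv ?_
    simp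
    ring

/-- Picone's inequality is applied to the parabola `(x - a)(b - x)` on an interval of length `(r -
l) / k` with no zero inside. The boundary terms vanish, and the two parabola integrals give `w₀ (lam
- κm)(b - a)² ≤ 5 P`. The bound holds for every `lam` whose angle at `r` is at most `kπ`, hence also
shows that the angle reaches `kπ`. -/
theorem exists_growth_bound : ∃ C, 0 < C ∧ ∀ (k : ℕ) (lam : ℝ), 1 ≤ k → S.angle lam S.r ≤ k * Real.pi →
    lam ≤ C * (k : ℝ) ^ 2 := by
  obtain ⟨P, hP0, hP⟩ := exists_abs_le_on_Icc S.continuous_p S.l S.r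
  obtain ⟨κm, hκ0, hκ⟩ := exists_abs_le_on_Icc S.continuous_κ S.l S.r
  obtain ⟨w0, hw0, hw⟩ := exists_pos_le_on_Icc S.continuous_w S.hlr.le fun x hx => S.w_pos hx
  have hL : 0 < S.r - S.l := sub_pos.2 S.hlr
  refine ⟨κm + 5 * P / (w0 * (S.r - S.l) ^ 2) + 1, by positivity, fun k lam hk hang => ?_⟩
  have hk0 : (1 : ℝ) ≤ k := by exact_mod_cast hk
  obtain ⟨z, hz⟩ := S.exists_zeros hk hang
  obtain ⟨a, b, ha, hb, hab, hav⟩ := exists_subinterval_avoiding S.hlr hk z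
  have hd : 0 < b - a := by rw [hab]; positivity
  by_cases hlam : lam ≤ κm
  · have : 0 ≤ 5 * P / (w0 * (S.r - S.l) ^ 2) + 1 := by positivity
    have h4 : κm ≤ κm * (k : ℝ) ^ 2 := le_mul_of_one_le_right hκ0 (one_le_pow₀ hk0)
    have h5 := mul_nonneg this (sq_nonneg (k : ℝ))
    linarith
  push Not at hlam
  have hpic := (S.isSolution_sol lam).picone S (sub_pos.1 hd).le ha hb
    (U := fun x => (x - a) * (b - x)) (U' := fun x => a + b - 2 * x)
    (fun x => (((hasDerivAt_id x).sub_const a).mul ((hasDerivAt_id x).const_sub b)).congr_deriv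
      (by simp; ring)) (by fun_prop) (fun x hx h0 => by
        by_contra hne
        have h1 : x ≠ a := by rintro rfl; simp at hne
        have h2 : x ≠ b := by rintro rfl; simp at hne
        have h3 : x ∈ Ioo a b := ⟨lt_of_le_of_ne hx.1 h1.symm, lt_of_le_of_ne hx.2 h2⟩
        obtain ⟨i, hi⟩ := hz x ⟨ha.trans hx.1, h3.2.trans_le hb⟩ h0
        exact hav i (hi ▸ h3))
  have hle : ∫ x in a..b, (S.p x / 2 * (a + b - 2 * x) ^ 2 +
      S.w x * (S.κ x - lam) * ((x - a) * (b - x)) ^ 2) ≤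
      ∫ x in a..b, (P / 2 * (a + b - 2 * x) ^ 2 - w0 * (lam - κm) * ((x - a) * (b - x)) ^ 2) := by
    have := S.continuous_p; have := S.continuous_w; have := S.continuous_κ
    refine integral_mono_on (sub_pos.1 hd).le (Continuous.intervalIntegrable (by fun_prop) _ _)
      (Continuous.intervalIntegrable (by fun_prop) _ _) fun x hx => ?_
    have hx' : x ∈ Icc S.l S.r := ⟨ha.trans hx.1, hx.2.trans hb⟩
    have h1 := (le_abs_self _).trans (hP x hx')
    have h2 := (le_abs_self _).trans (hκ x hx')
    have h3 := hw x hx'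
    have h4 : w0 * (lam - κm) ≤ S.w x * (lam - S.κ x) :=
      mul_le_mul h3 (by linarith) (by linarith) (hw0.le.trans h3)
    have h5 := mul_le_mul_of_nonneg_right h4 (sq_nonneg ((x - a) * (b - x)))
    have h6 := mul_le_mul_of_nonneg_right h1 (sq_nonneg (a + b - 2 * x))
    linarith
  rw [integral_sub (Continuous.intervalIntegrable (by fun_prop) _ _)
      (Continuous.intervalIntegrable (by fun_prop) _ _), intervalIntegral.integral_const_mul,
      intervalIntegral.integral_const_mul, integral_parabola_sq, integral_parabola_deriv_sq] at hle
  simp only [sub_self, zero_mul, mul_zero, ne_eq, OfNat.ofNat_ne_zero, not_false_eq_true, zero_pow,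
    zero_div] at hpic
  have h1 : w0 * (lam - κm) * (b - a) ^ 2 ≤ 5 * P := by
    have h2 : 0 ≤ (b - a) ^ 3 / 30 * (5 * P - w0 * (lam - κm) * (b - a) ^ 2) := by linarith
    have := nonneg_of_mul_nonneg_right h2 (by positivity)
    linarith
  rw [hab, div_pow] at h1
  have h3 : lam - κm ≤ 5 * P / (w0 * (S.r - S.l) ^ 2) * (k : ℝ) ^ 2 := by
    rw [div_mul_eq_mul_div, le_div_iff₀ (by positivity)]
    calc _ = w0 * (lam - κm) * ((S.r - S.l) ^ 2 / (k : ℝ) ^ 2) * (k : ℝ) ^ 2 := by field_simp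
      _ ≤ _ := by gcongr
  have h4 : κm ≤ κm * (k : ℝ) ^ 2 := le_mul_of_one_le_right hκ0 (one_le_pow₀ hk0)
  nlinarith [sq_nonneg (k : ℝ)]

theorem exists_angle_eq {k : ℕ} (hk : 1 ≤ k) : ∃ lam, S.angle lam S.r = k * Real.pi := by
  obtain ⟨C, hC, h⟩ := S.exists_growth_bound
  have hpi := Real.pi_pos
  have hk0 : (1 : ℝ) ≤ k := by exact_mod_cast hk
  refine mem_range_of_exists_le_of_exists_ge S.continuous_angle_right ⟨0, ?_⟩
    ⟨C * (k : ℝ) ^ 2 + 1, ?_⟩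
  · have := S.angle_zero_right_le
    nlinarith
  · by_contra! hlt
    have := h k _ hk hlt.le
    linarith

/-- The `k`-th eigenvalue, `k ≥ 1`. -/
def eig (k : ℕ) : ℝ := if hk : 1 ≤ k then (S.exists_angle_eq hk).choose else 0

theorem angle_eig {k : ℕ} (hk : 1 ≤ k) : S.angle (S.eig k) S.r = k * Real.pi := by
  rw [eig, dif_pos hk]
  exact (S.exists_angle_eq hk).choose_spec

theorem eig_pos {k : ℕ} (hk : 1 ≤ k) : 0 < S.eig k := by
  rw [← (S.angle_strictMono S.r_mem).lt_iff_lt]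
  change S.angle 0 S.r < S.angle (S.eig k) S.r
  have hk0 : (1 : ℝ) ≤ k := by exact_mod_cast hk
  rw [S.angle_eig hk]
  have := S.angle_zero_right_le
  have := Real.pi_pos
  nlinarith

theorem eig_strictMonoOn : StrictMonoOn S.eig (Ici 1) := fun i hi j hj hij => by
  rw [← (S.angle_strictMono S.r_mem).lt_iff_lt]
  change S.angle (S.eig i) S.r < S.angle (S.eig j) S.r
  rw [S.angle_eig hi, S.angle_eig hj]
  have := Real.pi_pos
  gcongr

theorem sol_right_eq_zero_iff (lam : ℝ) : S.sol lam S.r = 0 ↔ ∃ k : ℕ, 1 ≤ k ∧ S.eig k = lam := by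
  have hpi := Real.pi_pos
  constructor
  · intro h
    have hs : Real.sin (S.angle lam S.r) = 0 :=
      (mul_eq_zero.1 h).resolve_left (S.radius_pos lam S.r).ne'
    obtain ⟨j, hj⟩ := Real.sin_eq_zero_iff.1 hs
    have hj0 : 0 < j := by
      have := S.angle_pos (lam := lam) S.r_mem
      rw [← hj] at this
      exact_mod_cast pos_of_mul_pos_left this hpi.le
    have hj1 : 1 ≤ j.toNat := by omega
    refine ⟨j.toNat, hj1, (S.angle_strictMono S.r_mem).injective ?_⟩
    rw [S.angle_eig hj1, ← hj]
    congr 1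
    exact_mod_cast Int.toNat_of_nonneg hj0.le
  · rintro ⟨k, hk, rfl⟩
    rw [sol, S.angle_eig hk, Real.sin_nat_mul_pi, mul_zero]

/-! ### The mass form and orthogonality -/

/-- The mass form. -/
def massForm (f g : ℝ → ℝ) : ℝ := (∫ x in S.l..S.r, S.w x * (f x * g x)) + f S.l * g S.l / (2 * S.ρ)

/-- Lagrange's identity for linear combinations: `f' = 2 F / p` and `F' = w (κ f - f₁)`. -/
theorem massForm_eq_of_quasi {f F f₁ g G : ℝ → ℝ} (hf : Continuous f) (hF : Continuous F)
    (hf₁ : Continuous f₁) (hg : Continuous g) (hG : Continuous G)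
    (dF : ∀ x ∈ Icc S.l S.r, HasDerivAt F (S.w x * (S.κ x * f x - f₁ x)) x)
    (dg : ∀ x ∈ Icc S.l S.r, HasDerivAt g (2 * G x / S.p x) x)
    (left : 2 * S.ρ * F S.l = S.κ S.l * f S.l - f₁ S.l) (right : g S.r = 0) :
    S.massForm f₁ g = (∫ x in S.l..S.r, (2 * F x * G x / S.p x + S.w x * S.κ x * (f x * g x))) +
      S.κ S.l * (f S.l * g S.l) / (2 * S.ρ) := by
  have hp := S.continuous_p; have hw := S.continuous_w; have hκ := S.continuous_κ
  have hp0 : ∀ x, S.p x ≠ 0 := fun x => (S.p_pos x).ne'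
  have h1 : ∫ x in S.l..S.r, (2 * F x * G x / S.p x + S.w x * S.κ x * (f x * g x) -
      S.w x * (f₁ x * g x)) = F S.r * g S.r - F S.l * g S.l := by
    refine integral_eq_sub_of_hasDerivAt (f := fun x => F x * g x) (fun x hx => ?_)
      (Continuous.intervalIntegrable (by fun_prop (disch := assumption)) _ _)
    rw [uIcc_of_le S.hlr.le] at hx
    exact ((dF x hx).mul (dg x hx)).congr_deriv (by ring)
  rw [integral_sub (Continuous.intervalIntegrable (by fun_prop (disch := assumption)) _ _)
    (Continuous.intervalIntegrable (by fun_prop) _ _), right] at h1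
  have hρ := S.hρ.ne'
  have h2 : F S.l = (S.κ S.l * f S.l - f₁ S.l) / (2 * S.ρ) := by rw [← left]; field_simp
  rw [h2] at h1
  unfold massForm
  have h3 : (S.κ S.l * f S.l - f₁ S.l) / (2 * S.ρ) * g S.l =
    S.κ S.l * (f S.l * g S.l) / (2 * S.ρ) - f₁ S.l * g S.l / (2 * S.ρ) := by ring
  linarith

theorem massForm_comm (f g : ℝ → ℝ) : S.massForm f g = S.massForm g f := by
  unfold massForm; simp_rw [mul_comm (f _)]

theorem massForm_smul_left (a : ℝ) (f g : ℝ → ℝ) :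
    S.massForm (fun x => a * f x) g = a * S.massForm f g := by
  unfold massForm
  rw [mul_add, ← intervalIntegral.integral_const_mul]
  congr 1
  · congr 1; ext x; ring
  · ring

theorem massForm_sum_left {ι : Type*} (s : Finset ι) (c : ι → ℝ) {f : ι → ℝ → ℝ} {g : ℝ → ℝ}
    (hf : ∀ i, Continuous (f i)) (hg : Continuous g) :
    S.massForm (fun x => ∑ i ∈ s, c i * f i x) g = ∑ i ∈ s, c i * S.massForm (f i) g := by
  have hw := S.continuous_w
  unfold massForm
  simp_rw [mul_add, Finset.sum_add_distrib, ← intervalIntegral.integral_const_mul]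
  rw [← intervalIntegral.integral_finsetSum
    (fun i _ => Continuous.intervalIntegrable (by have := hf i; fun_prop) _ _)]
  congr 1
  · congr 1; ext x; rw [Finset.sum_mul, Finset.mul_sum]
    exact Finset.sum_congr rfl fun i _ => by ring
  · rw [Finset.sum_mul, Finset.sum_div]
    exact Finset.sum_congr rfl fun i _ => by ring

/-- Lagrange's identity writes each eigenvalue times the mass form as the same symmetric energy
form, so distinct eigenvalues force the mass form to vanish. -/
theorem massForm_sol_orthogonal {i j : ℕ} (hi : 1 ≤ i) (hj : 1 ≤ j) (hij : i ≠ j) :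
    S.massForm (S.sol (S.eig i)) (S.sol (S.eig j)) = 0 := by
  have key : ∀ a b : ℕ, 1 ≤ b →
      S.eig a * S.massForm (S.sol (S.eig a)) (S.sol (S.eig b)) =
      (∫ x in S.l..S.r, (2 * S.solQuasi (S.eig a) x * S.solQuasi (S.eig b) x / S.p x +
        S.w x * S.κ x * (S.sol (S.eig a) x * S.sol (S.eig b) x))) +
      S.κ S.l * (S.sol (S.eig a) S.l * S.sol (S.eig b) S.l) / (2 * S.ρ) := fun a b hb => by
    have ha' := S.isSolution_sol (S.eig a)
    have hb' := S.isSolution_sol (S.eig b)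
    rw [← massForm_smul_left]
    refine S.massForm_eq_of_quasi ha'.cont_fst ha'.cont_snd (continuous_const.mul ha'.cont_fst)
      hb'.cont_fst hb'.cont_snd (fun x hx => (ha'.deriv_snd x hx).congr_deriv (by ring)) hb'.deriv_fst
      (by rw [ha'.left]; ring) ((S.sol_right_eq_zero_iff _).2 ⟨b, hb, rfl⟩)
  have h1 := key i j hj
  have h2 := key j i hi
  rw [S.massForm_comm (S.sol (S.eig j))] at h2
  have h3 : S.eig i ≠ S.eig j := fun h => hij (S.eig_strictMonoOn.injOn hi hj h)
  have h4 : (S.eig i - S.eig j) * S.massForm (S.sol (S.eig i)) (S.sol (S.eig j)) = 0 := by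
    rw [sub_mul, h1, h2, sub_eq_zero]
    congr 1
    · congr 1; ext x; ring
    · ring
  exact (mul_eq_zero.1 h4).resolve_left (sub_ne_zero.2 h3)

theorem massForm_self_nonneg (f : ℝ → ℝ) : 0 ≤ S.massForm f f := by
  have := S.hρ
  refine add_nonneg (integral_nonneg S.hlr.le fun x hx =>
    mul_nonneg (S.w_pos hx).le (mul_self_nonneg _)) ?_
  exact div_nonneg (mul_self_nonneg _) (by positivity)

theorem massForm_sol_pos (lam : ℝ) : 0 < S.massForm (S.sol lam) (S.sol lam) := by
  have := S.hρ
  refine add_pos_of_nonneg_of_pos (integral_nonneg S.hlr.le fun x hx =>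
    mul_nonneg (S.w_pos hx).le (mul_self_nonneg _)) ?_
  exact div_pos (mul_self_pos.2 (S.sol_left_ne_zero lam)) (by positivity)

/-- Linear combinations of the first `k` eigenfunctions. -/
def comb {k : ℕ} (a : Fin k → ℝ) (x : ℝ) : ℝ := ∑ i : Fin k, a i * S.sol (S.eig (i + 1)) x

/-- Linear combinations of the quasi-derivatives of the first `k` eigenfunctions. -/
def combQuasi {k : ℕ} (a : Fin k → ℝ) (x : ℝ) : ℝ := ∑ i : Fin k, a i * S.solQuasi (S.eig (i + 1)) x

variable {k : ℕ} (a b : Fin k → ℝ)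

theorem continuous_comb : Continuous (S.comb a) :=
  continuous_finsetSum _ fun _ _ => continuous_const.mul (S.isSolution_sol _).cont_fst

theorem continuous_combQuasi : Continuous (S.combQuasi a) :=
  continuous_finsetSum _ fun _ _ => continuous_const.mul (S.isSolution_sol _).cont_snd

theorem comb_right : S.comb a S.r = 0 :=
  Finset.sum_eq_zero fun i _ => by
    rw [(S.sol_right_eq_zero_iff _).2 ⟨i + 1, by omega, rfl⟩, mul_zero]

theorem hasDerivAt_comb {x : ℝ} (hx : x ∈ Icc S.l S.r) :
    HasDerivAt (S.comb a) (2 * S.combQuasi a x / S.p x) x := by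
  have h : HasDerivAt (S.comb a) (∑ i : Fin k, a i * (2 * S.solQuasi (S.eig (i + 1)) x / S.p x)) x :=
    HasDerivAt.fun_sum fun i _ => ((S.isSolution_sol _).deriv_fst x hx).const_mul (a i)
  refine h.congr_deriv ?_
  rw [combQuasi, Finset.mul_sum, Finset.sum_div]
  exact Finset.sum_congr rfl fun i _ => by ring

theorem hasDerivAt_combQuasi {x : ℝ} (hx : x ∈ Icc S.l S.r) : HasDerivAt (S.combQuasi a)
    (S.w x * (S.κ x * S.comb a x - S.comb (fun i => S.eig (i + 1) * a i) x)) x := by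
  have h : HasDerivAt (S.combQuasi a)
      (∑ i : Fin k, a i * (S.w x * (S.κ x - S.eig (i + 1)) * S.sol (S.eig (i + 1)) x)) x :=
    HasDerivAt.fun_sum fun i _ => ((S.isSolution_sol _).deriv_snd x hx).const_mul (a i)
  refine h.congr_deriv ?_
  rw [comb, comb, Finset.mul_sum, ← Finset.sum_sub_distrib, Finset.mul_sum]
  exact Finset.sum_congr rfl fun i _ => by ring

theorem massForm_comb : S.massForm (S.comb a) (S.comb b) =
    ∑ i : Fin k, a i * b i * S.massForm (S.sol (S.eig (i + 1))) (S.sol (S.eig (i + 1))) := by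
  have hsum : ∀ (d : Fin k → ℝ) {g : ℝ → ℝ}, Continuous g → S.massForm (S.comb d) g =
      ∑ i : Fin k, d i * S.massForm (S.sol (S.eig (i + 1))) g := fun d g hg =>
    S.massForm_sum_left Finset.univ d (fun _ => (S.isSolution_sol _).cont_fst) hg
  rw [hsum a (S.continuous_comb b)]
  refine Finset.sum_congr rfl fun i _ => ?_
  rw [massForm_comm, hsum b (S.isSolution_sol _).cont_fst, Finset.sum_eq_single i]
  · ring
  · intro j _ hji
    rw [S.massForm_sol_orthogonal (by omega) (by omega), mul_zero]
    intro h
    exact hji (Fin.ext (by omega))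
  · simp

theorem massForm_comb_pos (ha : a ≠ 0) : 0 < S.massForm (S.comb a) (S.comb a) := by
  rw [massForm_comb]
  obtain ⟨i, hi⟩ := Function.ne_iff.1 ha
  refine Finset.sum_pos' (fun i _ => mul_nonneg (mul_self_nonneg _) (S.massForm_sol_pos _).le)
    ⟨i, Finset.mem_univ i, mul_pos (mul_self_pos.2 hi) (S.massForm_sol_pos _)⟩

/-- The energy of a combination of the first `k` eigenfunctions. -/
theorem energy_comb_le (hk : 1 ≤ k) :
    (∫ x in S.l..S.r, (2 * S.combQuasi a x * S.combQuasi a x / S.p x +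
        S.w x * S.κ x * (S.comb a x * S.comb a x))) +
      S.κ S.l * (S.comb a S.l * S.comb a S.l) / (2 * S.ρ) ≤
    S.eig k * S.massForm (S.comb a) (S.comb a) := by
  rw [← S.massForm_eq_of_quasi (S.continuous_comb a) (S.continuous_combQuasi a)
    (S.continuous_comb fun i => S.eig (i + 1) * a i) (S.continuous_comb a) (S.continuous_combQuasi a)
    (fun x hx => S.hasDerivAt_combQuasi a hx) (fun x hx => S.hasDerivAt_comb a hx) ?_ (S.comb_right a)]
  · rw [massForm_comb, massForm_comb, Finset.mul_sum]
    refine Finset.sum_le_sum fun i _ => ?_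
    have h1 : S.eig (i + 1) ≤ S.eig k := S.eig_strictMonoOn.monotoneOn (by simp) (by simpa using hk) i.2
    have h2 := (S.massForm_sol_pos (S.eig (i + 1))).le
    have h3 := mul_le_mul_of_nonneg_right h1 (mul_nonneg (mul_self_nonneg (a i)) h2)
    linarith
  · rw [comb, comb, combQuasi, Finset.mul_sum, Finset.mul_sum, ← Finset.sum_sub_distrib]
    refine Finset.sum_congr rfl fun i _ => ?_
    have := (S.isSolution_sol (S.eig (i + 1))).left
    linear_combination a i * this

/-- Weighting the coefficients by the eigenvalues applies the operator to the combination. The bound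
therefore controls its second derivative in the quadrature errors. -/
theorem massForm_eig_comb_le (hk : 1 ≤ k) :
    S.massForm (S.comb fun i => S.eig (i + 1) * a i) (S.comb fun i => S.eig (i + 1) * a i) ≤
    S.eig k ^ 2 * S.massForm (S.comb a) (S.comb a) := by
  rw [massForm_comb, massForm_comb, Finset.mul_sum]
  refine Finset.sum_le_sum fun i _ => ?_
  have h1 : S.eig (i + 1) ≤ S.eig k := S.eig_strictMonoOn.monotoneOn (by simp) (by simpa using hk) i.2
  have h0 : 0 ≤ S.eig (i + 1) := (S.eig_pos (by omega)).le
  have h2 := (S.massForm_sol_pos (S.eig (i + 1))).le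
  have h4 : S.eig (i + 1) ^ 2 ≤ S.eig k ^ 2 := by gcongr
  have h3 := mul_le_mul_of_nonneg_right h4 (mul_nonneg (mul_self_nonneg (a i)) h2)
  linarith

end StickyCoeff

/-! ### Identification of the eigenvalues -/

theorem eq_left_of_hasDerivAt_zero {l r : ℝ} {f : ℝ → ℝ} (hc : ContinuousOn f (Icc l r))
    (hd : ∀ x ∈ Ioo l r, HasDerivAt f 0 x) {x : ℝ} (hx : x ∈ Icc l r) : f x = f l := by
  rcases hx.1.eq_or_lt with h | h
  · rw [h]
  obtain ⟨y, _, hy⟩ := exists_hasDerivAt_eq_slope f (fun _ => 0) h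
    (hc.mono (Icc_subset_Icc_right hx.2)) fun z hz => hd z ⟨hz.1, hz.2.trans_le hx.2⟩
  have h0 : x - l ≠ 0 := (sub_pos.2 h).ne'
  have := (eq_div_iff h0).1 hy
  linarith

/-- The global coefficients `S` represent the diffusion `D`. -/
structure StickyCoeff.Represents (S : StickyCoeff) (D : StickyDiffusion) : Prop where
  l_eq : S.l = D.l
  r_eq : S.r = D.r
  ρ_eq : S.ρ = D.ρ
  c_eq : ∀ x ∈ Icc D.l D.r, D.μ x = S.c x * D.σ x ^ 2
  s_eq : ∀ x ∈ Icc D.l D.r, S.s x * D.σ x ^ 2 = 1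
  κ_eq : ∀ x ∈ Icc D.l D.r, S.κ x = D.κ x

/-- The quotients `μ / σ²` and `1 / σ²` are formed on the interval and only then extended, so
positivity of `σ²` is needed nowhere else. -/
theorem exists_represents (D : StickyDiffusion) (hlr : D.l < D.r) (hρ : 0 < D.ρ)
    (hμ : ContDiffOn ℝ 3 D.μ (Set.Icc D.l D.r))
    (hσ : ContDiffOn ℝ 4 (fun x => D.σ x ^ 2) (Set.Icc D.l D.r))
    (hσ_pos : ∀ x ∈ Set.Icc D.l D.r, 0 < D.σ x ^ 2)
    (hκ : ContDiffOn ℝ 2 D.κ (Set.Icc D.l D.r))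
    (hκ_nonneg : ∀ x ∈ Set.Icc D.l D.r, 0 ≤ D.κ x) : ∃ S : StickyCoeff, S.Represents D := by
  have hμ2 : ContDiffOn ℝ 2 D.μ (Icc D.l D.r) := hμ.of_le (by norm_num)
  have hσ2 : ContDiffOn ℝ 2 (fun x => D.σ x ^ 2) (Icc D.l D.r) := hσ.of_le (by norm_num)
  obtain ⟨c, hc, hceq⟩ := exists_contDiff_extension hlr 2
    (f := fun x => D.μ x / D.σ x ^ 2) (hμ2.div hσ2 fun x hx => (hσ_pos x hx).ne')
  obtain ⟨s, hs, hseq⟩ := exists_contDiff_extension hlr 2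
    (f := fun x => (D.σ x ^ 2)⁻¹) (hσ2.inv fun x hx => (hσ_pos x hx).ne')
  obtain ⟨κ, hκ', hκeq⟩ := exists_contDiff_extension hlr 2 hκ
  refine ⟨⟨D.l, D.r, D.ρ, c, s, κ, hlr, hρ, hc, hs, hκ', fun x hx => ?_, fun x hx => ?_⟩,
    rfl, rfl, rfl, fun x hx => ?_, fun x hx => ?_, fun x hx => hκeq hx⟩
  · rw [hseq hx]; exact inv_pos.2 (hσ_pos x hx)
  · rw [hκeq hx]; exact hκ_nonneg x hx
  · change D.μ x = c x * _
    rw [hceq hx]; exact (div_mul_cancel₀ _ (hσ_pos x hx).ne').symm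
  · change s x * _ = 1
    rw [hseq hx]; exact inv_mul_cancel₀ (hσ_pos x hx).ne'

namespace StickyCoeff

variable {S : StickyCoeff} {D : StickyDiffusion}

theorem Represents.isEigenpair_sol (h : S.Represents D) {lam : ℝ} (h0 : S.sol lam S.r = 0) :
    D.IsEigenpair lam (S.sol lam) := by
  have hs := S.isSolution_sol lam
  have hlr := S.hlr
  rw [h.l_eq, h.r_eq] at hlr
  have hu := uniqueDiffOn_Icc hlr
  have hd1 : ∀ x ∈ Icc D.l D.r, HasDerivAt (S.sol lam) (2 * S.solQuasi lam x / S.p x) x := by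
    rw [← h.l_eq, ← h.r_eq]; exact hs.deriv_fst
  have hd2 : ∀ x ∈ Icc D.l D.r, HasDerivAt (fun x => 2 * S.solQuasi lam x / S.p x)
      (2 * S.s x * (S.κ x - lam) * S.sol lam x - 4 * S.c x * S.solQuasi lam x / S.p x) x := by
    rw [← h.l_eq, ← h.r_eq]
    intro x hx
    have hp := (S.p_pos x).ne'
    refine (((hs.deriv_snd x hx).const_mul 2).div (S.hasDerivAt_p x) hp).congr_deriv ?_
    unfold w
    field_simp
    ring
  have e1 : ∀ x ∈ Icc D.l D.r, D.d1 (S.sol lam) x = 2 * S.solQuasi lam x / S.p x := fun x hx =>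
    (hd1 x hx).hasDerivWithinAt.derivWithin (hu x hx)
  have e2 : ∀ x ∈ Icc D.l D.r, D.d2 (S.sol lam) x =
      2 * S.s x * (S.κ x - lam) * S.sol lam x - 4 * S.c x * S.solQuasi lam x / S.p x := fun x hx => by
    rw [StickyDiffusion.d2]
    exact (((hd2 x hx).hasDerivWithinAt).congr e1 (e1 x hx)).derivWithin (hu x hx)
  refine ⟨?_, ⟨D.l, ⟨le_rfl, hlr.le⟩, ?_⟩, fun x hx => ?_, ?_, ?_⟩
  · rw [show (2 : WithTop ℕ∞) = 1 + 1 by norm_num, contDiffOn_succ_iff_derivWithin hu]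
    refine ⟨fun x hx => (hd1 x hx).differentiableAt.differentiableWithinAt, by simp, ?_⟩
    rw [show (1 : WithTop ℕ∞) = 0 + 1 by norm_num, contDiffOn_succ_iff_derivWithin hu]
    refine ⟨fun x hx => (((hd2 x hx).hasDerivWithinAt).congr e1 (e1 x hx)).differentiableWithinAt,
      by simp, ?_⟩
    rw [contDiffOn_zero]
    have hc := S.continuous_c; have hs' := S.continuous_s; have hκ := S.continuous_κ
    have hp := S.continuous_p; have hf := hs.cont_fst; have hg := hs.cont_snd
    have hp0 : ∀ x, S.p x ≠ 0 := fun x => (S.p_pos x).ne'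
    exact ContinuousOn.congr (Continuous.continuousOn (by fun_prop (disch := assumption))) e2
  · rw [← h.l_eq]; exact S.sol_left_ne_zero lam
  · have hx' := Ioo_subset_Icc_self hx
    rw [StickyDiffusion.generator, e1 x hx', e2 x hx', h.c_eq x hx', ← h.κ_eq x hx']
    have := h.s_eq x hx'
    linear_combination ((S.κ x - lam) * S.sol lam x) * this
  · rw [e1 D.l ⟨le_rfl, hlr.le⟩, ← h.κ_eq D.l ⟨le_rfl, hlr.le⟩, ← h.l_eq, ← h.ρ_eq, S.p_left]
    linear_combination hs.left
  · rw [← h.r_eq]; exact h0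

/-- An eigenfunction is a multiple of `sol lam`: their Wronskian is constant and vanishes at `l`,
since both satisfy the sticky condition. The factor is not zero, so the condition at `r` passes to
`sol lam`. -/
theorem Represents.sol_right_eq_zero (h : S.Represents D) {lam : ℝ} {φ : ℝ → ℝ}
    (hφ : D.IsEigenpair lam φ) : S.sol lam S.r = 0 := by
  have hs := S.isSolution_sol lam
  have hlr := S.hlr
  rw [h.l_eq, h.r_eq] at hlr
  have hu := uniqueDiffOn_Icc hlr
  have hs1 : ∀ x ∈ Icc D.l D.r, HasDerivAt (S.sol lam) (2 * S.solQuasi lam x / S.p x) x := by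
    rw [← h.l_eq, ← h.r_eq]; exact hs.deriv_fst
  have hs2 : ∀ x ∈ Icc D.l D.r, HasDerivAt (S.solQuasi lam)
      (S.w x * (S.κ x - lam) * S.sol lam x) x := by
    rw [← h.l_eq, ← h.r_eq]; exact hs.deriv_snd
  have hmem : ∀ x ∈ Ioo D.l D.r, Icc D.l D.r ∈ 𝓝 x := fun x hx => Icc_mem_nhds hx.1 hx.2
  have hC1 : ContDiffOn ℝ 1 (D.d1 φ) (Icc D.l D.r) := hφ.smooth.derivWithin hu (by norm_num)
  have hφ1 : ∀ x ∈ Ioo D.l D.r, HasDerivAt φ (D.d1 φ x) x := fun x hx =>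
    ((hφ.smooth.differentiableOn (by simp) x
      (Ioo_subset_Icc_self hx)).hasDerivWithinAt).hasDerivAt (hmem x hx)
  have hφ2 : ∀ x ∈ Ioo D.l D.r, HasDerivAt (D.d1 φ) (D.d2 φ x) x := fun x hx =>
    ((hC1.differentiableOn (by simp) x
      (Ioo_subset_Icc_self hx)).hasDerivWithinAt).hasDerivAt (hmem x hx)
  have hq1 : ∀ x ∈ Ioo D.l D.r, HasDerivAt φ (2 * (S.p x * D.d1 φ x / 2) / S.p x) x := fun x hx => by
    have := (S.p_pos x).ne'
    exact (hφ1 x hx).congr_deriv (by field_simp)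
  have hq2 : ∀ x ∈ Ioo D.l D.r, HasDerivAt (fun x => S.p x * D.d1 φ x / 2)
      (S.w x * (S.κ x - lam) * φ x) x := fun x hx => by
    refine (((S.hasDerivAt_p x).mul (hφ2 x hx)).div_const 2).congr_deriv ?_
    have hx' := Ioo_subset_Icc_self hx
    have h1 := hφ.interior x hx
    have h2 := h.s_eq x hx'
    rw [StickyDiffusion.generator, h.c_eq x hx', ← h.κ_eq x hx'] at h1
    unfold w
    linear_combination (S.p x * S.s x) * h1 - (S.p x * (S.c x * D.d1 φ x + D.d2 φ x / 2)) * h2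
  have hcp := S.continuous_p.continuousOn (s := Icc D.l D.r)
  have hc1 := hφ.smooth.continuousOn
  have hc2 := hC1.continuousOn
  have hc3 := hs.cont_fst.continuousOn (s := Icc D.l D.r)
  have hc4 := hs.cont_snd.continuousOn (s := Icc D.l D.r)
  have hcq : ContinuousOn (fun x => S.p x * D.d1 φ x / 2) (Icc D.l D.r) := (hcp.mul hc2).div_const 2
  have hrad : ∀ x, S.sol lam x ^ 2 + S.solQuasi lam x ^ 2 ≠ 0 := fun x => by
    have := S.radius_pos lam x
    have h1 := Real.sin_sq_add_cos_sq (S.angle lam x)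
    have h2 : S.sol lam x ^ 2 + S.solQuasi lam x ^ 2 = S.radius lam x ^ 2 := by
      unfold sol solQuasi
      linear_combination (S.radius lam x ^ 2) * h1
    rw [h2]; positivity
  have hW : ∀ x ∈ Icc D.l D.r, S.p x * D.d1 φ x / 2 * S.sol lam x - φ x * S.solQuasi lam x = 0 := by
    intro x hx
    rw [eq_left_of_hasDerivAt_zero
      (f := fun x => S.p x * D.d1 φ x / 2 * S.sol lam x - φ x * S.solQuasi lam x)
      ((hcq.mul hc3).sub (hc1.mul hc4)) (fun y hy => ?_) hx]
    · have h1 := hφ.sticky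
      have h2 := hs.left
      have h3 := S.p_left
      rw [h.l_eq] at h2 h3
      rw [← h.κ_eq D.l ⟨le_rfl, hlr.le⟩, ← h.ρ_eq] at h1
      have hρ := S.hρ.ne'
      simp only [h3]
      have h4 : 2 * S.ρ * (1 * D.d1 φ D.l / 2 * S.sol lam D.l - φ D.l * S.solQuasi lam D.l) = 0 := by
        linear_combination (S.sol lam D.l) * h1 - φ D.l * h2
      simpa [hρ] using h4
    · have hy' := Ioo_subset_Icc_self hy
      refine (((hq2 y hy).mul (hs1 y hy')).sub ((hq1 y hy).mul (hs2 y hy'))).congr_deriv ?_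
      ring
  -- The factor is found by projecting `(φ, p φ' / 2)` onto `(sol, solQuasi)`. Its denominator is
  -- the squared radius, so zeros of `sol` cause no division by zero.
  have hconst : ∀ x ∈ Icc D.l D.r, φ x = (φ D.l * S.sol lam D.l +
      S.p D.l * D.d1 φ D.l / 2 * S.solQuasi lam D.l) /
      (S.sol lam D.l ^ 2 + S.solQuasi lam D.l ^ 2) * S.sol lam x := by
    intro x hx
    have h1 := eq_left_of_hasDerivAt_zero
      (f := fun x => (φ x * S.sol lam x + S.p x * D.d1 φ x / 2 * S.solQuasi lam x) /
        (S.sol lam x ^ 2 + S.solQuasi lam x ^ 2))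
      (((hc1.mul hc3).add (hcq.mul hc4)).div ((hc3.pow 2).add (hc4.pow 2)) fun y _ => hrad y)
      (fun y hy => ?_) hx
    · rw [← h1, div_mul_eq_mul_div, eq_div_iff (hrad x)]
      linear_combination (-S.solQuasi lam x) * hW x hx
    · have hy' := Ioo_subset_Icc_self hy
      refine ((((hq1 y hy).mul (hs1 y hy')).add ((hq2 y hy).mul (hs2 y hy'))).div
        (((hs1 y hy').pow 2).add ((hs2 y hy').pow 2)) (hrad y)).congr_deriv ?_
      rw [div_eq_zero_iff]
      left
      have hw := hW y hy'
      simp only [Pi.mul_apply, Pi.add_apply, Pi.pow_apply]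
      generalize S.p y * D.d1 φ y / 2 = q at hw ⊢
      have hp := (S.p_pos y).ne'
      linear_combination ((2 / S.p y + S.w y * (S.κ y - lam)) *
        (S.sol lam y ^ 2 - S.solQuasi lam y ^ 2)) * hw
  obtain ⟨x, hx, hne⟩ := hφ.nonzero
  have h1 := hconst D.r ⟨hlr.le, le_rfl⟩
  rw [hφ.killed] at h1
  have h2 := hconst x hx
  rw [h.r_eq]
  refine (mul_eq_zero.1 h1.symm).resolve_left fun h3 => hne ?_
  rw [h2, h3, zero_mul]

theorem Represents.isIncreasingEnumeration (h : S.Represents D) :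
    IsIncreasingEnumeration (Set.Ici 1) S.eig D.eigenvalues := by
  refine ⟨S.eig_strictMonoOn, ?_⟩
  ext lam
  rw [mem_image]
  constructor
  · intro hk
    exact ⟨_, h.isEigenpair_sol ((S.sol_right_eq_zero_iff lam).2 hk)⟩
  · rintro ⟨φ, hφ⟩
    exact (S.sol_right_eq_zero_iff lam).1 (h.sol_right_eq_zero hφ)

end StickyCoeff

/-! ### Symmetrizable matrices -/

/-- `f j` is an `m`-orthonormal eigenbasis of `-G` with increasing eigenvalues `ev j`. -/
structure IsSpectralBasis {N : ℕ} (G : Matrix (Fin N) (Fin N) ℝ) (m : Fin N → ℝ) (ev : Fin N → ℝ)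
    (f : Fin N → Fin N → ℝ) : Prop where
  mono : Monotone ev
  eigen : ∀ j i, G.mulVec (f j) i = -ev j * f j i
  orthonormal : ∀ j k, ∑ i, m i * (f j i * f k i) = if j = k then 1 else 0
  complete : ∀ i k, ∑ j, m i * (f j i * f j k) = if i = k then 1 else 0

/-- Conjugation by the square roots of the weights turns `-G` into a symmetric matrix; the spectral
theorem applies, the eigenvectors are scaled back, and the eigenvalues are sorted. -/
theorem exists_isSpectralBasis {N : ℕ} (G : Matrix (Fin N) (Fin N) ℝ) (m : Fin N → ℝ)
    (hm : ∀ i, 0 < m i) (hsym : ∀ i j, m i * G i j = m j * G j i) :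
    ∃ ev f, IsSpectralBasis G m ev f := by
  set q : Fin N → ℝ := fun i => Real.sqrt (m i) with hq
  have hq0 : ∀ i, q i ≠ 0 := fun i => (Real.sqrt_pos.2 (hm i)).ne'
  have hqq : ∀ i, q i * q i = m i := fun i => Real.mul_self_sqrt (hm i).le
  let A : Matrix (Fin N) (Fin N) ℝ := Matrix.of fun i j => -(q i * G i j / q j)
  have hA : A.IsHermitian := by
    ext i j
    simp only [Matrix.conjTranspose_apply, star_trivial, A, Matrix.of_apply]
    have h := hsym i j
    rw [← hqq i, ← hqq j] at h
    have h1 := hq0 i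
    have h2 := hq0 j
    rw [neg_inj, div_eq_div_iff h1 h2]
    linarith
  set σ := Tuple.sort hA.eigenvalues with hσ
  set e : Fin N → Fin N → ℝ := fun j i => (hA.eigenvectorBasis (σ j)).ofLp i with he
  have horth : ∀ j k, ∑ i, m i * (e j i / q i * (e k i / q i)) = if j = k then 1 else 0 := by
    intro j k
    have h1 := (orthonormal_iff_ite.1 hA.eigenvectorBasis.orthonormal) (σ k) (σ j)
    rw [PiLp.inner_apply] at h1
    have h2 : (∑ i, m i * (e j i / q i * (e k i / q i))) =
        ∑ i, inner ℝ ((hA.eigenvectorBasis (σ k)).ofLp i) ((hA.eigenvectorBasis (σ j)).ofLp i) := by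
      refine Finset.sum_congr rfl fun i _ => ?_
      have := hq0 i
      have h3 : inner ℝ ((hA.eigenvectorBasis (σ k)).ofLp i) ((hA.eigenvectorBasis (σ j)).ofLp i) =
        e j i * e k i := by simp [he]
      rw [← hqq i, h3]
      field_simp
    rw [h2, h1]
    simp [eq_comm]
  refine ⟨hA.eigenvalues ∘ σ, fun j i => e j i / q i, Tuple.monotone_sort _, fun j i => ?_, horth, ?_⟩
  · have h1 := congrFun (hA.mulVec_eigenvectorBasis (σ j)) i
    simp only [Matrix.mulVec, dotProduct, A, Matrix.of_apply, Pi.smul_apply, smul_eq_mul] at h1 ⊢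
    have h0 := hq0 i
    have h2 : q i * ∑ k, G i k * (e j k / q k) =
        -∑ k, -(q i * G i k / q k) * (hA.eigenvectorBasis (σ j)).ofLp k := by
      rw [Finset.mul_sum, ← Finset.sum_neg_distrib]
      exact Finset.sum_congr rfl fun k _ => by simp only [he]; ring
    rw [h1] at h2
    simp only [Function.comp]
    refine mul_left_cancel₀ h0 ?_
    rw [h2]
    simp only [he]
    field_simp
  -- Orthonormality says that two square matrices multiply to `1` in one order; completeness is the
  -- other order.
  · have h1 : (Matrix.of fun j i => m i * (e j i / q i)) * (Matrix.of fun j i => e j i / q i).transpose = 1 := by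
      ext j k
      rw [Matrix.mul_apply, Matrix.one_apply, ← horth j k]
      exact Finset.sum_congr rfl fun i _ => by simp; ring
    rw [mul_eq_one_comm] at h1
    intro i k
    have h2 := congrFun (congrFun h1 k) i
    rw [Matrix.mul_apply, Matrix.one_apply] at h2
    simp only [eq_comm (a := i)]
    rw [← h2]
    exact Finset.sum_congr rfl fun i _ => by simp; ring

/-! ### Coordinates and Rayleigh quotients in the eigenbasis -/

namespace IsSpectralBasis

variable {N : ℕ} {G : Matrix (Fin N) (Fin N) ℝ} {m ev : Fin N → ℝ} {f : Fin N → Fin N → ℝ}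

/-- The coordinates of `u` in the eigenbasis. -/
def coord (m : Fin N → ℝ) (f : Fin N → Fin N → ℝ) (u : Fin N → ℝ) (j : Fin N) : ℝ :=
  ∑ i, m i * (f j i * u i)

theorem sum_coord (h : IsSpectralBasis G m ev f) (u : Fin N → ℝ) (k : Fin N) :
    ∑ j, coord m f u j * f j k = u k := by
  calc ∑ j, coord m f u j * f j k = ∑ j, ∑ i, u i * (m i * (f j i * f j k)) :=
        Finset.sum_congr rfl fun j _ => by
          rw [coord, Finset.sum_mul]; exact Finset.sum_congr rfl fun i _ => by ring
    _ = ∑ i, u i * ∑ j, m i * (f j i * f j k) := by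
        rw [Finset.sum_comm]; exact Finset.sum_congr rfl fun i _ => by rw [Finset.mul_sum]
    _ = u k := by simp [h.complete]

theorem coord_sum (h : IsSpectralBasis G m ev f) (a : Fin N → ℝ) (j : Fin N) :
    coord m f (fun i => ∑ k, a k * f k i) j = a j := by
  calc coord m f (fun i => ∑ k, a k * f k i) j = ∑ i, ∑ k, a k * (m i * (f j i * f k i)) :=
        Finset.sum_congr rfl fun i _ => by
          rw [Finset.mul_sum, Finset.mul_sum]; exact Finset.sum_congr rfl fun k _ => by ring
    _ = ∑ k, a k * ∑ i, m i * (f j i * f k i) := by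
        rw [Finset.sum_comm]; exact Finset.sum_congr rfl fun i _ => by rw [Finset.mul_sum]
    _ = a j := by simp [h.orthonormal]

theorem sum_mul_eq (h : IsSpectralBasis G m ev f) (u v : Fin N → ℝ) :
    ∑ i, m i * (u i * v i) = ∑ j, coord m f u j * coord m f v j := by
  calc ∑ i, m i * (u i * v i) = ∑ i, ∑ j, coord m f u j * (m i * (f j i * v i)) :=
        Finset.sum_congr rfl fun i _ => by
          conv_lhs => rw [← h.sum_coord u i]
          rw [Finset.sum_mul, Finset.mul_sum]
          exact Finset.sum_congr rfl fun k _ => by ring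
    _ = _ := by
        rw [Finset.sum_comm]; exact Finset.sum_congr rfl fun i _ => by rw [← Finset.mul_sum]; rfl

theorem mulVec_eq (h : IsSpectralBasis G m ev f) (u : Fin N → ℝ) (i : Fin N) :
    G.mulVec u i = ∑ j, (-ev j * coord m f u j) * f j i := by
  calc G.mulVec u i = ∑ k, G i k * u k := rfl
    _ = ∑ k, ∑ j, coord m f u j * (G i k * f j k) :=
        Finset.sum_congr rfl fun k _ => by
          conv_lhs => rw [← h.sum_coord u k]
          rw [Finset.mul_sum]
          exact Finset.sum_congr rfl fun j _ => by ring
    _ = _ := by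
        rw [Finset.sum_comm]
        refine Finset.sum_congr rfl fun j _ => ?_
        rw [← Finset.mul_sum]
        have := h.eigen j i
        rw [Matrix.mulVec, dotProduct] at this
        rw [this]; ring

theorem coord_mulVec (h : IsSpectralBasis G m ev f) (u : Fin N → ℝ) (j : Fin N) :
    coord m f (G.mulVec u) j = -ev j * coord m f u j := by
  rw [show G.mulVec u = fun i => ∑ j, (-ev j * coord m f u j) * f j i from
    funext fun i => h.mulVec_eq u i, h.coord_sum]

theorem energy_eq (h : IsSpectralBasis G m ev f) (u : Fin N → ℝ) :
    -∑ i, m i * (u i * G.mulVec u i) = ∑ j, ev j * coord m f u j ^ 2 := by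
  rw [h.sum_mul_eq, ← Finset.sum_neg_distrib]
  exact Finset.sum_congr rfl fun j _ => by rw [h.coord_mulVec]; ring

/-- The half of the min-max principle for vectors orthogonal to the lower eigenvectors; it receives
sampled eigenfunctions. -/
theorem le_energy (h : IsSpectralBasis G m ev f) {u : Fin N → ℝ} {k : Fin N}
    (hu : ∀ j < k, coord m f u j = 0) :
    ev k * ∑ i, m i * (u i * u i) ≤ -∑ i, m i * (u i * G.mulVec u i) := by
  rw [h.energy_eq, h.sum_mul_eq, Finset.mul_sum]
  refine Finset.sum_le_sum fun j _ => ?_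
  rcases lt_or_ge j k with hj | hj
  · simp [hu j hj]
  · have := mul_le_mul_of_nonneg_right (h.mono hj) (mul_self_nonneg (coord m f u j))
    linarith

/-- The other half, for vectors spanned by the lower eigenvectors; it is applied to the nodal values
that get interpolated. -/
theorem energy_le (h : IsSpectralBasis G m ev f) {a : Fin N → ℝ} {k : Fin N}
    (ha : ∀ j, k < j → a j = 0) :
    -∑ i, m i * ((∑ t, a t * f t i) * G.mulVec (fun i => ∑ t, a t * f t i) i) ≤
      ev k * ∑ i, m i * ((∑ t, a t * f t i) * (∑ t, a t * f t i)) := by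
  rw [h.energy_eq fun i => ∑ t, a t * f t i,
    h.sum_mul_eq (fun i => ∑ t, a t * f t i) (fun i => ∑ t, a t * f t i), Finset.mul_sum]
  refine Finset.sum_le_sum fun j _ => ?_
  rw [h.coord_sum]
  rcases lt_or_ge k j with hj | hj
  · simp [ha j hj]
  · have := mul_le_mul_of_nonneg_right (h.mono hj) (mul_self_nonneg (a j))
    linarith

theorem mass_pos (h : IsSpectralBasis G m ev f) {a : Fin N → ℝ} (ha : a ≠ 0) :
    0 < ∑ i, m i * ((∑ t, a t * f t i) * (∑ t, a t * f t i)) := by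
  rw [h.sum_mul_eq (fun i => ∑ t, a t * f t i) (fun i => ∑ t, a t * f t i)]
  simp only [h.coord_sum]
  obtain ⟨i, hi⟩ := Function.ne_iff.1 ha
  exact Finset.sum_pos' (fun i _ => mul_self_nonneg _) ⟨i, Finset.mem_univ i, mul_self_pos.2 hi⟩

theorem ne_zero (h : IsSpectralBasis G m ev f) (j : Fin N) : f j ≠ 0 := fun h0 => by
  have := h.orthonormal j j
  simp [h0] at this

/-- Two eigenvectors for one eigenvalue have a combination vanishing at `z`, hence zero by
hypothesis. Orthonormality then forces `f k z = 0`, hence `f k = 0`. -/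
theorem strictMono (h : IsSpectralBasis G m ev f) {z : Fin N}
    (hz : ∀ (v : Fin N → ℝ) (t : ℝ), (∀ i, G.mulVec v i = t * v i) → v z = 0 → v = 0) :
    StrictMono ev := by
  refine h.mono.strictMono_of_injective fun j k hjk => ?_
  by_contra hne
  have h1 : (f k z) • f j - (f j z) • f k = 0 := by
    refine hz _ (-ev j) (fun i => ?_) (by simp; ring)
    rw [Matrix.mulVec_sub, Matrix.mulVec_smul, Matrix.mulVec_smul]
    simp only [Pi.sub_apply, Pi.smul_apply, smul_eq_mul, h.eigen, hjk]
    ring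
  have hkz : f k z ≠ 0 := fun h0 => h.ne_zero k (hz _ (-ev k) (h.eigen k) h0)
  have h2 : ∑ i, m i * (f j i * (f k z * f j i - f j z * f k i)) = f k z := by
    have e1 := h.orthonormal j j
    have e2 := h.orthonormal j k
    rw [if_pos rfl] at e1
    rw [if_neg hne] at e2
    calc _ = f k z * ∑ i, m i * (f j i * f j i) - f j z * ∑ i, m i * (f j i * f k i) := by
          rw [Finset.mul_sum, Finset.mul_sum, ← Finset.sum_sub_distrib]
          exact Finset.sum_congr rfl fun i _ => by ring
      _ = _ := by rw [e1, e2]; ring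
  apply hkz
  rw [← h2]
  refine Finset.sum_eq_zero fun i _ => ?_
  have := congrFun h1 i
  simp only [Pi.sub_apply, Pi.smul_apply, smul_eq_mul, Pi.zero_apply] at this
  rw [this, mul_zero, mul_zero]

theorem hasEigenvalue_iff (h : IsSpectralBasis G m ev f) (lam : ℝ) :
    Module.End.HasEigenvalue (Matrix.toLin' G) (-lam) ↔ ∃ j, ev j = lam := by
  constructor
  · intro he
    obtain ⟨v, hv⟩ := he.exists_hasEigenvector
    by_contra! hcon
    refine hv.2 ?_
    have h1 : G.mulVec v = (-lam) • v := by simpa using hv.apply_eq_smul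
    have h2 : ∀ j, coord m f v j = 0 := fun j => by
      have h3 := h.coord_mulVec v j
      have h4 : coord m f (G.mulVec v) j = -lam * coord m f v j := by
        rw [h1, coord, coord, Finset.mul_sum]
        exact Finset.sum_congr rfl fun i _ => by simp only [Pi.smul_apply, smul_eq_mul]; ring
      have h5 : (ev j - lam) * coord m f v j = 0 := by linarith
      exact (mul_eq_zero.1 h5).resolve_left (sub_ne_zero.2 (hcon j))
    ext k
    rw [← h.sum_coord v k]
    simp [h2]
  · rintro ⟨j, rfl⟩
    refine Module.End.hasEigenvalue_of_hasEigenvector (x := f j) ⟨?_, h.ne_zero j⟩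
    rw [Module.End.mem_eigenspace_iff, Matrix.toLin'_apply]
    ext i
    simpa using h.eigen j i

end IsSpectralBasis

/-! ### Tridiagonal generators -/

/-- The generator of a birth and death chain on `0, …, n` with killing. -/
def birthDeath (n : ℕ) (d b κ : ℕ → ℝ) : Matrix (Fin (n + 1)) (Fin (n + 1)) ℝ :=
  fun i j =>
    if (j : ℕ) = i then -d i - b i - κ i
    else if (j : ℕ) + 1 = i then d i
    else if (j : ℕ) = i + 1 then b i
    else 0

/-- Nodal values live on all of `ℕ`: `u (n + 1) = 0` encodes killing at `r`, and `d 0 = 0` makes the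
truncated `i - 1` harmless at `i = 0`. -/
theorem birthDeath_mulVec {n : ℕ} {d b κ u : ℕ → ℝ} (hd : d 0 = 0) (hu : u (n + 1) = 0)
    (i : Fin (n + 1)) : (birthDeath n d b κ).mulVec (fun j => u j) i =
      d i * (u (i - 1) - u i) + b i * (u (i + 1) - u i) - κ i * u i := by
  obtain ⟨i, hi⟩ := i
  have h1 : (birthDeath n d b κ).mulVec (fun j => u j) ⟨i, hi⟩ = ∑ j ∈ Finset.range (n + 1),
      ((if i = j then (-d i - b i - κ i) * u j else 0) + (if j + 1 = i then d i * u j else 0) +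
        (if i + 1 = j then b i * u j else 0)) := by
    rw [← Fin.sum_univ_eq_sum_range (fun j => (if i = j then (-d i - b i - κ i) * u j else 0) +
      (if j + 1 = i then d i * u j else 0) + (if i + 1 = j then b i * u j else 0)) (n + 1)]
    change ∑ j, birthDeath n d b κ ⟨i, hi⟩ j * u j = _
    refine Finset.sum_congr rfl fun j _ => ?_
    simp only [birthDeath]
    split_ifs <;> first | omega | simp
  rw [h1, Finset.sum_add_distrib, Finset.sum_add_distrib, Finset.sum_ite_eq, Finset.sum_ite_eq,
    if_pos (Finset.mem_range.2 hi)]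
  have h3 : (if i + 1 ∈ Finset.range (n + 1) then b i * u (i + 1) else 0) = b i * u (i + 1) := by
    split_ifs with h
    · rfl
    · have : i + 1 = n + 1 := by rw [Finset.mem_range] at h; omega
      rw [this, hu, mul_zero]
  rw [h3]
  cases i with
  | zero => simp [hd]; ring
  | succ i =>
    have h4 : ∑ j ∈ Finset.range (n + 1), (if j + 1 = i + 1 then d (i + 1) * u j else 0) =
        d (i + 1) * u i := by
      simp only [add_left_inj]
      rw [Finset.sum_ite_eq', if_pos (Finset.mem_range.2 (by omega))]
    rw [h4]
    simp
    ring

/-- As the up rates do not vanish, the three-term recurrence determines an eigenvector from its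
value at `0`. -/
theorem birthDeath_eq_zero {n : ℕ} {d b κ : ℕ → ℝ} (hd : d 0 = 0) (hb : ∀ i < n, b i ≠ 0)
    (v : Fin (n + 1) → ℝ) (t : ℝ) (hv : ∀ i, (birthDeath n d b κ).mulVec v i = t * v i)
    (h0 : v 0 = 0) : v = 0 := by
  let u : ℕ → ℝ := fun i => if h : i < n + 1 then v ⟨i, h⟩ else 0
  have huv : v = fun j : Fin (n + 1) => u j := by ext j; simp only [u, dif_pos j.2]
  have hu : u (n + 1) = 0 := by simp [u]
  rw [huv] at hv
  have key : ∀ i, i ≤ n → (u i = 0 ∧ u (i - 1) = 0) := by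
    intro i
    induction i with
    | zero => intro _; have : u 0 = 0 := h0; simp [this]
    | succ i ih =>
      intro hi
      obtain ⟨h1, h2⟩ := ih (by omega)
      have h3 := hv ⟨i, by omega⟩
      rw [birthDeath_mulVec hd hu] at h3
      simp only [h1, h2, sub_zero, mul_zero, zero_add] at h3
      exact ⟨(mul_eq_zero.1 h3).resolve_left (hb i (by omega)), by simpa using h1⟩
  rw [huv]
  ext j
  exact (key j (by omega)).1

theorem birthDeath_symm {n : ℕ} {d b κ m : ℕ → ℝ} (hdb : ∀ i < n, m i * b i = m (i + 1) * d (i + 1))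
    (i j : Fin (n + 1)) : m i * birthDeath n d b κ i j = m j * birthDeath n d b κ j i := by
  obtain ⟨i, hi⟩ := i
  obtain ⟨j, hj⟩ := j
  simp only [birthDeath]
  rcases Nat.lt_trichotomy i j with h | h | h
  · by_cases h1 : j = i + 1
    · subst h1
      rw [if_neg (by omega), if_neg (by omega), if_pos rfl, if_neg (by omega), if_pos rfl]
      exact hdb i (by omega)
    · rw [if_neg (by omega), if_neg (by omega), if_neg (by omega), if_neg (by omega),
        if_neg (by omega), if_neg (by omega), mul_zero, mul_zero]
  · subst h; rfl
  · by_cases h1 : i = j + 1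
    · subst h1
      rw [if_neg (by omega), if_pos rfl, if_neg (by omega), if_neg (by omega), if_pos rfl]
      exact (hdb j (by omega)).symm
    · rw [if_neg (by omega), if_neg (by omega), if_neg (by omega), if_neg (by omega),
        if_neg (by omega), if_neg (by omega), mul_zero, mul_zero]

/-- Summation by parts. The conductance `C n` belongs to the jump into the killed state, so its term
is `C n * u n ^ 2`. -/
theorem birthDeath_energy {n : ℕ} {d b κ m C u : ℕ → ℝ} (hd : d 0 = 0)
    (hC : ∀ i ≤ n, m i * b i = C i) (hC' : ∀ i < n, m (i + 1) * d (i + 1) = C i)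
    (hu : u (n + 1) = 0) :
    -∑ i : Fin (n + 1), m i * (u i * (birthDeath n d b κ).mulVec (fun j => u j) i) =
      ∑ i ∈ Finset.range (n + 1), C i * (u (i + 1) - u i) ^ 2 +
        ∑ i ∈ Finset.range (n + 1), m i * (κ i * u i ^ 2) := by
  simp_rw [birthDeath_mulVec hd hu]
  rw [Fin.sum_univ_eq_sum_range (fun i => m i * (u i * (d i * (u (i - 1) - u i) +
    b i * (u (i + 1) - u i) - κ i * u i))) (n + 1)]
  have h1 : ∑ i ∈ Finset.range (n + 1), m i * (u i * (d i * (u (i - 1) - u i))) =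
      ∑ i ∈ Finset.range (n + 1), C i * (u (i + 1) * (u i - u (i + 1))) := by
    rw [Finset.sum_range_succ', Finset.sum_range_succ, hu, hd]
    simp only [zero_mul, mul_zero, add_zero]
    refine Finset.sum_congr rfl fun i hi => ?_
    rw [← hC' i (Finset.mem_range.1 hi), Nat.add_sub_cancel]
    ring
  have h2 : ∑ i ∈ Finset.range (n + 1), m i * (u i * (b i * (u (i + 1) - u i))) =
      ∑ i ∈ Finset.range (n + 1), C i * (u i * (u (i + 1) - u i)) :=
    Finset.sum_congr rfl fun i hi => by
      rw [← hC i (by have := Finset.mem_range.1 hi; omega)]; ring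
  have h3 : ∑ i ∈ Finset.range (n + 1), m i * (u i * (d i * (u (i - 1) - u i) +
      b i * (u (i + 1) - u i) - κ i * u i)) =
      ∑ i ∈ Finset.range (n + 1), m i * (u i * (d i * (u (i - 1) - u i))) +
      ∑ i ∈ Finset.range (n + 1), m i * (u i * (b i * (u (i + 1) - u i))) -
      ∑ i ∈ Finset.range (n + 1), m i * (κ i * u i ^ 2) := by
    rw [← Finset.sum_add_distrib, ← Finset.sum_sub_distrib]
    exact Finset.sum_congr rfl fun i _ => by ring
  rw [h3, h1, h2, ← Finset.sum_add_distrib]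
  have h4 : ∑ i ∈ Finset.range (n + 1), (C i * (u (i + 1) * (u i - u (i + 1))) +
      C i * (u i * (u (i + 1) - u i))) = -∑ i ∈ Finset.range (n + 1), C i * (u (i + 1) - u i) ^ 2 := by
    rw [← Finset.sum_neg_distrib]
    exact Finset.sum_congr rfl fun i _ => by ring
  rw [h4]
  ring

/-! ### Meshes and the symmetrizing weights -/

/-- The `i`-th cell length. -/
def gap (x : ℕ → ℝ) (i : ℕ) : ℝ := x (i + 1) - x i

namespace StickyCoeff

/-- `x 0 < ⋯ < x (n + 1)` is a sufficiently fine mesh of `[l, r]` with cells of length at most `h`. -/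
structure IsMesh (S : StickyCoeff) (n : ℕ) (x : ℕ → ℝ) (h K : ℝ) : Prop where
  left : x 0 = S.l
  right : x (n + 1) = S.r
  lt_succ : ∀ i ≤ n, x i < x (i + 1)
  step_le : ∀ i ≤ n, gap x i ≤ h
  card_le : n * h ≤ K
  le_one : h ≤ 1
  small : ∀ y ∈ Icc S.l S.r, |S.c y| * h ≤ 1 / 4

variable {S : StickyCoeff} {n : ℕ} {x : ℕ → ℝ} {h K : ℝ}

namespace IsMesh

theorem le_of_le (H : S.IsMesh n x h K) {i j : ℕ} (hij : i ≤ j) (hj : j ≤ n + 1) : x i ≤ x j := by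
  induction j, hij using Nat.le_induction with
  | base => exact le_rfl
  | succ j _ ih => exact (ih (by omega)).trans (H.lt_succ j (by omega)).le

theorem mem (H : S.IsMesh n x h K) {i : ℕ} (hi : i ≤ n + 1) : x i ∈ Icc S.l S.r := by
  rw [← H.left, ← H.right]
  exact ⟨H.le_of_le (Nat.zero_le i) hi, H.le_of_le hi le_rfl⟩

theorem gap_pos (H : S.IsMesh n x h K) {i : ℕ} (hi : i ≤ n) : 0 < gap x i :=
  sub_pos.2 (H.lt_succ i hi)

theorem h_pos (H : S.IsMesh n x h K) : 0 < h := (H.gap_pos (Nat.zero_le n)).trans_le (H.step_le 0 (Nat.zero_le n))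

theorem abs_mul_gap_le (H : S.IsMesh n x h K) {i j : ℕ} (hi : i ≤ n) (hj : j ≤ n + 1) :
    |S.c (x j) * gap x i| ≤ 1 / 4 := by
  rw [abs_mul, abs_of_pos (H.gap_pos hi)]
  exact (mul_le_mul_of_nonneg_left (H.step_le i hi) (abs_nonneg _)).trans (H.small _ (H.mem hj))

theorem sum_gap (H : S.IsMesh n x h K) : ∑ i ∈ Finset.range (n + 1), gap x i = S.r - S.l := by
  unfold gap
  rw [Finset.sum_range_sub, H.left, H.right]

end IsMesh

/-- `2 gap i` times the `i`-th conductance. -/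
def condWeight (S : StickyCoeff) (x : ℕ → ℝ) : ℕ → ℝ
  | 0 => Real.exp (S.c (x 0) * gap x 0)
  | i + 1 => condWeight S x i * (1 + S.c (x (i + 1)) * gap x i) / (1 - S.c (x (i + 1)) * gap x (i + 1))

/-- The symmetrizing weight of the `i`-th node; `t` is the inverse of the boundary factor. -/
def nodeMass (S : StickyCoeff) (x : ℕ → ℝ) (t : ℝ) : ℕ → ℝ
  | 0 => S.condWeight x 0 * t / (2 * S.ρ)
  | i + 1 => S.condWeight x (i + 1) * ((gap x i + gap x (i + 1)) / 2) * S.s (x (i + 1)) /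
      (1 + S.c (x (i + 1)) * gap x i)

theorem IsMesh.one_add_pos (H : S.IsMesh n x h K) {i j : ℕ} (hi : i ≤ n) (hj : j ≤ n + 1) :
    3 / 4 ≤ 1 + S.c (x j) * gap x i := by
  have := (abs_le.1 (H.abs_mul_gap_le hi hj)).1
  linarith

theorem IsMesh.one_sub_pos (H : S.IsMesh n x h K) {i j : ℕ} (hi : i ≤ n) (hj : j ≤ n + 1) :
    3 / 4 ≤ 1 - S.c (x j) * gap x i := by
  have := (abs_le.1 (H.abs_mul_gap_le hi hj)).2
  linarith

theorem IsMesh.condWeight_pos (H : S.IsMesh n x h K) {i : ℕ} (hi : i ≤ n) : 0 < S.condWeight x i := by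
  induction i with
  | zero => exact Real.exp_pos _
  | succ i ih =>
    have h1 := H.one_add_pos (i := i) (j := i + 1) (by omega) (by omega)
    have h2 := H.one_sub_pos (i := i + 1) (j := i + 1) hi (by omega)
    have h3 := ih (by omega)
    rw [condWeight]
    exact div_pos (mul_pos h3 (by linarith)) (by linarith)

theorem IsMesh.nodeMass_pos (H : S.IsMesh n x h K) {t : ℝ} (ht : 0 < t) {i : ℕ} (hi : i ≤ n) :
    0 < S.nodeMass x t i := by
  have hρ := S.hρ
  have h0 := H.condWeight_pos hi
  cases i with
  | zero => rw [nodeMass]; positivity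
  | succ i =>
    have h1 := H.one_add_pos (i := i) (j := i + 1) (by omega) (by omega)
    have h2 := H.gap_pos (i := i) (by omega)
    have h3 := H.gap_pos hi
    have h4 := S.s_pos _ (H.mem (i := i + 1) (by omega))
    rw [nodeMass]
    exact div_pos (by positivity) (by linarith)

theorem abs_log_one_sub_le {y : ℝ} (hy : |y| ≤ 1 / 4) : |Real.log (1 - y) + y + y ^ 2 / 2| ≤ 2 * |y| ^ 3 := by
  have h1 := Real.abs_log_sub_add_sum_range_le (x := y) (by linarith) 2
  have h2 : ∑ i ∈ Finset.range 2, y ^ (i + 1) / ((i : ℝ) + 1) + Real.log (1 - y) =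
      Real.log (1 - y) + y + y ^ 2 / 2 := by
    simp [Finset.sum_range_succ]; ring
  rw [h2] at h1
  refine h1.trans ?_
  rw [div_le_iff₀ (by linarith)]
  have h3 := mul_nonneg (pow_nonneg (abs_nonneg y) 3) (show 0 ≤ 1 - 2 * |y| by linarith)
  norm_num
  linarith

/-- The logarithm of the scale density. -/
theorem log_p (S : StickyCoeff) (y : ℝ) : Real.log (S.p y) = ∫ t in S.l..y, 2 * S.c t := by
  rw [p, Real.log_exp]

/-- The conductance weights approximate `p (1 + c gap)` to second order. -/
theorem exists_condWeight_bound (S : StickyCoeff) (K : ℝ) : ∃ h₀ C : ℝ, 0 < h₀ ∧ 0 ≤ C ∧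
    ∀ (n : ℕ) (x : ℕ → ℝ) (h : ℝ), h ≤ h₀ → S.IsMesh n x h K → ∀ i ≤ n,
      |S.condWeight x i - S.p (x i) * (1 + S.c (x i) * gap x i)| ≤ C * h ^ 2 := by
  obtain ⟨A, hA0, hA⟩ := exists_abs_le_on_Icc S.continuous_c S.l S.r
  obtain ⟨A₁, hA₁0, hA₁⟩ := exists_abs_le_on_Icc (S.hc.continuous_deriv (by norm_num)) S.l S.r
  obtain ⟨B, hB0, hB⟩ := exists_trapezoid_bound (contDiff_const (c := (2 : ℝ)) |>.mul S.hc) S.l S.r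
  obtain ⟨P, hP0, hP⟩ := exists_abs_le_on_Icc S.continuous_p S.l S.r
  set E := 4 * A ^ 3 + B + A * A₁ with hE
  have hE0 : 0 ≤ E := by positivity
  set C₁ := max K 0 * E + A ^ 2 with hC₁
  have hC₁0 : 0 ≤ C₁ := by positivity
  refine ⟨1 / (2 * C₁ + 1), P * (C₁ + (A + C₁) ^ 2), by positivity, by positivity, ?_⟩
  intro n x h hh H
  have hh0 := H.h_pos
  have hlip : ∀ i ≤ n, |S.c (x (i + 1)) - S.c (x i)| ≤ A₁ * gap x i := fun i hi => by
    have := Convex.norm_image_sub_le_of_norm_hasDerivWithin_le (f := S.c)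
      (f' := deriv S.c) (s := Icc S.l S.r) (C := A₁) (x := x i) (y := x (i + 1))
      (fun y _ => (S.hc.differentiable (by norm_num) y).hasDerivAt.hasDerivWithinAt)
      (fun y hy => hA₁ y hy) (convex_Icc _ _) (H.mem (by omega)) (H.mem (by omega))
    rw [Real.norm_eq_abs, Real.norm_eq_abs] at this
    rwa [show |x (i + 1) - x i| = gap x i from abs_of_pos (H.gap_pos hi)] at this
  -- The quadratic term is essential on a non-uniform mesh: without it the increments would contain
  -- `c² (gap (i + 1)² - gap i²) / 2`, only second order. With it they reduce to cubic logarithm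
  -- remainders, a trapezoidal error for `∫ 2c`, and the change of `c²` across a cell times `gap²`.
  let L : ℕ → ℝ := fun i => Real.log (S.condWeight x i) - Real.log (S.p (x i)) -
    S.c (x i) * gap x i - S.c (x i) ^ 2 * gap x i ^ 2 / 2
  have hstep : ∀ i, i + 1 ≤ n → |L (i + 1) - L i| ≤ E * h ^ 3 := by
    intro i hi
    have hg := H.gap_pos (i := i) (by omega)
    have hg' := H.gap_pos hi
    have hgh := H.step_le i (by omega)
    have hgh' := H.step_le (i + 1) hi
    have e0 := H.one_add_pos (i := i) (j := i + 1) (by omega) (by omega)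
    have e1 := H.one_sub_pos (i := i + 1) (j := i + 1) hi (by omega)
    have hQ := H.condWeight_pos (i := i) (by omega)
    have hlogQ : Real.log (S.condWeight x (i + 1)) = Real.log (S.condWeight x i) +
        Real.log (1 + S.c (x (i + 1)) * gap x i) - Real.log (1 - S.c (x (i + 1)) * gap x (i + 1)) := by
      rw [condWeight, Real.log_div (mul_pos hQ (by linarith)).ne' (by linarith),
        Real.log_mul hQ.ne' (by linarith)]
    have hlogp : Real.log (S.p (x (i + 1))) - Real.log (S.p (x i)) =
        ∫ t in x i..x (i + 1), 2 * S.c t := by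
      have hcc : Continuous fun t => 2 * S.c t := continuous_const.mul S.continuous_c
      rw [S.log_p, S.log_p, integral_interval_sub_left (hcc.intervalIntegrable _ _)
        (hcc.intervalIntegrable _ _)]
    have t1 := abs_log_one_sub_le (y := -(S.c (x (i + 1)) * gap x i))
      (by rw [abs_neg]; exact H.abs_mul_gap_le (by omega) (by omega))
    have t2 := abs_log_one_sub_le (y := S.c (x (i + 1)) * gap x (i + 1))
      (H.abs_mul_gap_le hi (by omega))
    have t3 := hB (x i) (H.mem (by omega)) (x (i + 1)) (H.mem (by omega)) (sub_pos.1 hg).le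
    have hcA := hA (x (i + 1)) (H.mem (by omega))
    have hcA' := hA (x i) (H.mem (i := i) (by omega))
    have hl := hlip i (by omega)
    have b1 : |S.c (x (i + 1)) * gap x i| ^ 3 ≤ A ^ 3 * h ^ 3 := by
      rw [abs_mul, abs_of_pos hg, mul_pow]; gcongr
    have b2 : |S.c (x (i + 1)) * gap x (i + 1)| ^ 3 ≤ A ^ 3 * h ^ 3 := by
      rw [abs_mul, abs_of_pos hg', mul_pow]; gcongr
    have b3 : B * (x (i + 1) - x i) ^ 3 ≤ B * h ^ 3 := by
      have : 0 ≤ x (i + 1) - x i := hg.le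
      have : x (i + 1) - x i ≤ h := hgh
      gcongr
    have b4 : |(S.c (x i) ^ 2 - S.c (x (i + 1)) ^ 2) * gap x i ^ 2 / 2| ≤ A * A₁ * h ^ 3 := by
      have : (S.c (x i) ^ 2 - S.c (x (i + 1)) ^ 2) * gap x i ^ 2 / 2 =
        -((S.c (x (i + 1)) - S.c (x i)) * (S.c (x (i + 1)) + S.c (x i)) * gap x i ^ 2 / 2) := by ring
      rw [this, abs_neg, abs_div, abs_mul, abs_mul, abs_of_pos (show (0 : ℝ) < 2 by norm_num),
        abs_of_nonneg (sq_nonneg (gap x i))]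
      have b5 : |S.c (x (i + 1)) + S.c (x i)| ≤ 2 * A := (abs_add_le _ _).trans (by linarith)
      calc _ ≤ (A₁ * h) * (2 * A) * h ^ 2 / 2 := by
            have : |S.c (x (i + 1)) - S.c (x i)| ≤ A₁ * h :=
              hl.trans (mul_le_mul_of_nonneg_left hgh hA₁0)
            gcongr
        _ = _ := by ring
    rw [abs_neg] at t1
    rw [sub_neg_eq_add] at t1
    have hgd : x (i + 1) - x i = gap x i := rfl
    rw [hgd] at t3 b3
    have key : L (i + 1) - L i =
        (Real.log (1 + S.c (x (i + 1)) * gap x i) + -(S.c (x (i + 1)) * gap x i) +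
          (-(S.c (x (i + 1)) * gap x i)) ^ 2 / 2) -
        (Real.log (1 - S.c (x (i + 1)) * gap x (i + 1)) + S.c (x (i + 1)) * gap x (i + 1) +
          (S.c (x (i + 1)) * gap x (i + 1)) ^ 2 / 2) +
        (gap x i / 2 * (2 * S.c (x i) + 2 * S.c (x (i + 1))) - ∫ t in x i..x (i + 1), 2 * S.c t) +
        (S.c (x i) ^ 2 - S.c (x (i + 1)) ^ 2) * gap x i ^ 2 / 2 := by
      simp only [L]
      rw [hlogQ, ← hlogp]
      ring
    rw [key]
    have t1' := abs_le.1 (t1.trans (mul_le_mul_of_nonneg_left b1 two_pos.le))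
    have t2' := abs_le.1 (t2.trans (mul_le_mul_of_nonneg_left b2 two_pos.le))
    have t3' := abs_le.1 (t3.trans b3)
    have t4' := abs_le.1 b4
    rw [hE, abs_le]
    constructor <;> linarith [t1'.1, t1'.2, t2'.1, t2'.2, t3'.1, t3'.2, t4'.1, t4'.2]
  -- Symmetry fixes the conductances only up to a factor. The starting value `exp (c gap)`, with
  -- `p(l) = 1`, makes the initial error second order.
  have hL0 : L 0 = -(S.c (x 0) ^ 2 * gap x 0 ^ 2 / 2) := by
    simp only [L, condWeight, H.left, S.p_left, Real.log_exp, Real.log_one]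
    ring
  have hsq : ∀ i ≤ n, S.c (x i) ^ 2 * gap x i ^ 2 / 2 ≤ A ^ 2 * h ^ 2 / 2 := fun i hi => by
    have h1 := H.gap_pos hi
    have h2 := H.step_le i hi
    have h3 : S.c (x i) ^ 2 ≤ A ^ 2 := by
      rw [← sq_abs]; have := hA _ (H.mem (i := i) (by omega)); gcongr
    gcongr
  have hLi : ∀ i ≤ n, |L i| ≤ i * (E * h ^ 3) + A ^ 2 * h ^ 2 / 2 := by
    intro i
    induction i with
    | zero =>
      intro _
      rw [hL0, abs_neg, abs_of_nonneg (by positivity)]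
      simpa using hsq 0 (Nat.zero_le n)
    | succ i ih =>
      intro hi
      have h1 := abs_le.1 (ih (by omega))
      have h2 := abs_le.1 (hstep i hi)
      rw [abs_le]
      push_cast
      constructor <;> linarith [h1.1, h1.2, h2.1, h2.2]
  intro i hi
  have hp := S.p_pos (x i)
  have hmain : |Real.log (S.condWeight x i) - Real.log (S.p (x i)) - S.c (x i) * gap x i| ≤
      C₁ * h ^ 2 := by
    have h1 := abs_le.1 (hLi i hi)
    have h2 := hsq i hi
    have h3 : 0 ≤ S.c (x i) ^ 2 * gap x i ^ 2 / 2 := by positivity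
    -- The bound on `n h` is needed here: at most `n` local errors `O(h³)` add up to `O(h²)`.
    have h4 : (i : ℝ) * (E * h ^ 3) ≤ max K 0 * E * h ^ 2 := by
      have h5 : (i : ℝ) * h ≤ max K 0 := by
        have : (i : ℝ) ≤ n := by exact_mod_cast hi
        exact ((mul_le_mul_of_nonneg_right this hh0.le).trans H.card_le).trans (le_max_left _ _)
      calc (i : ℝ) * (E * h ^ 3) = (i * h) * (E * h ^ 2) := by ring
        _ ≤ max K 0 * (E * h ^ 2) := by gcongr
        _ = _ := by ring
    have h6 : Real.log (S.condWeight x i) - Real.log (S.p (x i)) - S.c (x i) * gap x i =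
      L i + S.c (x i) ^ 2 * gap x i ^ 2 / 2 := by simp only [L]; ring
    rw [h6, hC₁, abs_le]
    constructor <;> linarith [h1.1, h1.2]
  have hh1 := H.le_one
  have hC₁h : C₁ * h ^ 2 ≤ 1 / 2 := by
    have h1 : h * (2 * C₁ + 1) ≤ 1 := by
      rwa [le_div_iff₀ (by positivity)] at hh
    nlinarith [mul_nonneg hC₁0 hh0.le]
  set e := Real.log (S.condWeight x i) - Real.log (S.p (x i)) with he
  have heq : S.condWeight x i = S.p (x i) * Real.exp e := by
    rw [he, Real.exp_sub, Real.exp_log (H.condWeight_pos hi), Real.exp_log hp]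
    field_simp
  have hcg : |S.c (x i) * gap x i| ≤ A * h := by
    rw [abs_mul, abs_of_pos (H.gap_pos hi)]
    have := H.step_le i hi
    have := H.gap_pos hi
    have := hA _ (H.mem (i := i) (by omega))
    gcongr
  have hcg4 := H.abs_mul_gap_le hi (j := i) (by omega)
  have he1 : |e| ≤ (A + C₁) * h := by
    have h1 : |e| ≤ |e - S.c (x i) * gap x i| + |S.c (x i) * gap x i| := by
      simpa using abs_add_le (e - S.c (x i) * gap x i) (S.c (x i) * gap x i)
    have h2 : C₁ * h ^ 2 ≤ C₁ * h := by nlinarith [mul_nonneg hC₁0 hh0.le]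
    linarith
  have he2 : |e| ≤ 1 := by
    have h1 : |e| ≤ |e - S.c (x i) * gap x i| + |S.c (x i) * gap x i| := by
      simpa using abs_add_le (e - S.c (x i) * gap x i) (S.c (x i) * gap x i)
    linarith
  have he3 := Real.abs_exp_sub_one_sub_id_le he2
  have he4 : e ^ 2 ≤ (A + C₁) ^ 2 * h ^ 2 := by
    rw [← sq_abs e, ← mul_pow]; gcongr
  rw [heq, ← mul_sub, abs_mul]
  have hPx := hP _ (H.mem (i := i) (by omega))
  calc _ ≤ P * (C₁ * h ^ 2 + (A + C₁) ^ 2 * h ^ 2) := by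
        refine mul_le_mul hPx ?_ (abs_nonneg _) hP0
        have h1 := abs_le.1 (he3.trans he4)
        have h2 := abs_le.1 hmain
        rw [abs_le]
        constructor <;> linarith [h1.1, h1.2, h2.1, h2.2]
    _ = _ := by ring

end StickyCoeff

/-! ### Consistency of the discrete forms -/

/-- Second order quadrature of `W U²` on one cell. -/
theorem exists_cell_quadrature_bound {W c : ℝ → ℝ} (hW : ContDiff ℝ 2 W) (hc : ContDiff ℝ 2 c)
    (l r : ℝ) : ∃ C, 0 ≤ C ∧ ∀ a ∈ Icc l r, ∀ b ∈ Icc l r, a ≤ b → ∀ U U' U'' : ℝ → ℝ,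
      Continuous U → Continuous U' → Continuous U'' → (∀ x ∈ Icc a b, HasDerivAt U (U' x) x) →
      (∀ x ∈ Icc a b, HasDerivAt U' (U'' x) x) →
      |(b - a) / 2 * (W a * U a ^ 2 * (1 + c a * (b - a)) + W b * U b ^ 2 * (1 - c b * (b - a))) -
        ∫ x in a..b, W x * U x ^ 2| ≤
        C * ((b - a) ^ 2 * ∫ x in a..b, (U x ^ 2 + U' x ^ 2 + |U x * U'' x|)) := by
  have hW1 : ContDiff ℝ 1 (deriv W) := (contDiff_succ_iff_deriv (n := 1).1 hW).2.2
  have hW2 : Continuous (deriv (deriv W)) := hW1.continuous_deriv le_rfl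
  have hW0' := hW.continuous
  have hW1' := hW1.continuous
  have hc0' := hc.continuous
  have hc1' : Continuous (deriv c) := hc.continuous_deriv (by norm_num)
  obtain ⟨B₀, hB₀0, hB₀⟩ := exists_abs_le_on_Icc hW0' l r
  obtain ⟨B₁, hB₁0, hB₁⟩ := exists_abs_le_on_Icc hW1' l r
  obtain ⟨B₂, hB₂0, hB₂⟩ := exists_abs_le_on_Icc hW2 l r
  obtain ⟨A₀, hA₀0, hA₀⟩ := exists_abs_le_on_Icc hc0' l r
  obtain ⟨A₁, hA₁0, hA₁⟩ := exists_abs_le_on_Icc hc1' l r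
  have dW : ∀ x, HasDerivAt W (deriv W x) x := fun x => (hW.differentiable (by norm_num) x).hasDerivAt
  have dW1 : ∀ x, HasDerivAt (deriv W) (deriv (deriv W) x) x := fun x =>
    (hW1.differentiable (by norm_num) x).hasDerivAt
  have dc : ∀ x, HasDerivAt c (deriv c x) x := fun x => (hc.differentiable (by norm_num) x).hasDerivAt
  refine ⟨(B₂ + 2 * B₁ + 2 * B₀ + 2 * B₁) + (A₁ * B₀ + A₀ * B₁ + A₀ * B₀), by positivity, ?_⟩
  intro a ha b hb hab U U' U'' hU hU1 hU2 dU dU1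
  have hmem : ∀ x ∈ Icc a b, x ∈ Icc l r := fun x hx => ⟨ha.1.trans hx.1, hx.2.trans hb.2⟩
  have T := trapezoid_error_le hab (f := fun x => W x * U x ^ 2)
    (f' := fun x => deriv W x * U x ^ 2 + W x * (2 * U x * U' x))
    (f'' := fun x => deriv (deriv W) x * U x ^ 2 + 4 * (deriv W x * (U x * U' x)) +
      2 * (W x * (U' x ^ 2 + U x * U'' x)))
    (fun x hx => ((dW x).mul ((dU x hx).pow 2)).congr_deriv (by simp))
    (fun x hx => (((dW1 x).mul ((dU x hx).pow 2)).add
      ((dW x).mul (((dU x hx).const_mul 2).mul (dU1 x hx)))).congr_deriv (by simp; ring))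
    (by fun_prop)
  -- The end corrections amount to `(b - a)² / 2` times the difference of `c W U²` between the
  -- endpoints, so they too are second order with an integral bound.
  have V := abs_sub_le_integral_abs_deriv hab (f := fun x => c x * (W x * U x ^ 2))
    (f' := fun x => deriv c x * (W x * U x ^ 2) + c x * (deriv W x * U x ^ 2 + W x * (2 * U x * U' x)))
    (fun x hx => ((dc x).mul ((dW x).mul ((dU x hx).pow 2))).congr_deriv (by simp)) (by fun_prop)
  set I := ∫ x in a..b, (U x ^ 2 + U' x ^ 2 + |U x * U'' x|) with hI
  have hUU : ∀ x, |U x * U' x| ≤ (U x ^ 2 + U' x ^ 2) / 2 := fun x => by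
    rw [abs_le]; constructor <;> nlinarith [sq_nonneg (U x + U' x), sq_nonneg (U x - U' x)]
  have T' : ∫ x in a..b, |deriv (deriv W) x * U x ^ 2 + 4 * (deriv W x * (U x * U' x)) +
      2 * (W x * (U' x ^ 2 + U x * U'' x))| ≤ (B₂ + 2 * B₁ + 2 * B₀ + 2 * B₁) * I := by
    rw [hI, ← intervalIntegral.integral_const_mul]
    refine integral_mono_on hab (Continuous.intervalIntegrable (by fun_prop) _ _)
      (Continuous.intervalIntegrable (by fun_prop) _ _) fun x hx => ?_
    have b0 := hB₀ x (hmem x hx)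
    have b1 := hB₁ x (hmem x hx)
    have b2 := hB₂ x (hmem x hx)
    have s1 : |deriv (deriv W) x * U x ^ 2| ≤ B₂ * U x ^ 2 := by
      rw [abs_mul, abs_of_nonneg (sq_nonneg (U x))]; gcongr
    have s2 : |4 * (deriv W x * (U x * U' x))| ≤ 4 * (B₁ * ((U x ^ 2 + U' x ^ 2) / 2)) := by
      rw [abs_mul, abs_mul, abs_of_pos (show (0 : ℝ) < 4 by norm_num)]
      have := hUU x
      gcongr
    have s3 : |2 * (W x * (U' x ^ 2 + U x * U'' x))| ≤ 2 * (B₀ * (U' x ^ 2 + |U x * U'' x|)) := by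
      rw [abs_mul, abs_mul, abs_of_pos (show (0 : ℝ) < 2 by norm_num)]
      have : |U' x ^ 2 + U x * U'' x| ≤ U' x ^ 2 + |U x * U'' x| :=
        (abs_add_le _ _).trans (by rw [abs_of_nonneg (sq_nonneg (U' x))])
      gcongr
    have q0 := sq_nonneg (U x)
    have q1 := sq_nonneg (U' x)
    have q2 := abs_nonneg (U x * U'' x)
    have f1 := mul_nonneg hB₂0 q1
    have f2 := mul_nonneg hB₂0 q2
    have f3 := mul_nonneg hB₁0 q0
    have f4 := mul_nonneg hB₁0 q1
    have f5 := mul_nonneg hB₁0 q2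
    have f6 := mul_nonneg hB₀0 q0
    calc _ ≤ |deriv (deriv W) x * U x ^ 2| + |4 * (deriv W x * (U x * U' x))| +
          |2 * (W x * (U' x ^ 2 + U x * U'' x))| :=
          (abs_add_le _ _).trans (add_le_add_left (abs_add_le _ _) _)
      _ ≤ _ := by linarith
  have V' : ∫ x in a..b, |deriv c x * (W x * U x ^ 2) +
      c x * (deriv W x * U x ^ 2 + W x * (2 * U x * U' x))| ≤ (A₁ * B₀ + A₀ * B₁ + A₀ * B₀) * I := by
    rw [hI, ← intervalIntegral.integral_const_mul]
    refine integral_mono_on hab (Continuous.intervalIntegrable (by fun_prop) _ _)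
      (Continuous.intervalIntegrable (by fun_prop) _ _) fun x hx => ?_
    have b0 := hB₀ x (hmem x hx)
    have b1 := hB₁ x (hmem x hx)
    have a0 := hA₀ x (hmem x hx)
    have a1 := hA₁ x (hmem x hx)
    have s1 : |deriv c x * (W x * U x ^ 2)| ≤ A₁ * (B₀ * U x ^ 2) := by
      rw [abs_mul, abs_mul, abs_of_nonneg (sq_nonneg (U x))]; gcongr
    have s2 : |c x * (deriv W x * U x ^ 2)| ≤ A₀ * (B₁ * U x ^ 2) := by
      rw [abs_mul, abs_mul, abs_of_nonneg (sq_nonneg (U x))]; gcongr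
    have s3 : |c x * (W x * (2 * U x * U' x))| ≤ A₀ * (B₀ * (2 * ((U x ^ 2 + U' x ^ 2) / 2))) := by
      rw [abs_mul, abs_mul, mul_assoc, abs_mul 2, abs_of_pos (show (0 : ℝ) < 2 by norm_num)]
      have := hUU x
      gcongr
    have q1 := sq_nonneg (U' x)
    have q2 := abs_nonneg (U x * U'' x)
    have f1 := mul_nonneg (mul_nonneg hA₁0 hB₀0) q1
    have f2 := mul_nonneg (mul_nonneg hA₁0 hB₀0) q2
    have f3 := mul_nonneg (mul_nonneg hA₀0 hB₁0) q1
    have f4 := mul_nonneg (mul_nonneg hA₀0 hB₁0) q2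
    have f5 := mul_nonneg (mul_nonneg hA₀0 hB₀0) q2
    calc _ ≤ |deriv c x * (W x * U x ^ 2)| + (|c x * (deriv W x * U x ^ 2)| +
          |c x * (W x * (2 * U x * U' x))|) := by
          rw [mul_add]
          exact (abs_add_le _ _).trans (add_le_add_right (abs_add_le _ _) _)
      _ ≤ _ := by linarith
  have hd : 0 ≤ (b - a) ^ 2 := sq_nonneg _
  have T2 := abs_le.1 (T.trans (mul_le_mul_of_nonneg_left T' hd))
  have V2 := abs_le.1 (V.trans V')
  have V3 := mul_le_mul_of_nonneg_left V2.1 hd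
  have V4 := mul_le_mul_of_nonneg_left V2.2 hd
  have hI0 : 0 ≤ (A₁ * B₀ + A₀ * B₁ + A₀ * B₀) * I := (abs_nonneg _).trans (V.trans V')
  have hI1 := mul_nonneg hd hI0
  rw [abs_le]
  constructor <;> nlinarith [T2.1, T2.2]

namespace StickyCoeff

variable {S : StickyCoeff} {n : ℕ} {x : ℕ → ℝ} {h K : ℝ}

/-- A function given cell by cell, of class `C²` on each cell, with nodal values `u` vanishing at
the last node. -/
structure IsCellwise (n : ℕ) (x u : ℕ → ℝ) (U U' U'' : ℕ → ℝ → ℝ) : Prop where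
  cont : ∀ i, Continuous (U i)
  cont' : ∀ i, Continuous (U' i)
  cont'' : ∀ i, Continuous (U'' i)
  deriv : ∀ i ≤ n, ∀ y ∈ Icc (x i) (x (i + 1)), HasDerivAt (U i) (U' i y) y
  deriv' : ∀ i ≤ n, ∀ y ∈ Icc (x i) (x (i + 1)), HasDerivAt (U' i) (U'' i y) y
  left : ∀ i ≤ n, U i (x i) = u i
  right : ∀ i ≤ n, U i (x (i + 1)) = u (i + 1)
  last : u (n + 1) = 0

/-- Sobolev-type norm controlling the quadrature errors. -/
def cellNorm (n : ℕ) (x : ℕ → ℝ) (U V W : ℕ → ℝ → ℝ) : ℝ :=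
  ∑ i ∈ Finset.range (n + 1), ∫ y in x i..x (i + 1), (U i y ^ 2 + V i y ^ 2 + |U i y * W i y|)

/-- The node weight predicted by cellwise quadrature. -/
def idealMass (S : StickyCoeff) (x : ℕ → ℝ) : ℕ → ℝ
  | 0 => 1 / (2 * S.ρ) + S.w (x 0) * (gap x 0 / 2 * (1 + S.c (x 0) * gap x 0))
  | i + 1 => S.w (x (i + 1)) * (gap x (i + 1) / 2 * (1 + S.c (x (i + 1)) * gap x (i + 1)) +
      gap x i / 2 * (1 - S.c (x (i + 1)) * gap x i))

/-- Regroups a sum over nodes as a sum over cells: each interior node takes a share from both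
neighbours, and node `0` also carries the sticky atom. -/
theorem sum_idealMass {k u : ℕ → ℝ} (hu : u (n + 1) = 0) :
    ∑ i ∈ Finset.range (n + 1), S.idealMass x i * (k i * u i ^ 2) = k 0 * u 0 ^ 2 / (2 * S.ρ) +
      ∑ i ∈ Finset.range (n + 1), gap x i / 2 *
        (S.w (x i) * k i * u i ^ 2 * (1 + S.c (x i) * gap x i) +
          S.w (x (i + 1)) * k (i + 1) * u (i + 1) ^ 2 * (1 - S.c (x (i + 1)) * gap x i)) := by
  simp_rw [mul_add (gap x _ / 2), Finset.sum_add_distrib]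
  rw [Finset.sum_range_succ (fun i => gap x i / 2 * (S.w (x (i + 1)) * k (i + 1) * u (i + 1) ^ 2 *
    (1 - S.c (x (i + 1)) * gap x i))) n, Finset.sum_range_succ' (fun i => S.idealMass x i * _) n,
    Finset.sum_range_succ' (fun i => gap x i / 2 * (S.w (x i) * k i * u i ^ 2 *
    (1 + S.c (x i) * gap x i))) n, hu]
  simp only [idealMass]
  have : ∑ i ∈ Finset.range n, S.w (x (i + 1)) * (gap x (i + 1) / 2 *
      (1 + S.c (x (i + 1)) * gap x (i + 1)) + gap x i / 2 * (1 - S.c (x (i + 1)) * gap x i)) *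
      (k (i + 1) * u (i + 1) ^ 2) =
      ∑ i ∈ Finset.range n, gap x (i + 1) / 2 * (S.w (x (i + 1)) * k (i + 1) * u (i + 1) ^ 2 *
        (1 + S.c (x (i + 1)) * gap x (i + 1))) +
      ∑ i ∈ Finset.range n, gap x i / 2 * (S.w (x (i + 1)) * k (i + 1) * u (i + 1) ^ 2 *
        (1 - S.c (x (i + 1)) * gap x i)) := by
    rw [← Finset.sum_add_distrib]
    exact Finset.sum_congr rfl fun i _ => by ring
  rw [this]
  ring

/-- The interior node weights agree with the predicted ones to second order. -/
theorem exists_nodeMass_bound (S : StickyCoeff) (K : ℝ) : ∃ h₀ C : ℝ, 0 < h₀ ∧ 0 ≤ C ∧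
    ∀ (n : ℕ) (x : ℕ → ℝ) (h t : ℝ), h ≤ h₀ → S.IsMesh n x h K → ∀ i, i + 1 ≤ n →
      |S.nodeMass x t (i + 1) - S.idealMass x (i + 1)| ≤ C * h ^ 2 * (gap x i + gap x (i + 1)) := by
  obtain ⟨h₀, C, hh₀, hC, hQ⟩ := S.exists_condWeight_bound K
  obtain ⟨A, hA0, hA⟩ := exists_abs_le_on_Icc S.continuous_c S.l S.r
  obtain ⟨B, hB0, hB⟩ := exists_abs_le_on_Icc S.continuous_s S.l S.r
  obtain ⟨W, hW0, hW⟩ := exists_abs_le_on_Icc S.continuous_w S.l S.r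
  refine ⟨h₀, C * B + 2 * (W * A ^ 2), hh₀, by positivity, ?_⟩
  intro n x h t hh H i hi
  have q := hQ n x h hh H (i + 1) hi
  have hg := H.gap_pos (i := i) (by omega)
  have hg' := H.gap_pos hi
  have hgh := H.step_le i (by omega)
  have hgh' := H.step_le (i + 1) hi
  have hmem := H.mem (i := i + 1) (by omega)
  have e0 := H.one_add_pos (i := i) (j := i + 1) (by omega) (by omega)
  have hA' := hA _ hmem
  have hB' := hB _ hmem
  have hW' := hW _ hmem
  have hh0 := H.h_pos
  simp only [nodeMass, idealMass]
  set c := S.c (x (i + 1))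
  set s := S.s (x (i + 1))
  set p := S.p (x (i + 1))
  set Q := S.condWeight x (i + 1)
  set d := gap x i
  set d' := gap x (i + 1)
  have hw : S.w (x (i + 1)) = p * s := rfl
  rw [hw] at hW' ⊢
  -- After clearing the denominator, the terms of first and second order in the steps cancel. What
  -- remains is the error of `condWeight` and a cubic term.
  have key : Q * ((d + d') / 2) * s / (1 + c * d) -
      p * s * (d' / 2 * (1 + c * d') + d / 2 * (1 - c * d)) =
      ((Q - p * (1 + c * d')) * s * ((d + d') / 2) + (p * s) * (c ^ 2 * (d ^ 2 - d' ^ 2) * d / 2)) / (1 + c * d) := by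
    have : 1 + c * d ≠ 0 := by linarith
    rw [eq_div_iff this, sub_mul, div_mul_cancel₀ _ this]
    ring
  rw [key, abs_div, abs_of_pos (show 0 < 1 + c * d by linarith), div_le_iff₀ (by linarith)]
  have s1 : |(Q - p * (1 + c * d')) * s * ((d + d') / 2)| ≤ C * h ^ 2 * B * ((d + d') / 2) := by
    rw [abs_mul, abs_mul, abs_of_pos (show 0 < (d + d') / 2 by linarith)]
    gcongr
  have s2 : |(p * s) * (c ^ 2 * (d ^ 2 - d' ^ 2) * d / 2)| ≤ W * (A ^ 2 * h ^ 2 * (d + d') / 2) := by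
    rw [abs_mul (p * s), abs_div, abs_mul _ d, abs_mul (c ^ 2), abs_of_pos hg,
      abs_of_pos (show (0 : ℝ) < 2 by norm_num), abs_of_nonneg (sq_nonneg c)]
    have c2 : c ^ 2 ≤ A ^ 2 := by rw [← sq_abs]; gcongr
    have d2 : |d ^ 2 - d' ^ 2| ≤ h ^ 2 := by
      have : d ^ 2 ≤ h ^ 2 := by gcongr
      have : d' ^ 2 ≤ h ^ 2 := by gcongr
      rw [abs_le]; constructor <;> nlinarith [sq_nonneg d, sq_nonneg d']
    have : d ≤ d + d' := by linarith
    gcongr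
  have hX : 0 ≤ C * B * h ^ 2 * (d + d') := by positivity
  have hY : 0 ≤ W * A ^ 2 * h ^ 2 * (d + d') := by positivity
  have hZ : (C * B + 2 * (W * A ^ 2)) * h ^ 2 * (d + d') * (3 / 4) ≤
      (C * B + 2 * (W * A ^ 2)) * h ^ 2 * (d + d') * (1 + c * d) := by gcongr
  refine ((abs_add_le _ _).trans (add_le_add s1 s2)).trans (le_trans ?_ hZ)
  linarith

/-- Consistency of the lumped mass forms, with density `w k`. -/
theorem exists_mass_consistency (S : StickyCoeff) (K : ℝ) {k : ℝ → ℝ} (hk : ContDiff ℝ 2 k) :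
    ∃ h₀ C : ℝ, 0 < h₀ ∧ 0 ≤ C ∧ ∀ (n : ℕ) (x : ℕ → ℝ) (h t ε : ℝ), h ≤ h₀ → S.IsMesh n x h K →
      h ^ 2 ≤ ε → |S.nodeMass x t 0 - S.idealMass x 0| ≤ ε →
      ∀ (u : ℕ → ℝ) (U U' U'' : ℕ → ℝ → ℝ) (B : ℝ), IsCellwise n x u U U' U'' →
        (∀ i ≤ n, u i ^ 2 ≤ B) →
        |∑ i ∈ Finset.range (n + 1), S.nodeMass x t i * (k (x i) * u i ^ 2) -
          ((∑ i ∈ Finset.range (n + 1), ∫ y in x i..x (i + 1), S.w y * k y * U i y ^ 2) +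
            k S.l * u 0 ^ 2 / (2 * S.ρ))| ≤ C * ε * (B + cellNorm n x U U' U'') := by
  obtain ⟨h₀, C₁, hh₀, hC₁, hm⟩ := S.exists_nodeMass_bound K
  obtain ⟨C₂, hC₂, hq⟩ := exists_cell_quadrature_bound (S.contDiff_w.mul hk) S.hc S.l S.r
  obtain ⟨M, hM0, hM⟩ := exists_abs_le_on_Icc hk.continuous S.l S.r
  have hlr : 0 < S.r - S.l := sub_pos.2 S.hlr
  refine ⟨h₀, M * (1 + 2 * (C₁ * (S.r - S.l))) + C₂, hh₀, by positivity, ?_⟩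
  intro n x h t ε hh H hε h0 u U U' U'' B hU hB
  have hε0 : 0 ≤ ε := (sq_nonneg h).trans hε
  have hB0 : 0 ≤ B := (sq_nonneg _).trans (hB 0 (Nat.zero_le n))
  have hgp : ∀ i ∈ Finset.range (n + 1), 0 ≤ gap x i := fun i hi =>
    (H.gap_pos (by have := Finset.mem_range.1 hi; omega)).le
  have hcell : ∀ i ∈ Finset.range (n + 1),
      |gap x i / 2 * (S.w (x i) * k (x i) * u i ^ 2 * (1 + S.c (x i) * gap x i) +
          S.w (x (i + 1)) * k (x (i + 1)) * u (i + 1) ^ 2 * (1 - S.c (x (i + 1)) * gap x i)) -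
        ∫ y in x i..x (i + 1), S.w y * k y * U i y ^ 2| ≤
      C₂ * ε * ∫ y in x i..x (i + 1), (U i y ^ 2 + U' i y ^ 2 + |U i y * U'' i y|) := by
    intro i hi
    have hi' : i ≤ n := by have := Finset.mem_range.1 hi; omega
    have hle : x i ≤ x (i + 1) := (H.lt_succ i hi').le
    have h1 := hq (x i) (H.mem (by omega)) (x (i + 1)) (H.mem (by omega)) hle (U i) (U' i) (U'' i)
      (hU.cont i) (hU.cont' i) (hU.cont'' i) (hU.deriv i hi') (hU.deriv' i hi')
    rw [hU.left i hi', hU.right i hi'] at h1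
    refine h1.trans ?_
    have hI : 0 ≤ ∫ y in x i..x (i + 1), (U i y ^ 2 + U' i y ^ 2 + |U i y * U'' i y|) :=
      integral_nonneg hle fun y _ => by positivity
    have h2 : (x (i + 1) - x i) ^ 2 ≤ ε := by
      have h3 : x (i + 1) - x i ≤ h := H.step_le i hi'
      have h4 : 0 ≤ x (i + 1) - x i := sub_nonneg.2 hle
      exact (pow_le_pow_left₀ h4 h3 2).trans hε
    rw [mul_assoc]
    gcongr
  have hsum1 : |∑ i ∈ Finset.range (n + 1), S.idealMass x i * (k (x i) * u i ^ 2) -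
      ((∑ i ∈ Finset.range (n + 1), ∫ y in x i..x (i + 1), S.w y * k y * U i y ^ 2) +
        k S.l * u 0 ^ 2 / (2 * S.ρ))| ≤ C₂ * ε * cellNorm n x U U' U'' := by
    rw [sum_idealMass (k := fun i => k (x i)) hU.last, H.left, cellNorm, Finset.mul_sum]
    refine le_trans (le_of_eq ?_) ((Finset.abs_sum_le_sum_abs _ _).trans (Finset.sum_le_sum hcell))
    rw [Finset.sum_sub_distrib]
    congr 1
    ring
  have hsum2 : |∑ i ∈ Finset.range (n + 1), S.nodeMass x t i * (k (x i) * u i ^ 2) -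
      ∑ i ∈ Finset.range (n + 1), S.idealMass x i * (k (x i) * u i ^ 2)| ≤
      M * (1 + 2 * (C₁ * (S.r - S.l))) * ε * B := by
    rw [← Finset.sum_sub_distrib]
    refine (Finset.abs_sum_le_sum_abs _ _).trans ?_
    have hterm : ∀ i ≤ n, ∀ e, |S.nodeMass x t i - S.idealMass x i| ≤ e →
        |S.nodeMass x t i * (k (x i) * u i ^ 2) - S.idealMass x i * (k (x i) * u i ^ 2)| ≤
          e * (M * B) := fun i hi e he => by
      rw [← sub_mul, abs_mul, abs_mul, abs_of_nonneg (sq_nonneg (u i))]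
      have h1 := hM _ (H.mem (i := i) (by omega))
      have h2 := hB i hi
      have h3 := (abs_nonneg _).trans he
      gcongr
    -- Node `0` carries the boundary error `ε`; the interior nodes carry `h² ≤ ε` times their
    -- adjacent steps, whose total is at most `2 (r - l)`.
    rw [Finset.sum_range_succ']
    have hz := hterm 0 (Nat.zero_le n) ε h0
    have hs : ∑ i ∈ Finset.range n, |S.nodeMass x t (i + 1) * (k (x (i + 1)) * u (i + 1) ^ 2) -
        S.idealMass x (i + 1) * (k (x (i + 1)) * u (i + 1) ^ 2)| ≤
        ∑ i ∈ Finset.range n, C₁ * ε * (gap x i + gap x (i + 1)) * (M * B) :=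
      Finset.sum_le_sum fun i hi => by
        have hi' := Finset.mem_range.1 hi
        refine hterm (i + 1) (by omega) _ ((hm n x h t hh H i (by omega)).trans ?_)
        have := H.gap_pos (i := i) (by omega)
        have := H.gap_pos (i := i + 1) (by omega)
        gcongr
    have hg2 : ∑ i ∈ Finset.range n, (gap x i + gap x (i + 1)) ≤ 2 * (S.r - S.l) := by
      rw [Finset.sum_add_distrib]
      have e1 := H.sum_gap
      have e2 := H.sum_gap
      rw [Finset.sum_range_succ] at e1
      rw [Finset.sum_range_succ'] at e2
      have := H.gap_pos (Nat.zero_le n)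
      have := H.gap_pos (le_refl n)
      linarith
    rw [← Finset.sum_mul, ← Finset.mul_sum] at hs
    have hs2 : C₁ * ε * (∑ i ∈ Finset.range n, (gap x i + gap x (i + 1))) * (M * B) ≤
      C₁ * ε * (2 * (S.r - S.l)) * (M * B) := by gcongr
    linarith
  have hN : 0 ≤ cellNorm n x U U' U'' := Finset.sum_nonneg fun i hi =>
    integral_nonneg (sub_nonneg.1 (hgp i hi)) fun y _ => by positivity
  have f1 : 0 ≤ M * (1 + 2 * (C₁ * (S.r - S.l))) * ε * cellNorm n x U U' U'' := by positivity
  have f2 : 0 ≤ C₂ * ε * B := by positivity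
  have g1 := abs_le.1 hsum1
  have g2 := abs_le.1 hsum2
  rw [abs_le]
  constructor <;> linarith [g1.1, g1.2, g2.1, g2.2]

/-- The discrete Dirichlet form is dominated by the continuous one up to second order. -/
theorem exists_dirichlet_upper (S : StickyCoeff) (K : ℝ) : ∃ h₀ C : ℝ, 0 < h₀ ∧ 0 ≤ C ∧
    ∀ (n : ℕ) (x : ℕ → ℝ) (h : ℝ), h ≤ h₀ → S.IsMesh n x h K →
      ∀ i ≤ n, ∀ U U' : ℝ → ℝ, Continuous U' → (∀ y ∈ Icc (x i) (x (i + 1)), HasDerivAt U (U' y) y) →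
        S.condWeight x i / (2 * gap x i) * (U (x (i + 1)) - U (x i)) ^ 2 ≤
          (1 + C * h ^ 2) * ∫ y in x i..x (i + 1), S.p y / 2 * U' y ^ 2 := by
  obtain ⟨h₀, C, hh₀, hC, hQ⟩ := S.exists_condWeight_bound K
  have hinv : ContDiff ℝ 2 fun y => (S.p y)⁻¹ := S.contDiff_p.inv fun y => (S.p_pos y).ne'
  obtain ⟨B, hB0, hB⟩ := exists_integral_taylor_bound hinv S.l S.r
  obtain ⟨P, hP0, hP⟩ := exists_abs_le_on_Icc S.continuous_p S.l S.r
  obtain ⟨R, hR0, hR⟩ := exists_abs_le_on_Icc hinv.continuous S.l S.r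
  refine ⟨h₀, 2 * (C * R) + 2 * (P * B) + C * B, hh₀, by positivity, ?_⟩
  intro n x h hh H i hi U U' hU' hd
  have q := hQ n x h hh H i hi
  have hle : x i ≤ x (i + 1) := (H.lt_succ i hi).le
  have hg := H.gap_pos hi
  have hgh := H.step_le i hi
  have hh0 := H.h_pos
  have hh1 := H.le_one
  have hmem := H.mem (i := i) (by omega)
  have hp := S.p_pos (x i)
  have hFTC : ∫ y in x i..x (i + 1), U' y = U (x (i + 1)) - U (x i) :=
    integral_eq_sub_of_hasDerivAt (fun y hy => hd y (by rwa [uIcc_of_le hle] at hy))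
      (hU'.intervalIntegrable _ _)
  have hsqrt : Continuous fun y => Real.sqrt (S.p y) := S.continuous_p.sqrt
  have hs0 : ∀ y, Real.sqrt (S.p y) ≠ 0 := fun y => (Real.sqrt_pos.2 (S.p_pos y)).ne'
  -- Cauchy–Schwarz with weight `p`: the squared increment is at most `∫ p U'²` times `∫ 1/p`. This
  -- one-sided bound uses no second derivative of `U`.
  have CS := sq_integral_mul_le hle (f := fun y => Real.sqrt (S.p y) * U' y)
    (g := fun y => (Real.sqrt (S.p y))⁻¹) (hsqrt.mul hU') (hsqrt.inv₀ hs0)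
  have e1 : ∫ y in x i..x (i + 1), (Real.sqrt (S.p y) * U' y) * (Real.sqrt (S.p y))⁻¹ =
      U (x (i + 1)) - U (x i) := by
    rw [← hFTC]
    congr 1
    ext y
    have := hs0 y
    field_simp
  have e2 : ∫ y in x i..x (i + 1), (Real.sqrt (S.p y) * U' y) ^ 2 =
      2 * ∫ y in x i..x (i + 1), S.p y / 2 * U' y ^ 2 := by
    rw [← intervalIntegral.integral_const_mul]
    congr 1
    ext y
    rw [mul_pow, Real.sq_sqrt (S.p_pos y).le]
    ring
  have e3 : ∫ y in x i..x (i + 1), ((Real.sqrt (S.p y))⁻¹) ^ 2 = ∫ y in x i..x (i + 1), (S.p y)⁻¹ := by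
    congr 1
    ext y
    rw [inv_pow, Real.sq_sqrt (S.p_pos y).le]
  rw [e1, e2, e3] at CS
  have hB' := hB (x i) hmem (x (i + 1)) (H.mem (by omega)) hle
  have hder : deriv (fun y => (S.p y)⁻¹) (x i) = -(2 * S.c (x i)) * (S.p (x i))⁻¹ := by
    refine ((S.hasDerivAt_p (x i)).fun_inv hp.ne').deriv.trans ?_
    field_simp
  rw [hder] at hB'
  have hgd : x (i + 1) - x i = gap x i := rfl
  rw [hgd] at hB'
  set I := ∫ y in x i..x (i + 1), S.p y / 2 * U' y ^ 2
  have hI0 : 0 ≤ I := integral_nonneg hle fun y _ => by have := S.p_pos y; positivity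
  set J := ∫ y in x i..x (i + 1), (S.p y)⁻¹
  set c := S.c (x i)
  set d := gap x i
  set Q := S.condWeight x i
  have hQ0 : 0 < Q := H.condWeight_pos hi
  have hcd := H.abs_mul_gap_le hi (j := i) (by omega)
  have hPx : S.p (x i) ≤ P := (le_abs_self _).trans (hP _ hmem)
  have hRx : (S.p (x i))⁻¹ ≤ R := (le_abs_self _).trans (hR _ hmem)
  -- To first order `Q` is `p (1 + c d)` and `J` is `d (1 - c d) / p`; the linear terms cancel and
  -- `1 - (c d)² ≤ 1`.
  have hkey : Q * J ≤ d * (1 + (2 * (C * R) + 2 * (P * B) + C * B) * h ^ 2) := by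
    have b1 : J ≤ d * ((S.p (x i))⁻¹ * (1 - c * d) + B * d ^ 2) := by
      have := (abs_le.1 hB').2
      linarith
    have b2 : Q ≤ S.p (x i) * (1 + c * d) + C * h ^ 2 := by linarith [(abs_le.1 q).2]
    have hdh : d ^ 2 ≤ h ^ 2 := by gcongr
    have hcd1 := (abs_le.1 hcd).1
    have hcd2 := (abs_le.1 hcd).2
    have b3 : (S.p (x i))⁻¹ * (1 - c * d) + B * d ^ 2 ≤ (S.p (x i))⁻¹ * (1 - c * d) + B * h ^ 2 := by
      gcongr
    have hpos : 0 ≤ (S.p (x i))⁻¹ * (1 - c * d) + B * h ^ 2 := by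
      have : 0 ≤ 1 - c * d := by linarith
      positivity
    have b5 : (S.p (x i) * (1 + c * d) + C * h ^ 2) * ((S.p (x i))⁻¹ * (1 - c * d) + B * h ^ 2) ≤
        1 + (2 * (C * R) + 2 * (P * B) + C * B) * h ^ 2 := by
      have z1 : S.p (x i) * (1 + c * d) * ((S.p (x i))⁻¹ * (1 - c * d)) = 1 - (c * d) ^ 2 := by
        field_simp; ring
      have z2 : S.p (x i) * (1 + c * d) * (B * h ^ 2) ≤ P * 2 * (B * h ^ 2) := by
        have : 1 + c * d ≤ 2 := by linarith
        have : 0 ≤ 1 + c * d := by linarith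
        gcongr
      have z3 : C * h ^ 2 * ((S.p (x i))⁻¹ * (1 - c * d)) ≤ C * h ^ 2 * (R * 2) := by
        have : 1 - c * d ≤ 2 := by linarith
        have : 0 ≤ 1 - c * d := by linarith
        gcongr
      have z4 : C * h ^ 2 * (B * h ^ 2) ≤ C * B * h ^ 2 := by
        have : h ^ 2 ≤ 1 := pow_le_one₀ hh0.le hh1
        calc C * h ^ 2 * (B * h ^ 2) = (C * B * h ^ 2) * h ^ 2 := by ring
          _ ≤ (C * B * h ^ 2) * 1 := by gcongr
          _ = _ := mul_one _
      nlinarith [sq_nonneg (c * d)]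
    calc Q * J ≤ Q * (d * ((S.p (x i))⁻¹ * (1 - c * d) + B * h ^ 2)) := by
          refine mul_le_mul_of_nonneg_left (b1.trans ?_) hQ0.le
          gcongr
      _ ≤ (S.p (x i) * (1 + c * d) + C * h ^ 2) * (d * ((S.p (x i))⁻¹ * (1 - c * d) + B * h ^ 2)) :=
          mul_le_mul_of_nonneg_right b2 (mul_nonneg hg.le hpos)
      _ = d * ((S.p (x i) * (1 + c * d) + C * h ^ 2) * ((S.p (x i))⁻¹ * (1 - c * d) + B * h ^ 2)) := by
          ring
      _ ≤ _ := by gcongr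
  rw [div_mul_eq_mul_div, div_le_iff₀ (by positivity)]
  calc Q * (U (x (i + 1)) - U (x i)) ^ 2 ≤ Q * (2 * I * J) := by gcongr
    _ = (2 * I) * (Q * J) := by ring
    _ ≤ (2 * I) * (d * (1 + (2 * (C * R) + 2 * (P * B) + C * B) * h ^ 2)) := by gcongr
    _ = _ := by ring

/-- For affine functions the two Dirichlet forms agree to second order. -/
theorem exists_dirichlet_affine (S : StickyCoeff) (K : ℝ) : ∃ h₀ C : ℝ, 0 < h₀ ∧ 0 ≤ C ∧
    ∀ (n : ℕ) (x : ℕ → ℝ) (h : ℝ), h ≤ h₀ → S.IsMesh n x h K → ∀ i ≤ n, ∀ v : ℝ,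
      |(∫ y in x i..x (i + 1), S.p y / 2 * (v / gap x i) ^ 2) - S.condWeight x i / (2 * gap x i) * v ^ 2| ≤
        C * h ^ 2 * (v ^ 2 / gap x i) := by
  obtain ⟨h₀, C, hh₀, hC, hQ⟩ := S.exists_condWeight_bound K
  obtain ⟨B, hB0, hB⟩ := exists_integral_taylor_bound S.contDiff_p S.l S.r
  refine ⟨h₀, B + C, hh₀, by positivity, ?_⟩
  intro n x h hh H i hi v
  have q := hQ n x h hh H i hi
  have hle : x i ≤ x (i + 1) := (H.lt_succ i hi).le
  have hg := H.gap_pos hi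
  have hgh := H.step_le i hi
  have hB' := hB (x i) (H.mem (by omega)) (x (i + 1)) (H.mem (by omega)) hle
  rw [(S.hasDerivAt_p (x i)).deriv] at hB'
  have hgd : x (i + 1) - x i = gap x i := rfl
  rw [hgd] at hB'
  have e1 : ∫ y in x i..x (i + 1), S.p y / 2 * (v / gap x i) ^ 2 =
      (∫ y in x i..x (i + 1), S.p y) * ((v / gap x i) ^ 2 / 2) := by
    rw [← intervalIntegral.integral_mul_const]
    congr 1; ext y; ring
  rw [e1]
  set J := ∫ y in x i..x (i + 1), S.p y
  set d := gap x i
  set Q := S.condWeight x i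
  have key : J * ((v / d) ^ 2 / 2) - Q / (2 * d) * v ^ 2 = (J - d * Q) * (v ^ 2 / d ^ 2 / 2) := by
    field_simp
  have hJ : |J - d * Q| ≤ (B + C) * h ^ 2 * d := by
    have b1 : B * d ^ 3 ≤ B * h ^ 2 * d := by
      have : d ^ 2 ≤ h ^ 2 := by gcongr
      calc B * d ^ 3 = B * d ^ 2 * d := by ring
        _ ≤ _ := by gcongr
    have b2 := abs_le.1 (hB'.trans b1)
    have b3 := abs_le.1 q
    have b4 := mul_le_mul_of_nonneg_left b3.1 hg.le
    have b5 := mul_le_mul_of_nonneg_left b3.2 hg.le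
    rw [abs_le]
    constructor <;> nlinarith [b2.1, b2.2]
  rw [key, abs_mul, abs_of_nonneg (show 0 ≤ v ^ 2 / d ^ 2 / 2 by positivity)]
  calc _ ≤ (B + C) * h ^ 2 * d * (v ^ 2 / d ^ 2 / 2) := by gcongr
    _ = (B + C) * h ^ 2 * (v ^ 2 / d) / 2 := by field_simp
    _ ≤ _ := by
      have := H.h_pos
      have : 0 ≤ (B + C) * h ^ 2 * (v ^ 2 / d) := by positivity
      linarith

end StickyCoeff

namespace StickyCoeff

/-! ### Upper bound for the discrete eigenvalues -/

/-- The down rates `d` and up rates `b` are those of the scheme on the mesh `x`, symmetrized by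
`nodeMass x t`. -/
structure IsScheme (S : StickyCoeff) (n : ℕ) (x : ℕ → ℝ) (t : ℝ) (d b : ℕ → ℝ) : Prop where
  down_zero : d 0 = 0
  up : ∀ i ≤ n, S.nodeMass x t i * b i = S.condWeight x i / (2 * gap x i)
  down : ∀ i < n, S.nodeMass x t (i + 1) * d (i + 1) = S.condWeight x i / (2 * gap x i)

variable {S : StickyCoeff} {n : ℕ} {x : ℕ → ℝ} {h K t : ℝ} {d b : ℕ → ℝ}

/-- The discrete energy of nodal values `u`. -/
def discreteEnergy (S : StickyCoeff) (n : ℕ) (x : ℕ → ℝ) (t : ℝ) (u : ℕ → ℝ) : ℝ :=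
  ∑ i ∈ Finset.range (n + 1), S.condWeight x i / (2 * gap x i) * (u (i + 1) - u i) ^ 2 +
    ∑ i ∈ Finset.range (n + 1), S.nodeMass x t i * (S.κ (x i) * u i ^ 2)

/-- The discrete mass of nodal values `u`. -/
def discreteMass (S : StickyCoeff) (n : ℕ) (x : ℕ → ℝ) (t : ℝ) (u : ℕ → ℝ) : ℝ :=
  ∑ i ∈ Finset.range (n + 1), S.nodeMass x t i * u i ^ 2

theorem IsScheme.energy (H : S.IsScheme n x t d b) {u : ℕ → ℝ} (hu : u (n + 1) = 0) :
    -∑ i : Fin (n + 1), S.nodeMass x t i *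
      (u i * (birthDeath n d b fun i => S.κ (x i)).mulVec (fun j => u j) i) =
      S.discreteEnergy n x t u :=
  birthDeath_energy (m := S.nodeMass x t) H.down_zero H.up H.down hu

theorem sum_nodeMass (S : StickyCoeff) (n : ℕ) (x : ℕ → ℝ) (t : ℝ) (u : ℕ → ℝ) :
    ∑ i : Fin (n + 1), S.nodeMass x t i * (u i * u i) = S.discreteMass n x t u := by
  rw [Fin.sum_univ_eq_sum_range (fun i => S.nodeMass x t i * (u i * u i)) (n + 1), discreteMass]
  exact Finset.sum_congr rfl fun i _ => by ring

/-- Bounds on combinations of the first `k` eigenfunctions by `eig k` times the mass. -/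
theorem exists_comb_bound (S : StickyCoeff) : ∃ C : ℝ, 0 ≤ C ∧ ∀ (k : ℕ) (a : Fin k → ℝ), 1 ≤ k →
    (∀ y ∈ Icc S.l S.r, S.comb a y ^ 2 ≤ C * (S.eig k * S.massForm (S.comb a) (S.comb a))) ∧
    ∫ y in S.l..S.r, (S.comb a y ^ 2 + (2 * S.combQuasi a y / S.p y) ^ 2 +
      |S.comb a y * (2 * S.s y * (S.κ y * S.comb a y - S.comb (fun i => S.eig (i + 1) * a i) y) -
        2 * S.c y * (2 * S.combQuasi a y / S.p y))|) ≤
      C * (S.eig k * S.massForm (S.comb a) (S.comb a)) := by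
  obtain ⟨p₀, hp₀, hp⟩ := exists_pos_le_on_Icc S.continuous_p S.hlr.le fun x _ => S.p_pos x
  obtain ⟨A, hA0, hA⟩ := exists_abs_le_on_Icc S.continuous_c S.l S.r
  obtain ⟨M, hM0, hM⟩ := exists_abs_le_on_Icc (S.continuous_s.mul S.continuous_κ) S.l S.r
  have hlr : 0 < S.r - S.l := sub_pos.2 S.hlr
  set Y := S.r - S.l with hY
  refine ⟨Y * (2 / p₀) + ((1 + 2 * M + A) * (Y * (Y * (2 / p₀)) + 2 / p₀) + 2 / p₀),
    by positivity, fun k a hk => ?_⟩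
  have cΨ := S.continuous_comb a
  have cQ := S.continuous_combQuasi a
  have cL := S.continuous_comb fun i => S.eig (i + 1) * a i
  have hpc := S.continuous_p; have hwc := S.continuous_w; have hκc := S.continuous_κ
  have hsc := S.continuous_s; have hcc := S.continuous_c
  have hpne : ∀ y, S.p y ≠ 0 := fun y => (S.p_pos y).ne'
  have hΛ := S.eig_pos hk
  have hb0 := S.massForm_self_nonneg (S.comb a)
  have hE := S.energy_comb_le a hk
  have hL := S.massForm_eig_comb_le a hk
  have hder := fun y hy => S.hasDerivAt_comb a (x := y) hy
  set b := S.massForm (S.comb a) (S.comb a) with hb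
  set Λ := S.eig k
  set Ψ := S.comb a with hΨ
  set Qd := S.combQuasi a
  set F := S.comb fun i => S.eig (i + 1) * a i
  have cD : Continuous fun y => 2 * Qd y / S.p y := by fun_prop (disch := assumption)
  set D : ℝ → ℝ := fun y => 2 * Qd y / S.p y with hD
  have hρ := S.hρ
  have hκl := S.κ_nonneg S.l S.l_mem
  have hDE : ∫ y in S.l..S.r, D y ^ 2 ≤ 2 / p₀ * (Λ * b) := by
    have h1 : ∫ y in S.l..S.r, D y ^ 2 ≤ ∫ y in S.l..S.r, 2 / p₀ *
        (2 * Qd y * Qd y / S.p y + S.w y * S.κ y * (Ψ y * Ψ y)) := by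
      refine integral_mono_on S.hlr.le (Continuous.intervalIntegrable (by fun_prop) _ _)
        (Continuous.intervalIntegrable (by fun_prop (disch := assumption)) _ _) fun y hy => ?_
      have h2 := hp y hy
      have h3 : 0 ≤ S.w y * S.κ y * (Ψ y * Ψ y) :=
        mul_nonneg (mul_nonneg (S.w_pos hy).le (S.κ_nonneg y hy)) (mul_self_nonneg _)
      have h4 : 2 * Qd y * Qd y / S.p y = S.p y / 2 * D y ^ 2 := by
        have := hpne y
        simp only [hD]; field_simp
      rw [h4]
      calc D y ^ 2 = 2 / p₀ * (p₀ / 2 * D y ^ 2) := by field_simp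
        _ ≤ 2 / p₀ * (S.p y / 2 * D y ^ 2) := by gcongr
        _ ≤ _ := by gcongr; linarith
    rw [intervalIntegral.integral_const_mul] at h1
    refine h1.trans ?_
    have h5 : 0 ≤ S.κ S.l * (Ψ S.l * Ψ S.l) / (2 * S.ρ) :=
      div_nonneg (mul_nonneg hκl (mul_self_nonneg _)) (by positivity)
    gcongr
    linarith
  -- The combination vanishes at `r`, so integrating its derivative from there bounds it by the
  -- energy.
  have hsup : ∀ y ∈ Icc S.l S.r, Ψ y ^ 2 ≤ Y * (2 / p₀ * (Λ * b)) := by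
    intro y hy
    have h1 : ∫ z in y..S.r, D z = Ψ S.r - Ψ y := by
      refine integral_eq_sub_of_hasDerivAt (fun z hz => ?_) (cD.intervalIntegrable _ _)
      rw [uIcc_of_le hy.2] at hz
      exact hder z ⟨hy.1.trans hz.1, hz.2⟩
    have h2 := sq_integral_mul_le hy.2 (f := fun _ => 1) (g := D) continuous_const cD
    simp only [one_mul, one_pow] at h2
    rw [h1, show Ψ S.r = 0 from S.comb_right a, zero_sub, neg_sq, intervalIntegral.integral_const,
      smul_eq_mul, mul_one] at h2
    have h3 : ∫ z in y..S.r, D z ^ 2 ≤ ∫ z in S.l..S.r, D z ^ 2 :=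
      integral_mono_interval hy.1 hy.2 le_rfl (Eventually.of_forall fun z => sq_nonneg _)
        (Continuous.intervalIntegrable (by fun_prop) _ _)
    have h4 : 0 ≤ ∫ z in y..S.r, D z ^ 2 := integral_nonneg hy.2 fun z _ => sq_nonneg _
    calc Ψ y ^ 2 ≤ (S.r - y) * ∫ z in y..S.r, D z ^ 2 := h2
      _ ≤ Y * (2 / p₀ * (Λ * b)) :=
        mul_le_mul (by rw [hY]; linarith [hy.1]) (h3.trans hDE) h4 hlr.le
  have hΛb : 0 ≤ Λ * b := mul_nonneg hΛ.le hb0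
  refine ⟨fun y hy => (hsup y hy).trans ?_, ?_⟩
  · have h1 : 0 ≤ ((1 + 2 * M + A) * (Y * (Y * (2 / p₀)) + 2 / p₀) + 2 / p₀) * (Λ * b) := by
      positivity
    linarith
  · have hΨ2 : ∫ y in S.l..S.r, Ψ y ^ 2 ≤ Y * (Y * (2 / p₀ * (Λ * b))) := by
      have h1 : ∫ y in S.l..S.r, Ψ y ^ 2 ≤ ∫ _ in S.l..S.r, Y * (2 / p₀ * (Λ * b)) :=
        integral_mono_on S.hlr.le (Continuous.intervalIntegrable (by fun_prop) _ _) (by simp) hsup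
      rwa [intervalIntegral.integral_const, smul_eq_mul] at h1
    have hmass : ∀ g : ℝ → ℝ, ∫ y in S.l..S.r, S.w y * (g y * g y) ≤ S.massForm g g := fun g => by
      unfold massForm
      have : 0 ≤ g S.l * g S.l / (2 * S.ρ) := div_nonneg (mul_self_nonneg _) (by positivity)
      linarith
    have hpt : ∫ y in S.l..S.r, (Ψ y ^ 2 + D y ^ 2 +
        |Ψ y * (2 * S.s y * (S.κ y * Ψ y - F y) - 2 * S.c y * D y)|) ≤
        ∫ y in S.l..S.r, ((1 + 2 * M + A) * (Ψ y ^ 2 + D y ^ 2) +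
          (1 / p₀) * (Λ * (S.w y * (Ψ y * Ψ y)) + 1 / Λ * (S.w y * (F y * F y)))) := by
      refine integral_mono_on S.hlr.le (Continuous.intervalIntegrable (by fun_prop) _ _)
        (Continuous.intervalIntegrable (by fun_prop) _ _) fun y hy => ?_
      have m1 := hM y hy
      have a1 := hA y hy
      have hs := S.s_pos y hy
      have hsw : S.s y ≤ 1 / p₀ * S.w y := by
        have h1 := hp y hy
        unfold w
        rw [one_div, inv_mul_eq_div, le_div_iff₀ hp₀]
        nlinarith
      have e1 : Ψ y * (2 * S.s y * (S.κ y * Ψ y - F y) - 2 * S.c y * D y) =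
          2 * (S.s y * S.κ y * Ψ y ^ 2) - S.s y * (2 * (Ψ y * F y)) - S.c y * (2 * (Ψ y * D y)) := by ring
      have e2 : |2 * (S.s y * S.κ y * Ψ y ^ 2)| ≤ 2 * (M * Ψ y ^ 2) := by
        rw [abs_mul, abs_mul, abs_of_pos (show (0 : ℝ) < 2 by norm_num), abs_of_nonneg (sq_nonneg (Ψ y))]
        gcongr
        exact m1
      -- The weights `Λ` and `1 / Λ` are balanced: since the mass of `F` is at most `Λ²` times that
      -- of `Ψ`, both terms contribute `Λ` times the mass. An unweighted estimate would produce
      -- `Λ²`.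
      have e3 : |S.s y * (2 * (Ψ y * F y))| ≤ S.s y * (Λ * (Ψ y * Ψ y) + 1 / Λ * (F y * F y)) := by
        rw [abs_mul, abs_of_pos hs]
        refine mul_le_mul_of_nonneg_left ?_ hs.le
        have q1 : 0 ≤ 1 / Λ * (Λ * Ψ y - F y) ^ 2 := by positivity
        have q2 : 0 ≤ 1 / Λ * (Λ * Ψ y + F y) ^ 2 := by positivity
        have r1 : 1 / Λ * (Λ * Ψ y - F y) ^ 2 =
          Λ * (Ψ y * Ψ y) + 1 / Λ * (F y * F y) - 2 * (Ψ y * F y) := by field_simp; ring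
        have r2 : 1 / Λ * (Λ * Ψ y + F y) ^ 2 =
          Λ * (Ψ y * Ψ y) + 1 / Λ * (F y * F y) + 2 * (Ψ y * F y) := by field_simp; ring
        rw [abs_le]
        constructor <;> linarith
      have e4 : |S.c y * (2 * (Ψ y * D y))| ≤ A * (Ψ y ^ 2 + D y ^ 2) := by
        rw [abs_mul]
        refine mul_le_mul a1 ?_ (abs_nonneg _) hA0
        rw [abs_le]
        constructor <;> nlinarith [sq_nonneg (Ψ y + D y), sq_nonneg (Ψ y - D y)]
      have e5 : S.s y * (Λ * (Ψ y * Ψ y) + 1 / Λ * (F y * F y)) ≤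
          (1 / p₀ * S.w y) * (Λ * (Ψ y * Ψ y) + 1 / Λ * (F y * F y)) := by
        refine mul_le_mul_of_nonneg_right hsw ?_
        have := mul_self_nonneg (Ψ y)
        have := mul_self_nonneg (F y)
        positivity
      have e6 := mul_nonneg hM0 (sq_nonneg (D y))
      rw [e1]
      have e7 := (abs_sub (2 * (S.s y * S.κ y * Ψ y ^ 2) - S.s y * (2 * (Ψ y * F y)))
        (S.c y * (2 * (Ψ y * D y)))).trans (add_le_add_left (abs_sub _ _) _)
      linarith
    refine hpt.trans ?_
    rw [integral_add (Continuous.intervalIntegrable (by fun_prop) _ _)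
      (Continuous.intervalIntegrable (by fun_prop) _ _), intervalIntegral.integral_const_mul,
      intervalIntegral.integral_const_mul, integral_add (Continuous.intervalIntegrable (by fun_prop) _ _)
      (Continuous.intervalIntegrable (by fun_prop) _ _),
      integral_add (Continuous.intervalIntegrable (by fun_prop) _ _)
      (Continuous.intervalIntegrable (by fun_prop) _ _), intervalIntegral.integral_const_mul,
      intervalIntegral.integral_const_mul]
    have g1 : Λ * ∫ y in S.l..S.r, S.w y * (Ψ y * Ψ y) ≤ Λ * b :=
      mul_le_mul_of_nonneg_left (hmass Ψ) hΛ.le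
    have g2 : 1 / Λ * ∫ y in S.l..S.r, S.w y * (F y * F y) ≤ Λ * b := by
      calc _ ≤ 1 / Λ * (Λ ^ 2 * b) := by
            have := (hmass F).trans hL
            gcongr
        _ = Λ * b := by field_simp
    calc _ ≤ (1 + 2 * M + A) * (Y * (Y * (2 / p₀ * (Λ * b))) + 2 / p₀ * (Λ * b)) +
          1 / p₀ * (Λ * b + Λ * b) := by gcongr
      _ = ((1 + 2 * M + A) * (Y * (Y * (2 / p₀)) + 2 / p₀) + 2 / p₀) * (Λ * b) := by ring
      _ ≤ _ := by
        have : 0 ≤ Y * (2 / p₀) * (Λ * b) := by positivity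
        linarith

/-- Rayleigh–Ritz with sampled eigenfunctions: their discrete energy is at most the continuous one
plus `C ε Λ B`, and their discrete mass at least `B (1 - C ε Λ)`, where `B` is the continuous mass
and `Λ` the eigenvalue. The index `j` starts at `0`, hence `eig (j + 1)`. -/
theorem exists_eig_upper (S : StickyCoeff) (K : ℝ) : ∃ h₀ C : ℝ, 0 < h₀ ∧ 0 ≤ C ∧
    ∀ (n : ℕ) (x : ℕ → ℝ) (h t ε : ℝ) (d b : ℕ → ℝ), h ≤ h₀ → S.IsMesh n x h K → S.IsScheme n x t d b →
      h ^ 2 ≤ ε → |S.nodeMass x t 0 - S.idealMass x 0| ≤ ε →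
      ∀ (ev : Fin (n + 1) → ℝ) (f : Fin (n + 1) → Fin (n + 1) → ℝ),
        IsSpectralBasis (birthDeath n d b fun i => S.κ (x i)) (fun i => S.nodeMass x t i) ev f →
        ∀ j : Fin (n + 1), C * ε * S.eig (j + 1) ≤ 1 / 2 →
          ev j * (1 - C * ε * S.eig (j + 1)) ≤ S.eig (j + 1) * (1 + C * ε) := by
  obtain ⟨C₁, hC₁, hcomb⟩ := S.exists_comb_bound
  obtain ⟨h₂, C₂, hh₂, hC₂, hmass⟩ := S.exists_mass_consistency K (k := fun _ => 1) contDiff_const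
  obtain ⟨h₃, C₃, hh₃, hC₃, hkill⟩ := S.exists_mass_consistency K S.hκ
  obtain ⟨h₄, C₄, hh₄, hC₄, hdir⟩ := S.exists_dirichlet_upper K
  refine ⟨min h₂ (min h₃ h₄), 2 * (C₁ * (C₂ + C₃)) + C₄, by positivity, by positivity, ?_⟩
  intro n x h t ε d b hh H hS hε h0 ev f hf j hsmall
  have hh2 : h ≤ h₂ := hh.trans (min_le_left _ _)
  have hh3 : h ≤ h₃ := hh.trans ((min_le_right _ _).trans (min_le_left _ _))
  have hh4 : h ≤ h₄ := hh.trans ((min_le_right _ _).trans (min_le_right _ _))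
  have hε0 : 0 ≤ ε := (sq_nonneg h).trans hε
  have hk : 1 ≤ (j : ℕ) + 1 := by omega
  -- There are `j + 1` eigenfunctions and `j` orthogonality conditions.
  obtain ⟨a, ha0, ha⟩ := exists_ne_zero_forall_sum_eq_zero (ι := Finset.Iio j) (τ := Fin (j + 1))
    (by rw [Fintype.card_coe, Fin.card_Iio, Fintype.card_fin]; omega)
    (fun i s => IsSpectralBasis.coord (fun i => S.nodeMass x t i) f
      (fun q : Fin (n + 1) => S.sol (S.eig (s + 1)) (x q)) i)
  obtain ⟨hsup, hcomb_int⟩ := hcomb _ a hk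
  have hE := S.energy_comb_le a hk
  have hbpos := S.massForm_comb_pos a ha0
  have cΨ := S.continuous_comb a
  have cQ := S.continuous_combQuasi a
  have cL := S.continuous_comb fun i => S.eig (i + 1) * a i
  have hpc := S.continuous_p; have hwc := S.continuous_w; have hκc := S.continuous_κ
  have hsc := S.continuous_s; have hcc := S.continuous_c
  have hpne : ∀ y, S.p y ≠ 0 := fun y => (S.p_pos y).ne'
  set Λ := S.eig (j + 1) with hΛ
  have hΛ0 : 0 < Λ := S.eig_pos hk
  set B := S.massForm (S.comb a) (S.comb a) with hB
  set u : ℕ → ℝ := fun i => S.comb a (x i) with hu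
  have hu0 : u (n + 1) = 0 := by simp only [hu]; rw [H.right, S.comb_right]
  have hcoord : ∀ i < j, IsSpectralBasis.coord (fun i => S.nodeMass x t i) f
      (fun q : Fin (n + 1) => u q) i = 0 := by
    intro i hi
    rw [← ha ⟨i, Finset.mem_Iio.2 hi⟩]
    simp only [IsSpectralBasis.coord, hu, comb, Finset.mul_sum]
    rw [Finset.sum_comm]
    exact Finset.sum_congr rfl fun s _ => Finset.sum_congr rfl fun q _ => by ring
  have hray := hf.le_energy hcoord
  rw [hS.energy hu0, S.sum_nodeMass n x t u] at hray
  have hcell : IsCellwise n x u (fun _ => S.comb a) (fun _ y => 2 * S.combQuasi a y / S.p y)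
      (fun _ y => 2 * S.s y * (S.κ y * S.comb a y - S.comb (fun i => S.eig (i + 1) * a i) y) -
        2 * S.c y * (2 * S.combQuasi a y / S.p y)) := by
    have hsub : ∀ i ≤ n, ∀ y ∈ Icc (x i) (x (i + 1)), y ∈ Icc S.l S.r := fun i hi y hy =>
      ⟨(H.mem (i := i) (by omega)).1.trans hy.1, hy.2.trans (H.mem (i := i + 1) (by omega)).2⟩
    refine ⟨fun _ => cΨ, fun _ => by fun_prop (disch := assumption),
      fun _ => by fun_prop (disch := assumption), fun i hi y hy => S.hasDerivAt_comb a (hsub i hi y hy),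
      fun i hi y hy => ?_, fun i _ => rfl, fun i _ => rfl, hu0⟩
    refine (((S.hasDerivAt_combQuasi a (hsub i hi y hy)).const_mul 2).div (S.hasDerivAt_p y)
      (hpne y)).congr_deriv ?_
    have := hpne y
    unfold w
    field_simp
  have hN : cellNorm n x (fun _ => S.comb a) (fun _ y => 2 * S.combQuasi a y / S.p y)
      (fun _ y => 2 * S.s y * (S.κ y * S.comb a y - S.comb (fun i => S.eig (i + 1) * a i) y) -
        2 * S.c y * (2 * S.combQuasi a y / S.p y)) ≤ C₁ * (Λ * B) := by
    refine le_trans (le_of_eq ?_) hcomb_int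
    rw [cellNorm, sum_integral_adjacent_intervals (a := x), H.left, H.right]
    exact fun i _ => Continuous.intervalIntegrable (by fun_prop (disch := assumption)) _ _
  have hsupu : ∀ i ≤ n, u i ^ 2 ≤ C₁ * (Λ * B) := fun i hi => hsup _ (H.mem (by omega))
  have m1 := hmass n x h t ε hh2 H hε h0 u _ _ _ _ hcell hsupu
  have m2 := hkill n x h t ε hh3 H hε h0 u _ _ _ _ hcell hsupu
  have hadj : ∀ g : ℝ → ℝ, Continuous g →
      ∑ i ∈ Finset.range (n + 1), ∫ y in x i..x (i + 1), g y = ∫ y in S.l..S.r, g y := fun g hg => by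
    rw [sum_integral_adjacent_intervals (a := x) fun i _ => hg.intervalIntegrable _ _, H.left, H.right]
  rw [hadj _ (by fun_prop)] at m1 m2
  have hΛB : 0 ≤ Λ * B := mul_nonneg hΛ0.le hbpos.le
  have hNN : ∀ C, 0 ≤ C → C * ε * (C₁ * (Λ * B) + cellNorm n x (fun _ => S.comb a)
      (fun _ y => 2 * S.combQuasi a y / S.p y)
      (fun _ y => 2 * S.s y * (S.κ y * S.comb a y - S.comb (fun i => S.eig (i + 1) * a i) y) -
        2 * S.c y * (2 * S.combQuasi a y / S.p y))) ≤ 2 * (C₁ * C) * ε * (Λ * B) := fun C hC => by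
    calc _ ≤ C * ε * (C₁ * (Λ * B) + C₁ * (Λ * B)) := by gcongr
      _ = _ := by ring
  have m1' := (abs_le.1 (m1.trans (hNN C₂ hC₂))).1
  have m2' := (abs_le.1 (m2.trans (hNN C₃ hC₃))).2
  have hu0l : u 0 = S.comb a S.l := by simp only [hu, H.left]
  have hBeq : (∫ y in S.l..S.r, S.w y * 1 * S.comb a y ^ 2) + 1 * u 0 ^ 2 / (2 * S.ρ) = B := by
    rw [hB, massForm, hu0l]
    congr 1
    · congr 1; ext y; ring
    · ring
  rw [hBeq] at m1'
  have hmass' : ∑ i ∈ Finset.range (n + 1), S.nodeMass x t i * (1 * u i ^ 2) = S.discreteMass n x t u :=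
    Finset.sum_congr rfl fun i _ => by ring
  rw [hmass'] at m1'
  have hdirsum : ∑ i ∈ Finset.range (n + 1), S.condWeight x i / (2 * gap x i) * (u (i + 1) - u i) ^ 2 ≤
      (1 + C₄ * h ^ 2) * ∫ y in S.l..S.r, S.p y / 2 * (2 * S.combQuasi a y / S.p y) ^ 2 := by
    rw [← hadj _ (by fun_prop (disch := assumption)), Finset.mul_sum]
    refine Finset.sum_le_sum fun i hi => ?_
    have hi' : i ≤ n := by have := Finset.mem_range.1 hi; omega
    exact hdir n x h hh4 H i hi' (S.comb a) _ (hcell.cont' i) (hcell.deriv i hi')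
  have hsplit : (∫ y in S.l..S.r, S.p y / 2 * (2 * S.combQuasi a y / S.p y) ^ 2) +
      ((∫ y in S.l..S.r, S.w y * S.κ y * S.comb a y ^ 2) + S.κ S.l * u 0 ^ 2 / (2 * S.ρ)) ≤ Λ * B := by
    refine le_trans (le_of_eq ?_) hE
    rw [← add_assoc, ← integral_add (Continuous.intervalIntegrable (by fun_prop (disch := assumption)) _ _)
      (Continuous.intervalIntegrable (by fun_prop) _ _), hu0l]
    congr 1
    · congr 1; ext y
      have := hpne y
      field_simp
    · ring
  have hkk : 0 ≤ (∫ y in S.l..S.r, S.w y * S.κ y * S.comb a y ^ 2) + S.κ S.l * u 0 ^ 2 / (2 * S.ρ) := by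
    have hρ := S.hρ
    have := S.κ_nonneg S.l S.l_mem
    refine add_nonneg (integral_nonneg S.hlr.le fun y hy => ?_) (by positivity)
    exact mul_nonneg (mul_nonneg (S.w_pos hy).le (S.κ_nonneg y hy)) (sq_nonneg _)
  have hen : S.discreteEnergy n x t u ≤ Λ * B * (1 + (2 * (C₁ * (C₂ + C₃)) + C₄) * ε) := by
    unfold discreteEnergy
    have g1 : C₄ * h ^ 2 * ∫ y in S.l..S.r, S.p y / 2 * (2 * S.combQuasi a y / S.p y) ^ 2 ≤
        C₄ * ε * (Λ * B) := by
      have hi0 : 0 ≤ ∫ y in S.l..S.r, S.p y / 2 * (2 * S.combQuasi a y / S.p y) ^ 2 :=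
        integral_nonneg S.hlr.le fun y _ => by have := S.p_pos y; positivity
      have : ∫ y in S.l..S.r, S.p y / 2 * (2 * S.combQuasi a y / S.p y) ^ 2 ≤ Λ * B := by linarith
      gcongr
    have g2 : 0 ≤ 2 * (C₁ * C₂) * ε * (Λ * B) := by positivity
    linarith
  have hma : B * (1 - (2 * (C₁ * (C₂ + C₃)) + C₄) * ε * Λ) ≤ S.discreteMass n x t u := by
    have g2 : 0 ≤ 2 * (C₁ * C₃) * ε * (Λ * B) := by positivity
    have g3 : 0 ≤ C₄ * ε * (Λ * B) := by positivity
    linarith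
  set C := 2 * (C₁ * (C₂ + C₃)) + C₄ with hC
  have hC0 : 0 ≤ C := by positivity
  -- The mass bound may be multiplied by `ev j` only if that is nonnegative; for negative `ev j` the
  -- claim is trivial because `1 - C ε Λ` is positive.
  rcases lt_or_ge (ev j) 0 with hneg | hpos
  · have h1 : ev j * (1 - C * ε * Λ) ≤ 0 := mul_nonpos_of_nonpos_of_nonneg hneg.le (by linarith)
    have h2 : 0 ≤ Λ * (1 + C * ε) := by positivity
    linarith
  · have h1 := mul_le_mul_of_nonneg_left hma hpos
    have h2 : B * (ev j * (1 - C * ε * Λ)) ≤ B * (Λ * (1 + C * ε)) := by linarith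
    exact le_of_mul_le_mul_left h2 hbpos

end StickyCoeff

namespace StickyCoeff

/-! ### Lower bound for the discrete eigenvalues -/

/-- The affine interpolant of the nodal values `u` on the `i`-th cell. -/
def interp (x u : ℕ → ℝ) (i : ℕ) (y : ℝ) : ℝ := u i + (u (i + 1) - u i) / gap x i * (y - x i)

variable {S : StickyCoeff} {n : ℕ} {x u : ℕ → ℝ} {h K t : ℝ} {d b : ℕ → ℝ}

theorem interp_left (i : ℕ) : interp x u i (x i) = u i := by simp [interp]

theorem interp_right {i : ℕ} (hg : gap x i ≠ 0) : interp x u i (x (i + 1)) = u (i + 1) := by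
  have : x (i + 1) - x i = gap x i := rfl
  rw [interp, this, div_mul_cancel₀ _ hg]
  ring

theorem hasDerivAt_interp (i : ℕ) (y : ℝ) :
    HasDerivAt (interp x u i) ((u (i + 1) - u i) / gap x i) y := by
  have := (((hasDerivAt_id y).sub_const (x i)).const_mul ((u (i + 1) - u i) / gap x i)).const_add (u i)
  rw [mul_one] at this
  exact this

theorem continuous_interp (i : ℕ) : Continuous (interp x u i) := by unfold interp; fun_prop

theorem interp_sum {τ : Type*} [Fintype τ] (a : τ → ℝ) (v : τ → ℕ → ℝ) (i : ℕ) (y : ℝ) :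
    interp x (fun i => ∑ s, a s * v s i) i y = ∑ s, a s * interp x (v s) i y := by
  simp only [interp]
  rw [← Finset.sum_sub_distrib, Finset.sum_div, Finset.sum_mul, ← Finset.sum_add_distrib]
  exact Finset.sum_congr rfl fun s _ => by ring

theorem IsMesh.isCellwise_interp (H : S.IsMesh n x h K) (hu : u (n + 1) = 0) :
    IsCellwise n x u (interp x u) (fun i _ => (u (i + 1) - u i) / gap x i) (fun _ _ => 0) where
  cont := continuous_interp
  cont' _ := continuous_const
  cont'' _ := continuous_const
  deriv i _ y _ := hasDerivAt_interp i y
  deriv' _ _ y _ := hasDerivAt_const y _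
  left i _ := interp_left i
  right _ hi := interp_right (H.gap_pos hi).ne'
  last := hu

theorem IsMesh.interp_sq_le (H : S.IsMesh n x h K) {i : ℕ} (hi : i ≤ n) {B y : ℝ}
    (h0 : u i ^ 2 ≤ B) (h1 : u (i + 1) ^ 2 ≤ B) (hy : y ∈ Icc (x i) (x (i + 1))) :
    interp x u i y ^ 2 ≤ B := by
  have hg := H.gap_pos hi
  set θ := (y - x i) / gap x i with hθ
  have hθ0 : 0 ≤ θ := div_nonneg (sub_nonneg.2 hy.1) hg.le
  have hθ1 : θ ≤ 1 := by
    rw [hθ, div_le_one hg]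
    exact sub_le_sub_right hy.2 _
  have e : interp x u i y = (1 - θ) * u i + θ * u (i + 1) := by
    rw [interp, hθ]; ring
  have e2 : interp x u i y ^ 2 = (1 - θ) * u i ^ 2 + θ * u (i + 1) ^ 2 -
      (1 - θ) * θ * (u (i + 1) - u i) ^ 2 := by rw [e]; ring
  have e3 : 0 ≤ (1 - θ) * θ * (u (i + 1) - u i) ^ 2 :=
    mul_nonneg (mul_nonneg (by linarith) hθ0) (sq_nonneg _)
  have e4 := mul_le_mul_of_nonneg_left h0 (show 0 ≤ 1 - θ by linarith)
  have e5 := mul_le_mul_of_nonneg_left h1 hθ0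
  linarith

theorem IsMesh.exists_cell (H : S.IsMesh n x h K) {y : ℝ} (hy : y ∈ Ico S.l S.r) :
    ∃ i ≤ n, x i ≤ y ∧ y < x (i + 1) := by
  have hex : ∃ i, y < x (i + 1) := ⟨n, by rw [H.right]; exact hy.2⟩
  classical
  refine ⟨Nat.find hex, Nat.find_min' hex (by rw [H.right]; exact hy.2), ?_, Nat.find_spec hex⟩
  rcases Nat.eq_zero_or_pos (Nat.find hex) with h0 | h0
  · rw [h0, H.left]; exact hy.1
  · have := Nat.find_min hex (Nat.sub_lt h0 one_pos)
    rwa [show Nat.find hex - 1 + 1 = Nat.find hex by omega, not_lt] at this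

/-- Adjacent interpolants agree at their common node. This reconciles the half-open cell assigned to
a zero with the closed cells on which Picone's inequality is used. -/
theorem IsMesh.interp_eq (H : S.IsMesh n x h K) {i j : ℕ} (hi : i ≤ n) (hj : j ≤ n) {y : ℝ}
    (hy : y ∈ Icc (x i) (x (i + 1))) (hj0 : x j ≤ y) (hj1 : y < x (j + 1)) :
    interp x u i y = interp x u j y := by
  rcases lt_trichotomy i j with hij | rfl | hij
  · have h1 : i + 1 = j := by
      by_contra hne
      have h2 := H.lt_succ (i + 1) (by omega)
      have h3 := H.le_of_le (i := i + 1 + 1) (j := j) (by omega) (by omega)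
      have := hy.2
      linarith
    subst h1
    have h2 : y = x (i + 1) := le_antisymm hy.2 hj0
    rw [h2, interp_right (H.gap_pos hi).ne', interp_left]
  · rfl
  · have := H.le_of_le (i := j + 1) (j := i) (by omega) (by omega)
    have := hy.1
    linarith

/-- The quadratic form of the eigenvalue problem is nonnegative on interpolants that vanish at the
zeros of a solution. -/
theorem IsSolution.form_interp_nonneg {lam : ℝ} {φ ψ : ℝ → ℝ} (hφ : S.IsSolution lam φ ψ)
    (hl : φ S.l ≠ 0) (H : S.IsMesh n x h K) (hu : u (n + 1) = 0)
    (hz : ∀ i ≤ n, ∀ y ∈ Icc (x i) (x (i + 1)), φ y = 0 → interp x u i y = 0) :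
    0 ≤ (∑ i ∈ Finset.range (n + 1), ∫ y in x i..x (i + 1),
      (S.p y / 2 * ((u (i + 1) - u i) / gap x i) ^ 2 + S.w y * (S.κ y - lam) * interp x u i y ^ 2)) +
      (S.κ S.l - lam) * u 0 ^ 2 / (2 * S.ρ) := by
  have h1 : ∑ i ∈ Finset.range (n + 1),
      (ψ (x (i + 1)) * u (i + 1) ^ 2 / φ (x (i + 1)) - ψ (x i) * u i ^ 2 / φ (x i)) ≤
      ∑ i ∈ Finset.range (n + 1), ∫ y in x i..x (i + 1),
        (S.p y / 2 * ((u (i + 1) - u i) / gap x i) ^ 2 +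
          S.w y * (S.κ y - lam) * interp x u i y ^ 2) := by
    refine Finset.sum_le_sum fun i hi => ?_
    have hi' : i ≤ n := by have := Finset.mem_range.1 hi; omega
    have := hφ.picone S (H.lt_succ i hi').le (H.mem (i := i) (by omega)).1
      (H.mem (i := i + 1) (by omega)).2 (hasDerivAt_interp (x := x) (u := u) i) continuous_const
      (hz i hi')
    rwa [interp_left, interp_right (H.gap_pos hi').ne'] at this
  -- Picone's boundary terms telescope over the cells. The one at `r` vanishes with `u (n + 1)`,
  -- even where `φ` vanishes, and the one at `l` becomes the sticky atom.
  rw [Finset.sum_range_sub (fun i => ψ (x i) * u i ^ 2 / φ (x i)), hu, H.left] at h1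
  have h2 : ψ S.l * u 0 ^ 2 / φ S.l = (S.κ S.l - lam) * u 0 ^ 2 / (2 * S.ρ) := by
    have hρ := S.hρ.ne'
    have := hφ.left
    field_simp
    linear_combination u 0 ^ 2 * this
  rw [h2] at h1
  simp only [ne_eq, OfNat.ofNat_ne_zero, not_false_eq_true, zero_pow, mul_zero, zero_div, zero_sub] at h1
  linarith

/-- Discrete Poincaré inequality: telescope back from the killed end and apply Cauchy–Schwarz with
weights `gap`. -/
theorem IsMesh.sq_le_sum (H : S.IsMesh n x h K) (hu : u (n + 1) = 0) {i : ℕ} (hi : i ≤ n + 1) :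
    u i ^ 2 ≤ (S.r - S.l) * ∑ i ∈ Finset.range (n + 1), (u (i + 1) - u i) ^ 2 / gap x i := by
  have hpos : ∀ k ∈ Finset.range (n + 1), 0 < gap x k := fun k hk =>
    H.gap_pos (by have := Finset.mem_range.1 hk; omega)
  have hsub : Finset.Ico i (n + 1) ⊆ Finset.range (n + 1) := fun k hk =>
    Finset.mem_range.2 (Finset.mem_Ico.1 hk).2
  have h1 : ∑ k ∈ Finset.Ico i (n + 1), (u (k + 1) - u k) = -u i := by
    rw [Finset.sum_Ico_sub u hi, hu, zero_sub]
  have h2 := Finset.sum_sq_le_sum_mul_sum_of_sq_le_mul (Finset.Ico i (n + 1))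
    (r := fun k => u (k + 1) - u k) (f := fun k => gap x k)
    (g := fun k => (u (k + 1) - u k) ^ 2 / gap x k) (fun k hk => (hpos k (hsub hk)).le)
    (fun k hk => div_nonneg (sq_nonneg _) (hpos k (hsub hk)).le)
    (fun k hk => (mul_div_cancel₀ _ (hpos k (hsub hk)).ne').ge)
  rw [h1, neg_sq] at h2
  refine h2.trans ?_
  rw [← H.sum_gap]
  refine mul_le_mul (Finset.sum_le_sum_of_subset_of_nonneg hsub fun k hk _ => (hpos k hk).le)
    (Finset.sum_le_sum_of_subset_of_nonneg hsub fun k hk _ =>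
      div_nonneg (sq_nonneg _) (hpos k hk).le)
    (Finset.sum_nonneg fun k hk => div_nonneg (sq_nonneg _) (hpos k (hsub hk)).le)
    (Finset.sum_nonneg fun k hk => (hpos k hk).le)

theorem IsMesh.cellNorm_interp_le (H : S.IsMesh n x h K) {B : ℝ} (hB : ∀ i ≤ n + 1, u i ^ 2 ≤ B) :
    cellNorm n x (interp x u) (fun i _ => (u (i + 1) - u i) / gap x i) (fun _ _ => 0) ≤
      (S.r - S.l) * B + ∑ i ∈ Finset.range (n + 1), (u (i + 1) - u i) ^ 2 / gap x i := by
  rw [cellNorm, ← H.sum_gap, Finset.sum_mul, ← Finset.sum_add_distrib]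
  refine Finset.sum_le_sum fun i hi => ?_
  have hi' : i ≤ n := by have := Finset.mem_range.1 hi; omega
  have hg := H.gap_pos hi'
  have hc := continuous_interp (x := x) (u := u) i
  have h1 : ∫ y in x i..x (i + 1), (interp x u i y ^ 2 + ((u (i + 1) - u i) / gap x i) ^ 2 +
      |interp x u i y * 0|) ≤ ∫ _ in x i..x (i + 1), (B + ((u (i + 1) - u i) / gap x i) ^ 2) := by
    refine integral_mono_on (H.lt_succ i hi').le (Continuous.intervalIntegrable (by fun_prop) _ _)
      (by simp) fun y hy => ?_
    rw [mul_zero, abs_zero, add_zero]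
    gcongr
    exact H.interp_sq_le hi' (hB i (by omega)) (hB (i + 1) (by omega)) hy
  refine h1.trans (le_of_eq ?_)
  rw [intervalIntegral.integral_const, smul_eq_mul, show x (i + 1) - x i = gap x i from rfl]
  field_simp

-- The interpolant of a combination of the first `j + 1` eigenvectors can be made to vanish at the
-- at most `j` zeros of the eigenfunction in `[l, r)`. Picone's inequality bounds `Λ` times its mass
-- by its energy, and both are then replaced by their discrete counterparts with errors `C ε` times
-- the discrete energy.
set_option maxHeartbeats 1000000 in
theorem exists_eig_lower (S : StickyCoeff) (K : ℝ) : ∃ h₀ C : ℝ, 0 < h₀ ∧ 0 ≤ C ∧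
    ∀ (n : ℕ) (x : ℕ → ℝ) (h t ε : ℝ) (d b : ℕ → ℝ), h ≤ h₀ → S.IsMesh n x h K → S.IsScheme n x t d b →
      0 < t → h ^ 2 ≤ ε → |S.nodeMass x t 0 - S.idealMass x 0| ≤ ε →
      ∀ (ev : Fin (n + 1) → ℝ) (f : Fin (n + 1) → Fin (n + 1) → ℝ),
        IsSpectralBasis (birthDeath n d b fun i => S.κ (x i)) (fun i => S.nodeMass x t i) ev f →
        ∀ j : Fin (n + 1), S.eig (j + 1) * (1 - C * ε * ev j) ≤ ev j * (1 + C * ε) := by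
  obtain ⟨p₀, hp₀, hp⟩ := exists_pos_le_on_Icc S.continuous_p S.hlr.le fun x _ => S.p_pos x
  obtain ⟨h₂, C₂, hh₂, hC₂, hmass⟩ := S.exists_mass_consistency K (k := fun _ => 1) contDiff_const
  obtain ⟨h₃, C₃, hh₃, hC₃, hkill⟩ := S.exists_mass_consistency K S.hκ
  obtain ⟨h₄, C₄, hh₄, hC₄, hdir⟩ := S.exists_dirichlet_affine K
  have hlr : 0 < S.r - S.l := sub_pos.2 S.hlr
  set Y := S.r - S.l with hY
  set C₅ := 4 / p₀ with hC₅
  set C₆ := C₅ * (Y + Y * Y + 1) with hC₆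
  have hC₅0 : 0 < C₅ := by positivity
  refine ⟨min (min h₂ (min h₃ h₄)) (min 1 (p₀ / (4 * (C₄ + 1)))), (C₂ + C₃) * C₆ + C₄ * C₅,
    by positivity, by positivity, ?_⟩
  intro n x h t ε d b hh H hS ht hε h0 ev f hf j
  have hhA := hh.trans (min_le_left _ _)
  have hhB := hh.trans (min_le_right _ _)
  have hh2 : h ≤ h₂ := hhA.trans (min_le_left _ _)
  have hh3 : h ≤ h₃ := hhA.trans ((min_le_right _ _).trans (min_le_left _ _))
  have hh4 : h ≤ h₄ := hhA.trans ((min_le_right _ _).trans (min_le_right _ _))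
  have hh5 : h ≤ p₀ / (4 * (C₄ + 1)) := hhB.trans (min_le_right _ _)
  have hhpos := H.h_pos
  have hε0 : 0 ≤ ε := (sq_nonneg h).trans hε
  have hk : 1 ≤ (j : ℕ) + 1 := by omega
  set Λ := S.eig (j + 1) with hΛ
  have hΛ0 : 0 < Λ := S.eig_pos hk
  have hsol := S.isSolution_sol Λ
  obtain ⟨z, hz⟩ := S.exists_zeros (lam := Λ) hk (S.angle_eig hk).le
  have hcellz : ∀ y, ∃ i, y ∈ Ico S.l S.r → i ≤ n ∧ x i ≤ y ∧ y < x (i + 1) := fun y => by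
    by_cases hy : y ∈ Ico S.l S.r
    · obtain ⟨i, hi⟩ := H.exists_cell hy
      exact ⟨i, fun _ => hi⟩
    · exact ⟨0, fun h => absurd h hy⟩
  choose cell hcell using hcellz
  let v : Fin (n + 1) → ℕ → ℝ := fun s i => if hi : i < n + 1 then f s ⟨i, hi⟩ else 0
  -- The `j` zeros and the `n - j` higher eigenvectors impose `n` conditions on `n + 1`
  -- coefficients.
  obtain ⟨a, ha0, ha⟩ := exists_ne_zero_forall_sum_eq_zero
    (ι := Fin ((j : ℕ) + 1 - 1) ⊕ ↥(Finset.Ioi j)) (τ := Fin (n + 1))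
    (by
      rw [Fintype.card_sum, Fintype.card_coe, Fin.card_Ioi, Fintype.card_fin, Fintype.card_fin]
      have := j.2
      omega)
    (Sum.elim (fun q s => interp x (v s) (cell (z q)) (z q)) fun q s => if s = q.1 then 1 else 0)
  have ha1 : ∀ i, j < i → a i = 0 := fun i hi => by
    have := ha (Sum.inr ⟨i, Finset.mem_Ioi.2 hi⟩)
    simpa using this
  set u : ℕ → ℝ := fun i => ∑ s, a s * v s i with hu
  have hu0 : u (n + 1) = 0 := by simp [hu, v]
  have huf : ∀ i : Fin (n + 1), u i = ∑ s, a s * f s i := fun i => by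
    simp only [hu, v, dif_pos i.2]
  have huz : ∀ i ≤ n, ∀ y ∈ Icc (x i) (x (i + 1)), S.sol Λ y = 0 → interp x u i y = 0 := by
    intro i hi y hy hy0
    have hyl : S.l ≤ y := (H.mem (i := i) (by omega)).1.trans hy.1
    have hyr : y ≤ S.r := hy.2.trans (H.mem (i := i + 1) (by omega)).2
    rcases hyr.lt_or_eq with hlt | rfl
    · obtain ⟨q, rfl⟩ := hz y ⟨hyl, hlt⟩ hy0
      obtain ⟨c1, c2, c3⟩ := hcell _ ⟨hyl, hlt⟩
      rw [H.interp_eq hi c1 hy c2 c3, hu, interp_sum]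
      exact ha (Sum.inl q)
    · have hin : i = n := by
        by_contra hne
        have h1 := H.lt_succ (i + 1) (by omega)
        have h2 := H.le_of_le (i := i + 1 + 1) (j := n + 1) (by omega) le_rfl
        rw [H.right] at h2
        linarith [hy.2]
      subst hin
      rw [← H.right, interp_right (H.gap_pos le_rfl).ne', hu0]
  have hform := hsol.form_interp_nonneg (S.sol_left_ne_zero Λ) H hu0 huz
  have hE := hf.energy_le ha1
  have hmpos := hf.mass_pos ha0
  simp only [← huf] at hE hmpos
  rw [hS.energy hu0, S.sum_nodeMass n x t u] at hE
  rw [S.sum_nodeMass n x t u] at hmpos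
  set N := ∑ i ∈ Finset.range (n + 1), (u (i + 1) - u i) ^ 2 / gap x i with hN
  set DC := ∑ i ∈ Finset.range (n + 1), ∫ y in x i..x (i + 1),
    S.p y / 2 * ((u (i + 1) - u i) / gap x i) ^ 2 with hDC
  set DD := ∑ i ∈ Finset.range (n + 1), S.condWeight x i / (2 * gap x i) * (u (i + 1) - u i) ^ 2 with hDD
  set E := S.discreteEnergy n x t u with hEdef
  have hpc := S.continuous_p; have hwc := S.continuous_w; have hκc := S.continuous_κ
  have hcu := continuous_interp (x := x) (u := u)
  have hgap : ∀ i ∈ Finset.range (n + 1), 0 < gap x i := fun i hi =>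
    H.gap_pos (by have := Finset.mem_range.1 hi; omega)
  have hN0 : 0 ≤ N := Finset.sum_nonneg fun i hi => div_nonneg (sq_nonneg _) (hgap i hi).le
  have hdir1 : |DC - DD| ≤ C₄ * h ^ 2 * N := by
    rw [hDC, hDD, ← Finset.sum_sub_distrib, hN, Finset.mul_sum]
    refine (Finset.abs_sum_le_sum_abs _ _).trans (Finset.sum_le_sum fun i hi => ?_)
    exact hdir n x h hh4 H i (by have := Finset.mem_range.1 hi; omega) _
  have hdir2 : p₀ / 2 * N ≤ DC := by
    rw [hDC, hN, Finset.mul_sum]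
    refine Finset.sum_le_sum fun i hi => ?_
    have hi' : i ≤ n := by have := Finset.mem_range.1 hi; omega
    have hg := H.gap_pos hi'
    have h1 : ∫ _ in x i..x (i + 1), p₀ / 2 * ((u (i + 1) - u i) / gap x i) ^ 2 ≤
        ∫ y in x i..x (i + 1), S.p y / 2 * ((u (i + 1) - u i) / gap x i) ^ 2 := by
      refine integral_mono_on (H.lt_succ i hi').le (by simp)
        (Continuous.intervalIntegrable (by fun_prop) _ _) fun y hy => ?_
      have := hp y ⟨(H.mem (i := i) (by omega)).1.trans hy.1,
        hy.2.trans (H.mem (i := i + 1) (by omega)).2⟩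
      gcongr
    refine le_trans (le_of_eq ?_) h1
    rw [intervalIntegral.integral_const, smul_eq_mul, show x (i + 1) - x i = gap x i from rfl]
    field_simp
  have hDDE : DD ≤ E := by
    rw [hEdef, discreteEnergy, ← hDD, le_add_iff_nonneg_right]
    refine Finset.sum_nonneg fun i hi => ?_
    have hi' : i ≤ n := by have := Finset.mem_range.1 hi; omega
    exact mul_nonneg (H.nodeMass_pos ht hi').le
      (mul_nonneg (S.κ_nonneg _ (H.mem (by omega))) (sq_nonneg _))
  have hsm : C₄ * h ^ 2 ≤ p₀ / 4 := by
    have h1 : h * (4 * (C₄ + 1)) ≤ p₀ := (le_div_iff₀ (by positivity)).1 hh5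
    have h2 : h ^ 2 ≤ h := by nlinarith [H.le_one]
    nlinarith
  -- For small `h` the consistency error is at most `p₀ / 4 * N` and is absorbed into the coercivity
  -- bound `p₀ / 2 * N ≤ DC`.
  have hNE : N ≤ C₅ * E := by
    have h1 := (abs_le.1 hdir1).2
    have h2 := mul_le_mul_of_nonneg_right hsm hN0
    rw [hC₅, div_mul_eq_mul_div, le_div_iff₀ hp₀]
    linarith
  have hE0 : 0 ≤ E := nonneg_of_mul_nonneg_right (hN0.trans hNE) hC₅0
  have hB : ∀ i ≤ n + 1, u i ^ 2 ≤ Y * N := fun i hi => H.sq_le_sum hu0 hi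
  have hcn := H.cellNorm_interp_le hB
  have hC6 : Y * N + cellNorm n x (interp x u) (fun i _ => (u (i + 1) - u i) / gap x i) (fun _ _ => 0) ≤
      C₆ * E := by
    calc _ ≤ (Y + Y * Y + 1) * N := by linarith
      _ ≤ (Y + Y * Y + 1) * (C₅ * E) := by gcongr
      _ = C₆ * E := by rw [hC₆]; ring
  have m1 := hmass n x h t ε hh2 H hε h0 u _ _ _ (Y * N) (H.isCellwise_interp hu0)
    fun i hi => hB i (by omega)
  have m2 := hkill n x h t ε hh3 H hε h0 u _ _ _ (Y * N) (H.isCellwise_interp hu0)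
    fun i hi => hB i (by omega)
  have m1' := (abs_le.1 (m1.trans (mul_le_mul_of_nonneg_left hC6 (by positivity)))).2
  have m2' := (abs_le.1 (m2.trans (mul_le_mul_of_nonneg_left hC6 (by positivity)))).1
  have hmass' : ∑ i ∈ Finset.range (n + 1), S.nodeMass x t i * (1 * u i ^ 2) = S.discreteMass n x t u :=
    Finset.sum_congr rfl fun i _ => by ring
  rw [hmass'] at m1'
  set m := S.discreteMass n x t u with hm
  set MC := ∑ i ∈ Finset.range (n + 1), ∫ y in x i..x (i + 1), S.w y * 1 * interp x u i y ^ 2 with hMC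
  set KC := ∑ i ∈ Finset.range (n + 1), ∫ y in x i..x (i + 1), S.w y * S.κ y * interp x u i y ^ 2 with hKC
  have hsplit : ∑ i ∈ Finset.range (n + 1), ∫ y in x i..x (i + 1),
      (S.p y / 2 * ((u (i + 1) - u i) / gap x i) ^ 2 + S.w y * (S.κ y - Λ) * interp x u i y ^ 2) =
      DC + KC - Λ * MC := by
    rw [hDC, hKC, hMC, Finset.mul_sum, ← Finset.sum_add_distrib, ← Finset.sum_sub_distrib]
    refine Finset.sum_congr rfl fun i _ => ?_
    have := hcu i
    rw [← integral_add (Continuous.intervalIntegrable (by fun_prop) _ _)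
      (Continuous.intervalIntegrable (by fun_prop) _ _), ← intervalIntegral.integral_const_mul,
      ← integral_sub (Continuous.intervalIntegrable (by fun_prop) _ _)
      (Continuous.intervalIntegrable (by fun_prop) _ _)]
    congr 1; ext y; ring
  rw [hsplit] at hform
  have hEsplit : E = DD + ∑ i ∈ Finset.range (n + 1), S.nodeMass x t i * (S.κ (x i) * u i ^ 2) := rfl
  have hdir3 : DC - DD ≤ C₄ * C₅ * ε * E := by
    refine (abs_le.1 hdir1).2.trans ?_
    calc C₄ * h ^ 2 * N ≤ C₄ * ε * (C₅ * E) := by gcongr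
      _ = _ := by ring
  have hMtot : Λ * (MC + 1 * u 0 ^ 2 / (2 * S.ρ)) ≤ E + (C₃ * C₆ + C₄ * C₅) * ε * E := by
    have e1 : (S.κ S.l - Λ) * u 0 ^ 2 / (2 * S.ρ) =
      S.κ S.l * u 0 ^ 2 / (2 * S.ρ) - Λ * (1 * u 0 ^ 2 / (2 * S.ρ)) := by ring
    rw [e1] at hform
    linarith
  set C := (C₂ + C₃) * C₆ + C₄ * C₅ with hC
  have hC₆0 : 0 ≤ C₆ := by positivity
  have f1 : 0 ≤ C₂ * C₆ * ε * E := by positivity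
  have f2 : 0 ≤ (C₃ * C₆ + C₄ * C₅) * ε * E := by positivity
  have hup : Λ * (MC + 1 * u 0 ^ 2 / (2 * S.ρ)) ≤ E * (1 + C * ε) := by
    rw [hC]; linarith
  have hlow : m - C * ε * E ≤ MC + 1 * u 0 ^ 2 / (2 * S.ρ) := by
    rw [hC]; linarith
  have hC0 : 0 ≤ C := by positivity
  have g1 : m - C * ε * (ev j * m) ≤ MC + 1 * u 0 ^ 2 / (2 * S.ρ) := by
    have := mul_le_mul_of_nonneg_left hE (mul_nonneg hC0 hε0)
    linarith
  have g2 := mul_le_mul_of_nonneg_left g1 hΛ0.le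
  have g3 : E * (1 + C * ε) ≤ ev j * m * (1 + C * ε) :=
    mul_le_mul_of_nonneg_right hE (by positivity)
  have g4 : m * (Λ * (1 - C * ε * ev j)) ≤ m * (ev j * (1 + C * ε)) := by linarith
  exact le_of_mul_le_mul_left g4 hmpos

end StickyCoeff

/-! ### Grids -/

namespace Grid

variable {l r : ℝ} {n : ℕ} (g : Grid l r n)

theorem stepR_le_mesh {i : ℕ} (hi : i ≤ n) : g.stepR i ≤ g.mesh :=
  Finset.le_sup' g.stepR (Finset.mem_range.2 (Nat.lt_succ_of_le hi))

theorem minStep_le_stepR {i : ℕ} (hi : i ≤ n) : g.minStep ≤ g.stepR i :=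
  Finset.inf'_le g.stepR (Finset.mem_range.2 (Nat.lt_succ_of_le hi))

theorem stepR_pos {i : ℕ} (hi : i ≤ n) : 0 < g.stepR i := sub_pos.2 (g.lt_succ i hi)

theorem minStep_pos : 0 < g.minStep := by
  rw [minStep, Finset.lt_inf'_iff]
  exact fun i hi => g.stepR_pos (Nat.lt_succ_iff.1 (Finset.mem_range.1 hi))

theorem mesh_pos : 0 < g.mesh := (g.stepR_pos (Nat.zero_le n)).trans_le (g.stepR_le_mesh (Nat.zero_le n))

theorem sum_stepR : ∑ i ∈ Finset.range (n + 1), g.stepR i = r - l := by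
  unfold stepR
  rw [Finset.sum_range_sub, g.left, g.right]

theorem sub_le_card_mul_mesh : r - l ≤ (n + 1) * g.mesh := by
  have h := Finset.sum_le_card_nsmul (Finset.range (n + 1)) g.stepR g.mesh fun i hi =>
    g.stepR_le_mesh (Nat.lt_succ_iff.1 (Finset.mem_range.1 hi))
  rwa [g.sum_stepR, Finset.card_range, nsmul_eq_mul, Nat.cast_add, Nat.cast_one] at h

theorem card_mul_minStep_le : (n + 1) * g.minStep ≤ r - l := by
  have h := Finset.card_nsmul_le_sum (Finset.range (n + 1)) g.stepR g.minStep fun i hi =>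
    g.minStep_le_stepR (Nat.lt_succ_iff.1 (Finset.mem_range.1 hi))
  rwa [g.sum_stepR, Finset.card_range, nsmul_eq_mul, Nat.cast_add, Nat.cast_one] at h

end Grid

/-! ### The schemes as symmetrizable birth and death chains -/

namespace StickyCoeff

variable {S : StickyCoeff} {D : StickyDiffusion} {n : ℕ}

theorem Represents.mem_Icc (hD : S.Represents D) {y : ℝ} (hy : y ∈ Icc S.l S.r) : y ∈ Icc D.l D.r := by
  rwa [← hD.l_eq, ← hD.r_eq]

/-- Quasi-uniformity enters here: `(n + 1) minStep ≤ r - l` and `mesh ≤ K minStep` bound `n * mesh`.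
-/
theorem Represents.isMesh (hD : S.Represents D) (g : Grid D.l D.r n) {K : ℝ}
    (hK : g.mesh / g.minStep ≤ K) (h1 : g.mesh ≤ 1)
    (hc : ∀ y ∈ Icc S.l S.r, |S.c y| * g.mesh ≤ 1 / 4) :
    S.IsMesh n g.x g.mesh (K * (D.r - D.l)) where
  left := g.left.trans hD.l_eq.symm
  right := g.right.trans hD.r_eq.symm
  lt_succ := g.lt_succ
  step_le _ hi := g.stepR_le_mesh hi
  le_one := h1
  small := hc
  card_le := by
    have h2 := g.minStep_pos
    have h3 := g.mesh_pos
    have hK0 : 0 ≤ K := (div_pos h3 h2).le.trans hK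
    have h4 := (div_le_iff₀ h2).1 hK
    calc (n : ℝ) * g.mesh ≤ (n + 1) * (K * g.minStep) :=
          mul_le_mul (by linarith) h4 h3.le (by positivity)
      _ = K * ((n + 1) * g.minStep) := by ring
      _ ≤ _ := mul_le_mul_of_nonneg_left g.card_mul_minStep_le hK0

/-- The inverse of the boundary factor. -/
def invBeta (S : StickyCoeff) (x : ℕ → ℝ) : Scheme → ℝ
  | .one => 1
  | .two => 1 + (S.ρ * S.s S.l - S.c S.l) * gap x 0

theorem Represents.beta_eq (hD : S.Represents D) (g : Grid D.l D.r n) (s : Scheme) :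
    D.beta g s = 1 / S.invBeta g.x s := by
  cases s with
  | one => simp [StickyDiffusion.beta, invBeta]
  | two =>
    have hlr := S.hlr.le
    rw [hD.l_eq, hD.r_eq] at hlr
    have h1 := hD.c_eq D.l ⟨le_rfl, hlr⟩
    have h2 := hD.s_eq D.l ⟨le_rfl, hlr⟩
    have h3 : D.σ D.l ^ 2 ≠ 0 := right_ne_zero_of_mul_eq_one h2
    have h4 : (D.ρ - D.μ D.l) / D.σ D.l ^ 2 = S.ρ * S.s S.l - S.c S.l := by
      rw [div_eq_iff h3, h1, hD.l_eq, hD.ρ_eq]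
      linear_combination -D.ρ * h2
    rw [StickyDiffusion.beta, g.left, h4]
    rfl

/-- Detailed balance. The denominator of `nodeMass` cancels the factor `1 + c gap` of the up rate,
and the recursion for `condWeight` is what makes the down rate yield the preceding conductance. -/
theorem Represents.isScheme (hD : S.Represents D) (g : Grid D.l D.r n) {h K : ℝ}
    (H : S.IsMesh n g.x h K) (s : Scheme) (ht : 0 < S.invBeta g.x s) :
    S.IsScheme n g.x (S.invBeta g.x s) (D.rateDown g) (D.rateUp s g) where
  down_zero := by simp [StickyDiffusion.rateDown]
  up i hi := by
    have hg := (H.gap_pos hi).ne'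
    cases i with
    | zero =>
      have hρ := S.hρ.ne'
      have := ht.ne'
      rw [StickyDiffusion.rateUp, if_pos rfl, hD.beta_eq, ← hD.ρ_eq, nodeMass,
        show g.stepR 0 = gap g.x 0 from rfl]
      field_simp
    | succ i =>
      have hmem : g.x (i + 1) ∈ Icc D.l D.r :=
        hD.mem_Icc (H.mem (by omega))
      have h1 := hD.c_eq _ hmem
      have h2 := hD.s_eq _ hmem
      have h3 := H.one_add_pos (i := i) (j := i + 1) (by omega) (by omega)
      have hg1 := H.gap_pos (i := i) (by omega)
      have hg2 := H.gap_pos hi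
      have h4 : 1 + S.c (g.x (i + 1)) * gap g.x i ≠ 0 := by linarith
      have h5 : gap g.x i + gap g.x (i + 1) ≠ 0 := by linarith
      rw [StickyDiffusion.rateUp, if_neg (Nat.succ_ne_zero i), nodeMass, Grid.step,
        show g.stepR (i + 1) = gap g.x (i + 1) from rfl, show g.stepL (i + 1) = gap g.x i from rfl, h1]
      have h7 : S.c (g.x (i + 1)) * D.σ (g.x (i + 1)) ^ 2 * gap g.x i + D.σ (g.x (i + 1)) ^ 2 =
        D.σ (g.x (i + 1)) ^ 2 * (1 + S.c (g.x (i + 1)) * gap g.x i) := by ring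
      rw [h7, add_comm (gap g.x (i + 1)), div_mul_div_comm, div_eq_div_iff (by positivity) (by positivity)]
      linear_combination S.condWeight g.x (i + 1) * ((gap g.x i + gap g.x (i + 1)) / 2) *
        (1 + S.c (g.x (i + 1)) * gap g.x i) * (2 * gap g.x (i + 1)) * h2
  down i hi := by
    have hmem : g.x (i + 1) ∈ Icc D.l D.r :=
      hD.mem_Icc (H.mem (by omega))
    have h1 := hD.c_eq _ hmem
    have h2 := hD.s_eq _ hmem
    have h3 := H.one_add_pos (i := i) (j := i + 1) (by omega) (by omega)
    have h3' := H.one_sub_pos (i := i + 1) (j := i + 1) (by omega) (by omega)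
    have hg1 := H.gap_pos (i := i) (by omega)
    have hg2 := H.gap_pos (i := i + 1) (by omega)
    have h4 : 1 + S.c (g.x (i + 1)) * gap g.x i ≠ 0 := by linarith
    have h4' : 1 - S.c (g.x (i + 1)) * gap g.x (i + 1) ≠ 0 := by linarith
    have h5 : gap g.x i + gap g.x (i + 1) ≠ 0 := by linarith
    rw [StickyDiffusion.rateDown, if_neg (Nat.succ_ne_zero i), nodeMass, condWeight, Grid.step,
      show g.stepR (i + 1) = gap g.x (i + 1) from rfl, show g.stepL (i + 1) = gap g.x i from rfl, h1]
    have h7 : -(S.c (g.x (i + 1)) * D.σ (g.x (i + 1)) ^ 2) * gap g.x (i + 1) + D.σ (g.x (i + 1)) ^ 2 =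
      D.σ (g.x (i + 1)) ^ 2 * (1 - S.c (g.x (i + 1)) * gap g.x (i + 1)) := by ring
    rw [h7, add_comm (gap g.x (i + 1))]
    field_simp
    linear_combination S.condWeight g.x i * h2

/-- With `A = c(l)` and `δ` the first step, the weight of node `0` is `exp (A δ) / (2ρβ)`, to be
compared with `1 / (2ρ) + s(l) δ / 2 + O(δ²)`. For `β = 1` the constant terms agree; the factor in
Scheme 2 makes the linear terms agree as well, since `A + (ρ s(l) - A) = ρ s(l)`. -/
theorem exists_boundary_bound (S : StickyCoeff) (s : Scheme) : ∃ h₀ C : ℝ, 0 < h₀ ∧ 1 ≤ C ∧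
    ∀ (n : ℕ) (x : ℕ → ℝ) (h K : ℝ), h ≤ h₀ → S.IsMesh n x h K →
      0 < S.invBeta x s ∧ |S.nodeMass x (S.invBeta x s) 0 - S.idealMass x 0| ≤ C * h ^ s.order := by
  have hρ := S.hρ
  have hs0 := S.s_pos S.l S.l_mem
  set A := S.c S.l with hA
  set s₀ := S.s S.l with hs₀
  set q := S.ρ * s₀ - A with hq
  have key : ∀ (n : ℕ) (x : ℕ → ℝ) (h K : ℝ), S.IsMesh n x h K → 0 < gap x 0 ∧ gap x 0 ≤ h ∧ h ≤ 1 ∧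
      |A * gap x 0| ≤ 1 / 4 ∧ |Real.exp (A * gap x 0) - 1 - A * gap x 0| ≤ A ^ 2 * gap x 0 ^ 2 ∧
      S.idealMass x 0 = 1 / (2 * S.ρ) + s₀ * (gap x 0 / 2 * (1 + A * gap x 0)) ∧
      ∀ t, S.nodeMass x t 0 = Real.exp (A * gap x 0) * t / (2 * S.ρ) := by
    intro n x h K H
    have h1 := H.abs_mul_gap_le (Nat.zero_le n) (Nat.zero_le (n + 1))
    rw [H.left] at h1
    refine ⟨H.gap_pos (Nat.zero_le n), H.step_le 0 (Nat.zero_le n), H.le_one, h1, ?_, ?_, fun t => ?_⟩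
    · rw [← mul_pow]
      exact Real.abs_exp_sub_one_sub_id_le (h1.trans (by norm_num))
    · rw [idealMass, H.left, w, S.p_left, one_mul]
    · rw [nodeMass, condWeight, H.left]
  cases s with
  | one =>
    refine ⟨1, 1 + ((|A| + A ^ 2) / (2 * S.ρ) + s₀), one_pos, ?_, ?_⟩
    · have : 0 ≤ (|A| + A ^ 2) / (2 * S.ρ) + s₀ := by positivity
      linarith
    intro n x h K _ H
    obtain ⟨g0, gh, h1, hAg, hexp, hid, hnode⟩ := key n x h K H
    refine ⟨one_pos, ?_⟩
    rw [hid, hnode, invBeta, Scheme.order, pow_one]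
    set δ := gap x 0
    set R := Real.exp (A * δ) - 1 - A * δ with hR
    have e : Real.exp (A * δ) * 1 / (2 * S.ρ) - (1 / (2 * S.ρ) + s₀ * (δ / 2 * (1 + A * δ))) =
        (A * δ + R) / (2 * S.ρ) - s₀ * (δ / 2 * (1 + A * δ)) := by
      rw [hR]; ring
    have e1 : |(A * δ + R) / (2 * S.ρ)| ≤ (|A| + A ^ 2) / (2 * S.ρ) * δ := by
      rw [abs_div, abs_of_pos (show 0 < 2 * S.ρ by positivity), div_mul_eq_mul_div]
      refine div_le_div_of_nonneg_right ?_ (by positivity)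
      have a1 : |A * δ| = |A| * δ := by rw [abs_mul, abs_of_pos g0]
      have a2 : A ^ 2 * δ ^ 2 ≤ A ^ 2 * δ := by
        refine mul_le_mul_of_nonneg_left ?_ (sq_nonneg A)
        nlinarith
      linarith [abs_add_le (A * δ) R]
    have e2 : |s₀ * (δ / 2 * (1 + A * δ))| ≤ s₀ * δ := by
      have b := abs_le.1 hAg
      have b1 : 0 ≤ δ / 2 * (1 + A * δ) := mul_nonneg (by positivity) (by linarith)
      rw [abs_of_nonneg (mul_nonneg hs0.le b1)]
      refine mul_le_mul_of_nonneg_left ?_ hs0.le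
      nlinarith
    rw [e]
    have e3 := abs_sub ((A * δ + R) / (2 * S.ρ)) (s₀ * (δ / 2 * (1 + A * δ)))
    calc _ ≤ ((|A| + A ^ 2) / (2 * S.ρ) + s₀) * δ := by linarith
      _ ≤ ((|A| + A ^ 2) / (2 * S.ρ) + s₀) * h := by gcongr
      _ ≤ _ := by linarith
  | two =>
    refine ⟨1 / (2 * (|q| + 1)), 1 + A ^ 2 * (2 + |q|) / (2 * S.ρ), by positivity, ?_, ?_⟩
    · have : 0 ≤ A ^ 2 * (2 + |q|) / (2 * S.ρ) := by positivity
      linarith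
    intro n x h K hh H
    obtain ⟨g0, gh, h1, hAg, hexp, hid, hnode⟩ := key n x h K H
    have hqg : |q * gap x 0| ≤ 1 / 2 := by
      rw [abs_mul, abs_of_pos g0]
      have := (le_div_iff₀ (by positivity)).1 (gh.trans hh)
      linarith
    have ht : S.invBeta x .two = 1 + q * gap x 0 := rfl
    refine ⟨by rw [ht]; linarith [(abs_le.1 hqg).1], ?_⟩
    rw [hid, hnode, ht, Scheme.order]
    set δ := gap x 0
    set R := Real.exp (A * δ) - 1 - A * δ with hR
    have e : Real.exp (A * δ) * (1 + q * δ) / (2 * S.ρ) - (1 / (2 * S.ρ) + s₀ * (δ / 2 * (1 + A * δ))) =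
        (R * (1 + q * δ) - A ^ 2 * δ ^ 2) / (2 * S.ρ) := by
      rw [hR, hq]; field_simp; ring
    rw [e, abs_div, abs_of_pos (show 0 < 2 * S.ρ by positivity)]
    have e1 : |R * (1 + q * δ)| ≤ A ^ 2 * δ ^ 2 * (1 + |q|) := by
      rw [abs_mul]
      refine mul_le_mul hexp ?_ (abs_nonneg _) (by positivity)
      have a1 : |q * δ| ≤ |q| := by
        rw [abs_mul, abs_of_pos g0]
        exact mul_le_of_le_one_right (abs_nonneg q) (gh.trans h1)
      have a2 := abs_add_le 1 (q * δ)
      rw [abs_one] at a2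
      linarith
    have e2 := abs_sub (R * (1 + q * δ)) (A ^ 2 * δ ^ 2)
    rw [abs_of_nonneg (show 0 ≤ A ^ 2 * δ ^ 2 by positivity)] at e2
    calc _ ≤ A ^ 2 * δ ^ 2 * (2 + |q|) / (2 * S.ρ) := by
          refine div_le_div_of_nonneg_right ?_ (by positivity)
          linarith
      _ ≤ A ^ 2 * h ^ 2 * (2 + |q|) / (2 * S.ρ) := by gcongr
      _ ≤ (1 + A ^ 2 * (2 + |q|) / (2 * S.ρ)) * h ^ 2 := by
          have := sq_nonneg h
          have e5 : A ^ 2 * h ^ 2 * (2 + |q|) / (2 * S.ρ) = A ^ 2 * (2 + |q|) / (2 * S.ρ) * h ^ 2 := by ring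
          linarith

end StickyCoeff

/-! ### From the two bounds to the rate of convergence -/

/-- The first bound, with `A lam ≤ 1 / 2` and `A ≤ 1`, gives `e ≤ 4 lam`. Inserting this into the
error terms leaves multiples of `lam` and `lam²`. -/
theorem abs_sub_le_of_mul_le {lam e A B : ℝ} (hlam : 0 ≤ lam) (hA : 0 ≤ A) (hB : 0 ≤ B) (hA1 : A ≤ 1)
    (hAl : A * lam ≤ 1 / 2) (h1 : e * (1 - A * lam) ≤ lam * (1 + A)) (h2 : lam * (1 - B * e) ≤ e * (1 + B)) :
    |e - lam| ≤ 4 * (A + B) * (lam + lam ^ 2) := by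
  have he : e ≤ 4 * lam := by
    rcases le_or_gt e 0 with h0 | h0
    · linarith
    · nlinarith
  have g1 := mul_le_mul_of_nonneg_left he (mul_nonneg hA hlam)
  have g2 := mul_le_mul_of_nonneg_left he (mul_nonneg hB (show 0 ≤ 1 + lam by linarith))
  have g3 : 0 ≤ A * lam := mul_nonneg hA hlam
  have g4 : 0 ≤ B * lam := mul_nonneg hB hlam
  have g5 : 0 ≤ A * lam ^ 2 := by positivity
  have g6 : 0 ≤ B * lam ^ 2 := by positivity
  rw [abs_le]
  constructor <;> nlinarith

theorem pow_four_mul_le_one {k : ℕ} {h : ℝ} (hh : 0 < h) (hk : (k : ℝ) ≤ h ^ (-(1 / 4) : ℝ)) :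
    (k : ℝ) ^ 4 * h ≤ 1 := by
  have h1 : (k : ℝ) ^ 4 ≤ (h ^ (-(1 / 4) : ℝ)) ^ 4 := by gcongr
  rw [← Real.rpow_natCast (h ^ (-(1 / 4) : ℝ)), ← Real.rpow_mul hh.le,
    show (-(1 / 4) : ℝ) * ((4 : ℕ) : ℝ) = -1 by norm_num, Real.rpow_neg_one] at h1
  calc (k : ℝ) ^ 4 * h ≤ h⁻¹ * h := by gcongr
    _ = 1 := inv_mul_cancel₀ hh.ne'

/-- Shifts indices from `0, …, n` to `1, …, n + 1`; the reduction modulo `n + 1` in `Fin.ofNat` has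
no effect in that range. -/
theorem isIncreasingEnumeration_of_strictMono {n : ℕ} {ev : Fin (n + 1) → ℝ} (hev : StrictMono ev)
    {Λ : Set ℝ} (hΛ : ∀ lam, lam ∈ Λ ↔ ∃ j, ev j = lam) :
    IsIncreasingEnumeration (Icc 1 (n + 1)) (fun k => ev (Fin.ofNat (n + 1) (k - 1))) Λ := by
  have hval : ∀ k ∈ Icc 1 (n + 1), (Fin.ofNat (n + 1) (k - 1) : ℕ) = k - 1 := fun k hk => by
    rw [Fin.val_ofNat]
    exact Nat.mod_eq_of_lt (by have := hk.1; have := hk.2; omega)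
  refine ⟨fun i hi j hj hij => hev ?_, ?_⟩
  · rw [Fin.lt_def, hval i hi, hval j hj]
    have := hi.1
    omega
  · ext lam
    rw [hΛ]
    constructor
    · rintro ⟨k, _, rfl⟩
      exact ⟨_, rfl⟩
    · rintro ⟨j, rfl⟩
      have hj : (j : ℕ) + 1 ∈ Icc 1 (n + 1) := ⟨by omega, by have := j.2; omega⟩
      refine ⟨j + 1, hj, congrArg ev (Fin.ext ?_)⟩
      rw [hval _ hj]
      omega

theorem proposition4p2 (D : StickyDiffusion) (hlr : D.l < D.r) (hρ : 0 < D.ρ)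
    (hμ : ContDiffOn ℝ 3 D.μ (Set.Icc D.l D.r))
    (hσ : ContDiffOn ℝ 4 (fun x => D.σ x ^ 2) (Set.Icc D.l D.r))
    (hσ_pos : ∀ x ∈ Set.Icc D.l D.r, 0 < D.σ x ^ 2)
    (hκ : ContDiffOn ℝ 2 D.κ (Set.Icc D.l D.r))
    (hκ_nonneg : ∀ x ∈ Set.Icc D.l D.r, 0 ≤ D.κ x) :
    ∃ lam : ℕ → ℝ, IsIncreasingEnumeration (Set.Ici 1) lam D.eigenvalues ∧
      ∀ (s : Scheme) (K : ℝ), ∃ δ : ℝ, 0 < δ ∧ ∃ C : ℝ, 0 < C ∧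
        ∀ (n : ℕ) (g : Grid D.l D.r n), g.mesh < δ → g.mesh / g.minStep ≤ K →
          ∃ lamn : ℕ → ℝ,
            IsIncreasingEnumeration (Set.Icc 1 (n + 1)) lamn (D.ctmcEigenvalues s g) ∧
            ∀ k : ℕ, 1 ≤ k → (k : ℝ) ≤ g.mesh ^ (-(1 / 4) : ℝ) →
              k ≤ n + 1 ∧ |lamn k - lam k| ≤ C * (k : ℝ) ^ 4 * g.mesh ^ s.order := by
  obtain ⟨S, hD⟩ := exists_represents D hlr hρ hμ hσ hσ_pos hκ hκ_nonneg
  refine ⟨S.eig, hD.isIncreasingEnumeration, fun s K => ?_⟩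
  obtain ⟨h₀, C₀, hh₀, hC₀, hbd⟩ := S.exists_boundary_bound s
  obtain ⟨h₁, C₁, hh₁, hC₁, hup⟩ := S.exists_eig_upper (K * (D.r - D.l))
  obtain ⟨h₂, C₂, hh₂, hC₂, hlow⟩ := S.exists_eig_lower (K * (D.r - D.l))
  obtain ⟨C₃, hC₃, hgrow⟩ := S.exists_growth_bound
  obtain ⟨A, hA0, hA⟩ := exists_abs_le_on_Icc S.continuous_c S.l S.r
  have hY : 0 < D.r - D.l := sub_pos.2 hlr
  set η := 1 / (2 * (C₁ * C₀ * C₃) + 1) with hη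
  have hη0 : 0 < η := by positivity
  -- Besides the thresholds of the three estimates and `h < 1`: `1 / (4 (A + 1))` gives the mesh
  -- condition on `c`, `(r - l)⁴` gives `k ≤ n + 1`, `η²` gives `C₁ ε λ_k ≤ 1 / 2`, and the last
  -- entry gives `C₁ ε ≤ 1`.
  refine ⟨min (min (min h₀ h₁) (min h₂ 1)) (min (min (1 / (4 * (A + 1))) ((D.r - D.l) ^ 4))
    (min (η ^ 2) (1 / (C₁ * C₀ + 1)))), by positivity,
    4 * ((C₁ + C₂) * C₀) * (C₃ + C₃ ^ 2) + 1, by positivity, fun n g hmesh hK => ?_⟩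
  simp only [lt_min_iff] at hmesh
  obtain ⟨⟨⟨b0, b1⟩, b2, b3⟩, ⟨b4, b5⟩, b6, b7⟩ := hmesh
  have hm := g.mesh_pos
  have H : S.IsMesh n g.x g.mesh (K * (D.r - D.l)) := by
    refine hD.isMesh g hK b3.le fun y hy => ?_
    have h1 := (lt_div_iff₀ (by positivity)).1 b4
    have h2 := mul_le_mul_of_nonneg_right (hA y hy) hm.le
    linarith
  obtain ⟨ht, hb⟩ := hbd n g.x g.mesh _ b0.le H
  have hS := hD.isScheme g H s ht
  have hnm : ∀ i ≤ n, 0 < S.nodeMass g.x (S.invBeta g.x s) i := fun i hi => H.nodeMass_pos ht hi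
  obtain ⟨ev, f, hf⟩ := exists_isSpectralBasis
    (birthDeath n (D.rateDown g) (D.rateUp s g) fun i => S.κ (g.x i))
    (fun i => S.nodeMass g.x (S.invBeta g.x s) i) (fun i => hnm i (Nat.lt_succ_iff.1 i.2))
    (birthDeath_symm fun i hi => (hS.up i hi.le).trans (hS.down i hi).symm)
  have hmat : D.generatorMatrix s g =
      birthDeath n (D.rateDown g) (D.rateUp s g) fun i => S.κ (g.x i) := by
    ext i j
    have : g.x i ∈ Icc D.l D.r :=
      hD.mem_Icc (H.mem (by have := i.2; omega))
    simp only [StickyDiffusion.generatorMatrix, birthDeath, hD.κ_eq _ this]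
  have hev : StrictMono ev := by
    refine hf.strictMono (z := 0) (birthDeath_eq_zero hS.down_zero fun i hi h0 => ?_)
    have h1 := hS.up i hi.le
    rw [h0, mul_zero] at h1
    exact (div_pos (H.condWeight_pos hi.le) (mul_pos two_pos (H.gap_pos hi.le))).ne h1
  refine ⟨_, isIncreasingEnumeration_of_strictMono hev fun lam => ?_, fun k hk1 hk => ?_⟩
  · rw [← hf.hasEigenvalue_iff, ← hmat]; rfl
  have hk4 := pow_four_mul_le_one hm hk
  have hkR : (1 : ℝ) ≤ k := by exact_mod_cast hk1
  -- Otherwise `r - l ≤ k h`, and `(k h)⁴ ≤ h` contradicts `h < (r - l)⁴`.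
  have hkn : k ≤ n + 1 := by
    by_contra! hlt
    have h1 : ((n : ℝ) + 1) ≤ k := by exact_mod_cast hlt.le
    have h2 : D.r - D.l ≤ k * g.mesh := g.sub_le_card_mul_mesh.trans (by gcongr)
    have h3 : (D.r - D.l) ^ 4 ≤ (k * g.mesh) ^ 4 := by gcongr
    have h4 : (k * g.mesh) ^ 4 ≤ g.mesh := by
      calc (k * g.mesh) ^ 4 = (k : ℝ) ^ 4 * g.mesh * g.mesh ^ 2 * g.mesh := by ring
        _ ≤ 1 * 1 * g.mesh := by
          have : g.mesh ^ 2 ≤ 1 := pow_le_one₀ hm.le b3.le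
          gcongr
        _ = g.mesh := by ring
    linarith
  refine ⟨hkn, ?_⟩
  set j := Fin.ofNat (n + 1) (k - 1) with hj
  have hjk : (j : ℕ) + 1 = k := by
    rw [hj, Fin.val_ofNat, Nat.mod_eq_of_lt (by omega)]
    omega
  set ε := C₀ * g.mesh ^ s.order with hε
  have hs : g.mesh ^ 2 ≤ g.mesh ^ s.order ∧ g.mesh ^ s.order ≤ g.mesh := by
    cases s <;> simp only [Scheme.order] <;> constructor <;> nlinarith
  have hpow : 0 < g.mesh ^ s.order := by positivity
  have hε2 : g.mesh ^ 2 ≤ ε := by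
    rw [hε]
    exact hs.1.trans (le_mul_of_one_le_left hpow.le hC₀)
  have hC₀0 : 0 < C₀ := by linarith
  have hε0 : 0 ≤ ε := by positivity
  have hεm : ε ≤ C₀ * g.mesh := mul_le_mul_of_nonneg_left hs.2 hC₀0.le
  have hΛ0 := S.eig_pos hk1
  have hΛ := hgrow k _ hk1 (S.angle_eig hk1).le
  -- `k⁴ h ≤ 1` gives `k² h ≤ √h`, which explains the entry `η²` in the threshold.
  have hk2 : (k : ℝ) ^ 2 * g.mesh ≤ η := by
    refine le_of_sq_le_sq ?_ hη0.le
    calc ((k : ℝ) ^ 2 * g.mesh) ^ 2 = (k : ℝ) ^ 4 * g.mesh * g.mesh := by ring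
      _ ≤ 1 * g.mesh := by gcongr
      _ ≤ η ^ 2 := by linarith
  have hsmall : C₁ * ε * S.eig k ≤ 1 / 2 := by
    calc C₁ * ε * S.eig k ≤ C₁ * (C₀ * g.mesh) * (C₃ * (k : ℝ) ^ 2) := by gcongr
      _ = C₁ * C₀ * C₃ * ((k : ℝ) ^ 2 * g.mesh) := by ring
      _ ≤ C₁ * C₀ * C₃ * η := by gcongr
      _ ≤ 1 / 2 := by
        rw [hη, mul_one_div, div_le_iff₀ (by positivity)]
        linarith
  have hA1 : C₁ * ε ≤ 1 := by
    have h1 := (lt_div_iff₀ (by positivity)).1 b7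
    have h2 := mul_le_mul_of_nonneg_left hεm hC₁
    linarith
  have hU := hup n g.x g.mesh _ ε _ _ b1.le H hS hε2 hb ev f hf j (by rw [hjk]; exact hsmall)
  have hL := hlow n g.x g.mesh _ ε _ _ b2.le H hS ht hε2 hb ev f hf j
  rw [hjk] at hU hL
  have hfin := abs_sub_le_of_mul_le hΛ0.le (mul_nonneg hC₁ hε0) (mul_nonneg hC₂ hε0) hA1 hsmall hU hL
  have hk24 : (k : ℝ) ^ 2 ≤ (k : ℝ) ^ 4 := pow_le_pow_right₀ hkR (by norm_num)
  calc |ev j - S.eig k| ≤ 4 * (C₁ * ε + C₂ * ε) * (S.eig k + S.eig k ^ 2) := hfin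
    _ ≤ 4 * (C₁ * ε + C₂ * ε) * (C₃ * (k : ℝ) ^ 4 + (C₃ * (k : ℝ) ^ 2) ^ 2) := by
      have : S.eig k ≤ C₃ * (k : ℝ) ^ 4 := hΛ.trans (by gcongr)
      gcongr
    _ = 4 * ((C₁ + C₂) * C₀) * (C₃ + C₃ ^ 2) * ((k : ℝ) ^ 4 * g.mesh ^ s.order) := by rw [hε]; ring
    _ ≤ _ := by
      have : 0 ≤ (k : ℝ) ^ 4 * g.mesh ^ s.order := by positivity
      linarith

end
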